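/- **Setting.** Consider the linear system $x_{t+1}=Ax_t+Bu_t$, $y_t=Cx_t$ with $x_t\in\mathbb R^n$, $u_t\in\mathbb R^m$, $y_t\in\mathbb R^p$, and symmetric cost matrices $Q,R$ with $\ell_0I\preceq Q,R\preceq\ell_1I$, $\|B\|\le\psi$, $\|C\|\le\varphi$ (spectral norms), where $0<\ell_0\le\ell_1$ and $\psi,\varphi\ge1$. The initial state $x_0$ has a law $\mathcal D$ with mean zero, covariance $I_n$ and $\|x_0\|\le d$ almost surely, $d>0$. Fix $\gamma\in(0,1)$. For a static output feedback gain $K\in\mathbb R^{m\times p}$ let $$J_\gamma(K)=\mathbb E_{x_0\sim\mathcal D}\sum_{t=0}^\infty\gamma^t\,(x_t^\top Qx_t+u_t^\top Ru_t)\in[0,\infty],\qquad u_t=-Ky_t,$$ and for $\tau\in\mathbb N$ let $J^{\tau}_{\gamma,x_0}(K)=\sum_{t=0}^{\tau-1}(\tilde x_t^\top Q\tilde x_t+\tilde u_t^\top R\tilde u_t)$ along $\tilde x_{t+1}=\sqrt\gamma(A-BKC)\tilde x_t$, $\tilde x_0=x_0$, $\tilde u_t=-KC\tilde x_t$. **Method.**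 Start from $K^0$ and let $K^{j+1}=K^j-\eta\,\hat g_j$, where $$\hat g_j=\frac{mp}{2rN^e}\sum_{i=1}^{N^e}\Big(J^{\tau^e}_{\gamma,x_0^i}(K^j+rU_i)-J^{\tau^e}_{\gamma,x_0^i}(K^j-rU_i)\Big)U_i,\qquad U_i=\overline U_i/\|\overline U_i\|_F,$$ the $\overline U_i\in\mathbb R^{m\times p}$ have i.i.d. $\mathcal N(0,1)$ entries, $x_0^i\sim\mathcal D$, and all samples are independent, with a fresh batch for every $j$. The method stops at the first $j$ with $\|\hat g_j\|_F\le 2\epsilon/3$ and returns $K^j$. **Constants.** For $\nu$ with $J_\gamma(K^0)\le\nu$, let $\kappa=\sqrt{\nu/\ell_0}$ and $$D=\frac1{8\kappa^3\psi\varphi},\quad G=16\kappa^9\ell_1\psi\varphi,\quad L=104\kappa^{10}\ell_1\psi^2\varphi^2\sqrt{\min\{m,p\}},\quad G^0=2\kappa^3\varphi(\ell_1+\psi\nu)\sqrt{\min\{m,p\}}.$$ **Theorem.** Let $\epsilon>0$, $\delta_0>0$, and let $\tau^e,N^e\in\mathbb N$, $r>0$, $\eta>0$ satisfy $$\tau^e\ge\frac{2\nu}{\ell_0}\log\Big(\frac{36d^2\nu^2mp}{r\epsilon\ell_0}\Big),\quad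 r\le\min\Big\{D,\frac{\nu}{G},\frac{\epsilon}{9L}\Big\},\quad N^e\ge\frac{81(mpG)^2(d^2+1)^2}{\epsilon^2}\log\frac{15}{\delta_0},\quad \eta\le\min\Big\{\frac{D}{G^0+\epsilon},\frac1{2L}\Big\}.$$ Let $M\ge 9J_\gamma(K^0)/(\eta\epsilon^2)$. Then, with probability at least $1-(M+1)\delta_0$, the method stops after some number $j\le M$ of iterations, $J_\gamma$ is differentiable at the returned gain $K^j$ with $\|\nabla J_\gamma(K^j)\|_F\le\epsilon$, and $J_\gamma(K^{i+1})\le J_\gamma(K^i)$ for all $i<j$. -/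

import Mathlib

open MeasureTheory ProbabilityTheory
open scoped Matrix Matrix.Norms.L2Operator

namespace SOF

/-- Vectorized `m × p` gains. The Euclidean norm and inner product are the Frobenius ones. -/
abbrev Gain (m p : ℕ) := EuclideanSpace ℝ (Fin m × Fin p)

/-- The `m × p` matrix of a gain. -/
def Gain.mat {m p : ℕ} (K : Gain m p) : Matrix (Fin m) (Fin p) ℝ :=
  Matrix.of fun i j => K (i, j)

/-- The data of a linear system `x⁺ = A x + B u`, `y = C x` with cost matrices `Q`, `R`. -/
structure Plant (n m p : ℕ) where
  A : Matrix (Fin n) (Fin n) ℝ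
  B : Matrix (Fin n) (Fin m) ℝ
  C : Matrix (Fin p) (Fin n) ℝ
  Q : Matrix (Fin n) (Fin n) ℝ
  R : Matrix (Fin m) (Fin m) ℝ

/-- `ℓ₀ I ⪯ Q, R ⪯ ℓ₁ I`, `‖B‖ ≤ ψ`, `‖C‖ ≤ φ` with spectral norms. -/
structure Plant.Bounded {n m p : ℕ} (S : Plant n m p) (ℓ₀ ℓ₁ ψ φ : ℝ) : Prop where
  Q_lower : (S.Q - ℓ₀ • (1 : Matrix (Fin n) (Fin n) ℝ)).PosSemidef
  Q_upper : (ℓ₁ • (1 : Matrix (Fin n) (Fin n) ℝ) - S.Q).PosSemidef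
  R_lower : (S.R - ℓ₀ • (1 : Matrix (Fin m) (Fin m) ℝ)).PosSemidef
  R_upper : (ℓ₁ • (1 : Matrix (Fin m) (Fin m) ℝ) - S.R).PosSemidef
  B_norm : ‖S.B‖ ≤ ψ
  C_norm : ‖S.C‖ ≤ φ

/-- A law of the initial state with zero mean, identity covariance and support in the
ball of radius `d`. -/
structure IsInitialLaw {n : ℕ} (μ : Measure (EuclideanSpace ℝ (Fin n))) (d : ℝ) : Prop where
  prob : IsProbabilityMeasure μ
  bounded : ∀ᵐ x ∂μ, ‖x‖ ≤ d
  mean_zero : ∫ x, x ∂μ = 0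
  covariance : ∀ i j, ∫ x, x i * x j ∂μ = (1 : Matrix (Fin n) (Fin n) ℝ) i j

/-- The input `u = -K y = -K C x`. -/
def Plant.input {n m p : ℕ} (S : Plant n m p) (K : Gain m p) (x : Fin n → ℝ) : Fin m → ℝ :=
  -(K.mat *ᵥ (S.C *ᵥ x))

/-- The stage cost `xᵀ Q x + uᵀ R u` with `u = -K C x`. -/
def Plant.stage {n m p : ℕ} (S : Plant n m p) (K : Gain m p) (x : Fin n → ℝ) : ℝ :=
  x ⬝ᵥ (S.Q *ᵥ x) + S.input K x ⬝ᵥ (S.R *ᵥ S.input K x)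

/-- The closed-loop state of the original system. -/
def Plant.state {n m p : ℕ} (S : Plant n m p) (K : Gain m p)
    (x₀ : EuclideanSpace ℝ (Fin n)) : ℕ → Fin n → ℝ
  | 0 => x₀.ofLp
  | t + 1 => S.A *ᵥ S.state K x₀ t + S.B *ᵥ S.input K (S.state K x₀ t)

/-- The closed-loop state of the damped system `x⁺ = √γ (A - B K C) x`. -/
noncomputable def Plant.dampedState {n m p : ℕ} (S : Plant n m p) (γ : ℝ) (K : Gain m p)
    (x₀ : EuclideanSpace ℝ (Fin n)) : ℕ → Fin n → ℝ
  | 0 => x₀.ofLp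
  | t + 1 => √γ • ((S.A - S.B * K.mat * S.C) *ᵥ S.dampedState γ K x₀ t)

/-- The discounted cost `J_γ(K) = E ∑ₜ γᵗ (xₜᵀ Q xₜ + uₜᵀ R uₜ)`; it is `∞` when the
expected series diverges. -/
noncomputable def Plant.cost {n m p : ℕ} (S : Plant n m p)
    (μ : Measure (EuclideanSpace ℝ (Fin n))) (γ : ℝ) (K : Gain m p) : ENNReal :=
  ∫⁻ x₀, ∑' t : ℕ, ENNReal.ofReal (γ ^ t * S.stage K (S.state K x₀ t)) ∂μ

/-- `J_γ` as a real-valued function, to be differentiated where `J_γ` is finite. -/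
noncomputable def Plant.costReal {n m p : ℕ} (S : Plant n m p)
    (μ : Measure (EuclideanSpace ℝ (Fin n))) (γ : ℝ) (K : Gain m p) : ℝ :=
  (S.cost μ γ K).toReal

/-- The sublevel set `{K | J_γ(K) ≤ ν}`. -/
def Plant.sublevel {n m p : ℕ} (S : Plant n m p)
    (μ : Measure (EuclideanSpace ℝ (Fin n))) (γ ν : ℝ) : Set (Gain m p) :=
  {K | S.cost μ γ K ≤ ENNReal.ofReal ν}

/-- The cost of one rollout of length `τ` of the damped system. -/
noncomputable def Plant.rollout {n m p : ℕ} (S : Plant n m p) (γ : ℝ) (τ : ℕ) (K : Gain m p)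
    (x₀ : EuclideanSpace ℝ (Fin n)) : ℝ :=
  ∑ t ∈ Finset.range τ, S.stage K (S.dampedState γ K x₀ t)

/-- The two-point estimate `mp/(2rN) ∑ᵢ (J^τ(K + r Uᵢ) - J^τ(K - r Uᵢ)) Uᵢ` with
`Uᵢ = Ūᵢ / ‖Ūᵢ‖_F`, from the raw samples `z i = (Ūᵢ, x₀ⁱ)`. -/
noncomputable def Plant.gradEst {n m p : ℕ} (S : Plant n m p) (γ : ℝ) (τ : ℕ) (r : ℝ) {N : ℕ}
    (z : Fin N → Gain m p × EuclideanSpace ℝ (Fin n)) (K : Gain m p) : Gain m p :=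
  ((m : ℝ) * p / (2 * r * N)) • ∑ i,
    (S.rollout γ τ (K + r • (‖(z i).1‖⁻¹ • (z i).1)) (z i).2
      - S.rollout γ τ (K - r • (‖(z i).1‖⁻¹ • (z i).1)) (z i).2) • (‖(z i).1‖⁻¹ • (z i).1)

/-- The policy gradient iterates `K^{j+1} = K^j - η ĝ_j(K^j)`, where `ĝ_j` uses the
fresh batch of samples `z j`. -/
noncomputable def Plant.iterate {n m p : ℕ} (S : Plant n m p) (γ : ℝ) (τ : ℕ) (r η : ℝ) {N : ℕ}
    (z : ℕ → Fin N → Gain m p × EuclideanSpace ℝ (Fin n)) (K₀ : Gain m p) : ℕ → Gain m p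
  | 0 => K₀
  | j + 1 => S.iterate γ τ r η z K₀ j - η • S.gradEst γ τ r (z j) (S.iterate γ τ r η z K₀ j)

/-- The method stops after `j` iterations and returns `K^j`: the index `j` is the first one
at which the norm of the gradient estimate is at most `2ε/3`. -/
def Plant.StopsAt {n m p : ℕ} (S : Plant n m p) (γ : ℝ) (τ : ℕ) (r η ε : ℝ) {N : ℕ}
    (z : ℕ → Fin N → Gain m p × EuclideanSpace ℝ (Fin n)) (K₀ : Gain m p) (j : ℕ) : Prop :=
  ‖S.gradEst γ τ r (z j) (S.iterate γ τ r η z K₀ j)‖ ≤ 2 * ε / 3 ∧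
    ∀ i < j, 2 * ε / 3 < ‖S.gradEst γ τ r (z i) (S.iterate γ τ r η z K₀ i)‖

/-- `κ = √(ν/ℓ₀)`. -/
noncomputable def kap (ν ℓ₀ : ℝ) : ℝ := √(ν / ℓ₀)

/-- `D = 1/(8 κ³ ψ φ)`. -/
noncomputable def constD (ν ℓ₀ ψ φ : ℝ) : ℝ := 1 / (8 * kap ν ℓ₀ ^ 3 * ψ * φ)

/-- `G = 16 κ⁹ ℓ₁ ψ φ`. -/
noncomputable def constG (ν ℓ₀ ℓ₁ ψ φ : ℝ) : ℝ := 16 * kap ν ℓ₀ ^ 9 * ℓ₁ * ψ * φ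

/-- `L = 104 κ¹⁰ ℓ₁ ψ² φ² √(min{m,p})`. -/
noncomputable def constL (m p : ℕ) (ν ℓ₀ ℓ₁ ψ φ : ℝ) : ℝ :=
  104 * kap ν ℓ₀ ^ 10 * ℓ₁ * ψ ^ 2 * φ ^ 2 * √((min m p : ℕ) : ℝ)

/-- `G⁰ = 2 κ³ φ (ℓ₁ + ψ ν) √(min{m,p})`. -/
noncomputable def constG0 (m p : ℕ) (ν ℓ₀ ℓ₁ ψ φ : ℝ) : ℝ :=
  2 * kap ν ℓ₀ ^ 3 * φ * (ℓ₁ + ψ * ν) * √((min m p : ℕ) : ℝ)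

end SOF

/-! Damping by `√γ` removes the discount, and identity covariance turns the expected cost into a
sum, over the standard basis of initial states, of output energies `∑ₜ ‖(Q^{1/2} x, R^{1/2} K C
x)‖²`. Where this cost is at most `ν`, the square root `e` of the energy is itself a Lyapunov
seminorm: deleting the first output gives `e(F₀ x)² = e(x)² - ‖W₀ x‖²`, and `ℓ₀ ‖x‖² ≤ ‖W₀ x‖²`,
`e(x)² ≤ ν ‖x‖²` make the closed loop contract `e²` by the factor `1 - 1/κ²`. Gains within `D` still
contract (`exists_bounds`). Expanding perturbed trajectories then yields geometric-type series,
hence Lipschitz, second order and truncation bounds with the same constants at every gain of the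
sublevel set (`exists_regularity`).

The two-point estimate has a smoothing bias and a truncation bias. Reflection invariance of the
Gaussian direction gains a factor `1/(mp)` that cancels the prefactor `mp`, so the smoothing bias is
dimension-free (`Plant.RegularAt.norm_integral_sampleEst_sub_le`). The fluctuation obeys Pinelis'
inequality (`measureReal_norm_sum_ge_le`), proved by propagating the expectation of `cosh (l ‖·‖)`
one summand at a time. Together the three errors stay below `ε/3` except with probability `δ₀`
(`measureReal_gradEst_error_le`).

The iterate `K^j` depends on earlier batches only, so the bound for a fixed gain passes to it by
Fubini (`measureReal_iterate_error_le`), and a union bound over `j ≤ M` gives the good event. There,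
each step taken before stopping lowers the cost by at least `η ε²/9` (`cost_step_le`), so the
iterates never leave the sublevel set, and nonnegativity of the cost forces a stop by `M`. At the
stop the gradient is at most `2ε/3 + ε/3` (`exists_stopsAt`). -/

namespace SOF

/-! ### Dimension-free concentration in Hilbert space -/

section Concentration

/-- Convexity of `v ↦ cosh √v` on the nonnegative reals. -/
lemma cosh_le_of_sq_le {w u v z : ℝ} (hw0 : 0 ≤ w) (hw1 : w ≤ 1)
    (hz : z ^ 2 ≤ w * u ^ 2 + (1 - w) * v ^ 2) :
    Real.cosh z ≤ w * Real.cosh u + (1 - w) * Real.cosh v := by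
  -- The Taylor series of `cosh` has nonnegative coefficients in `z ^ 2`, and each power is monotone
  -- and convex on `[0, ∞)`.
  refine hasSum_le (fun k => ?_) (Real.hasSum_cosh z)
    (((Real.hasSum_cosh u).mul_left w).add ((Real.hasSum_cosh v).mul_left (1 - w)))
  have h1 : z ^ (2 * k) ≤ w * u ^ (2 * k) + (1 - w) * v ^ (2 * k) := by
    simp only [pow_mul]
    refine (pow_le_pow_left₀ (sq_nonneg z) hz k).trans ?_
    have := (convexOn_pow k).2 (Set.mem_Ici.2 (sq_nonneg u)) (Set.mem_Ici.2 (sq_nonneg v))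
      hw0 (sub_nonneg.2 hw1) (by ring)
    simpa [smul_eq_mul] using this
  have h2 : (0 : ℝ) < ((2 * k).factorial : ℝ) := by positivity
  rw [← mul_div_assoc, ← mul_div_assoc, ← add_div]
  gcongr

variable {E : Type*} [NormedAddCommGroup E] [InnerProductSpace ℝ E]

/-- With `⟪s, x⟫ = y ‖s‖ b`, the number `‖s + x‖²` is at most the mean of `(‖s‖ + b)²` and `(‖s‖ -
b)²` with weights `(1 ± y)/2`; the addition formulas do the rest. The point is that `c` does not
depend on `x`: the correction is linear and disappears on averaging over a centered law. -/
lemma cosh_norm_add_le (l : ℝ) {b : ℝ} (s : E) :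
    ∃ c : ℝ, ∀ x : E, ‖x‖ ≤ b → Real.cosh (l * ‖s + x‖) ≤
      Real.cosh (l * ‖s‖) * Real.cosh (l * b) + c * inner ℝ s x := by
  refine ⟨Real.sinh (l * ‖s‖) * Real.sinh (l * b) / (‖s‖ * b), fun x hx => ?_⟩
  have hb : 0 ≤ b := (norm_nonneg x).trans hx
  have hin : |inner ℝ s x| ≤ ‖s‖ * b :=
    (abs_real_inner_le_norm s x).trans (by gcongr)
  set y := inner ℝ s x / (‖s‖ * b) with hy
  have hy1 : |y| ≤ 1 := by
    rw [hy, abs_div, abs_of_nonneg (by positivity : 0 ≤ ‖s‖ * b)]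
    exact div_le_one_of_le₀ hin (by positivity)
  have hys : y * (‖s‖ * b) = inner ℝ s x := by
    -- In the degenerate case division by zero sets `y = 0`, which is right because the inner
    -- product vanishes too.
    rcases eq_or_ne (‖s‖ * b) 0 with h | h
    · rw [h] at hin
      rw [h, mul_zero, abs_nonpos_iff.1 hin]
    · rw [hy, div_mul_cancel₀ _ h]
  rw [abs_le] at hy1
  have key := cosh_le_of_sq_le (w := (1 + y) / 2) (u := l * (‖s‖ + b)) (v := l * (‖s‖ - b))
    (z := l * ‖s + x‖) (by linarith) (by linarith) (by
      have h1 : ‖s + x‖ ^ 2 ≤ ‖s‖ ^ 2 + b ^ 2 + 2 * (y * (‖s‖ * b)) := by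
        rw [norm_add_sq_real, hys]
        nlinarith [norm_nonneg x]
      calc (l * ‖s + x‖) ^ 2 = l ^ 2 * ‖s + x‖ ^ 2 := by ring
        _ ≤ l ^ 2 * (‖s‖ ^ 2 + b ^ 2 + 2 * (y * (‖s‖ * b))) := by gcongr
        _ = _ := by ring)
  refine key.trans (le_of_eq ?_)
  have : Real.sinh (l * ‖s‖) * Real.sinh (l * b) / (‖s‖ * b) * inner ℝ s x
      = Real.sinh (l * ‖s‖) * Real.sinh (l * b) * y := by rw [hy]; ring
  rw [this, mul_add, mul_sub, Real.cosh_add, Real.cosh_sub]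
  ring

variable [CompleteSpace E] [MeasurableSpace E] [BorelSpace E] [SecondCountableTopology E]

lemma integral_cosh_norm_add_le (ρ : Measure E) [IsProbabilityMeasure ρ] {b : ℝ}
    (hb : ∀ᵐ x ∂ρ, ‖x‖ ≤ b) (h0 : ∫ x, x ∂ρ = 0) (l : ℝ) (s : E) :
    ∫ x, Real.cosh (l * ‖s + x‖) ∂ρ ≤ Real.cosh (l * ‖s‖) * Real.cosh (l * b) := by
  obtain ⟨c, hc⟩ := cosh_norm_add_le l (b := b) s
  have hint : Integrable (fun x : E => x) ρ :=
    Integrable.of_bound measurable_id.aestronglyMeasurable b hb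
  have hint2 : Integrable (fun x : E => c * inner ℝ s x) ρ :=
    (hint.const_inner s).const_mul c
  calc ∫ x, Real.cosh (l * ‖s + x‖) ∂ρ
      ≤ ∫ x, (Real.cosh (l * ‖s‖) * Real.cosh (l * b) + c * inner ℝ s x) ∂ρ := by
        refine integral_mono_of_nonneg (.of_forall fun x => (Real.cosh_pos _).le)
          ((integrable_const _).add hint2) ?_
        filter_upwards [hb] with x hx using hc x hx
    _ = _ := by
        rw [integral_add (integrable_const _) hint2, integral_const_mul c, integral_inner hint, h0]
        simp

variable {Ω ι : Type*} [MeasurableSpace Ω] {P : Measure Ω} [IsProbabilityMeasure P]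

lemma integral_cosh_norm_sum_le {X : ι → Ω → E} (hX : iIndepFun X P)
    (hm : ∀ i, Measurable (X i)) {b : ℝ} (hb0 : 0 ≤ b) (hb : ∀ i, ∀ᵐ ω ∂P, ‖X i ω‖ ≤ b)
    (h0 : ∀ i, ∫ ω, X i ω ∂P = 0) (l : ℝ) (s : Finset ι) :
    Integrable (fun ω => Real.cosh (l * ‖∑ i ∈ s, X i ω‖)) P ∧
    ∫ ω, Real.cosh (l * ‖∑ i ∈ s, X i ω‖) ∂P ≤ Real.cosh (l * b) ^ s.card := by
  classical
  have hcont : Continuous fun x : E => Real.cosh (l * ‖x‖) := by fun_prop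
  have hint (s : Finset ι) : Integrable (fun ω => Real.cosh (l * ‖∑ i ∈ s, X i ω‖)) P := by
    refine Integrable.of_bound (C := Real.cosh (l * (s.card * b)))
      (hcont.measurable.comp (Finset.measurable_sum s fun i _ => hm i)).aestronglyMeasurable ?_
    have : ∀ᵐ ω ∂P, ∀ i ∈ s, ‖X i ω‖ ≤ b := (ae_ball_iff s.countable_toSet).2 fun i _ => hb i
    filter_upwards [this] with ω hω
    rw [Real.norm_of_nonneg (Real.cosh_pos _).le, Real.cosh_le_cosh, abs_mul, abs_mul, abs_norm,
      abs_of_nonneg (by positivity : (0 : ℝ) ≤ s.card * b)]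
    gcongr
    refine (norm_sum_le _ _).trans ((Finset.sum_le_sum hω).trans (by simp))
  refine ⟨hint s, ?_⟩
  induction s using Finset.induction_on with
  | empty => simp
  | insert i s hi ih =>
    -- The partial sum and the new summand have a product law, so the one-step bound applies with
    -- the partial sum frozen as `s`.
    have hind := (hX.indepFun_finsetSum_of_notMem hm hi).map_prod_eq_prod_map_map
      (Finset.aemeasurable_sum s fun i _ => (hm i).aemeasurable) (hm i).aemeasurable
    have hsm : Measurable (∑ j ∈ s, X j) := by
      simpa [Finset.sum_fn] using Finset.measurable_sum s fun i _ => hm i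
    have hpm : Measurable (fun ω => ((∑ j ∈ s, X j) ω, X i ω)) := hsm.prodMk (hm i)
    have hc2 : Continuous fun x : E × E => Real.cosh (l * ‖x.1 + x.2‖) := by fun_prop
    have e1 : (fun ω => Real.cosh (l * ‖∑ j ∈ insert i s, X j ω‖))
        = fun ω => (fun x : E × E => Real.cosh (l * ‖x.1 + x.2‖)) ((∑ j ∈ s, X j) ω, X i ω) := by
      funext ω
      rw [Finset.sum_insert hi, add_comm]
      simp
    have hi2 := hint (insert i s)
    rw [e1] at hi2 ⊢
    have hi3 := (integrable_map_measure hc2.aestronglyMeasurable hpm.aemeasurable).2 hi2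
    rw [← integral_map hpm.aemeasurable hc2.aestronglyMeasurable]
    rw [hind] at hi3 ⊢
    have := Measure.isProbabilityMeasure_map (μ := P) hsm.aemeasurable
    have := Measure.isProbabilityMeasure_map (μ := P) (hm i).aemeasurable
    rw [integral_prod _ hi3]
    have hb' : ∀ᵐ x ∂(P.map (X i)), ‖x‖ ≤ b :=
      (ae_map_iff (hm i).aemeasurable (measurableSet_le measurable_norm measurable_const)).2 (hb i)
    have h0' : ∫ x, x ∂(P.map (X i)) = 0 := by
      rw [integral_map (hm i).aemeasurable (f := fun x : E => x)
        measurable_id.aestronglyMeasurable]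
      exact h0 i
    have hi4 : Integrable (fun x => Real.cosh (l * ‖x‖)) (P.map (∑ j ∈ s, X j)) := by
      rw [integrable_map_measure hcont.aestronglyMeasurable hsm.aemeasurable]
      simpa [Function.comp_def] using hint s
    calc _ ≤ ∫ x, Real.cosh (l * ‖x‖) * Real.cosh (l * b) ∂(P.map (∑ j ∈ s, X j)) := by
          refine integral_mono hi3.integral_prod_left (hi4.mul_const _) fun x => ?_
          exact integral_cosh_norm_add_le _ hb' h0' l x
      _ = (∫ ω, Real.cosh (l * ‖∑ j ∈ s, X j ω‖) ∂P) * Real.cosh (l * b) := by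
          rw [integral_mul_const, integral_map hsm.aemeasurable hcont.aestronglyMeasurable]
          simp
      _ ≤ Real.cosh (l * b) ^ s.card * Real.cosh (l * b) := by
          gcongr
      _ = _ := by rw [Finset.card_insert_of_notMem hi, pow_succ]

/-- Pinelis' inequality: a sum of independent centered vectors of norm at most `b` in a Hilbert
space has dimension-free subgaussian tails. -/
theorem measureReal_norm_sum_ge_le {X : ι → Ω → E} [Fintype ι] (hX : iIndepFun X P)
    (hm : ∀ i, Measurable (X i)) {b : ℝ} (hb0 : 0 < b) (hb : ∀ i, ∀ᵐ ω ∂P, ‖X i ω‖ ≤ b)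
    (h0 : ∀ i, ∫ ω, X i ω ∂P = 0) {a : ℝ} (ha : 0 ≤ a) (hι : 0 < Fintype.card ι) :
    P.real {ω | a ≤ ‖∑ i, X i ω‖} ≤ 2 * Real.exp (-(a ^ 2 / (2 * Fintype.card ι * b ^ 2))) := by
  set N : ℝ := (Fintype.card ι : ℝ) with hN
  have hN0 : 0 < N := by rw [hN]; exact_mod_cast hι
  -- This `l` minimizes the exponent `N (l b)² / 2 - l a` of the Chernoff bound.
  set l := a / (N * b ^ 2) with hl
  have hl0 : 0 ≤ l := by positivity
  obtain ⟨h1, h2⟩ := integral_cosh_norm_sum_le hX hm hb0.le hb h0 l Finset.univ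
  have h3 := mul_meas_ge_le_integral_of_nonneg (.of_forall fun ω => (Real.cosh_pos _).le) h1
    (Real.cosh (l * a))
  have hsub : P.real {ω | a ≤ ‖∑ i, X i ω‖}
      ≤ P.real {ω | Real.cosh (l * a) ≤ Real.cosh (l * ‖∑ i, X i ω‖)} := by
    refine measureReal_mono fun ω hω => ?_
    simp only [Set.mem_ofPred_eq] at hω ⊢
    rw [Real.cosh_le_cosh, abs_of_nonneg (by positivity), abs_of_nonneg (by positivity)]
    gcongr
  have h4 : Real.cosh (l * b) ^ (Finset.univ : Finset ι).card ≤ Real.exp (N * (l * b) ^ 2 / 2) := by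
    refine (pow_le_pow_left₀ (Real.cosh_pos _).le (Real.cosh_le_exp_half_sq _) _).trans
      (le_of_eq ?_)
    rw [← Real.exp_nat_mul, Finset.card_univ]
    congr 1
    ring
  -- Passing from `cosh` to `exp` here costs the factor `2` of the tail bound.
  have h5 : Real.exp (l * a) / 2 ≤ Real.cosh (l * a) := by
    rw [Real.cosh_eq]
    have := Real.exp_pos (-(l * a))
    linarith
  have h6 : Real.exp (l * a) / 2 * P.real {ω | a ≤ ‖∑ i, X i ω‖}
      ≤ Real.exp (N * (l * b) ^ 2 / 2) := by
    calc _ ≤ Real.cosh (l * a) * P.real {ω | Real.cosh (l * a) ≤ Real.cosh (l * ‖∑ i, X i ω‖)} := by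
          gcongr
      _ ≤ _ := h3.trans (h2.trans h4)
  have h7 : -(a ^ 2 / (2 * N * b ^ 2)) = N * (l * b) ^ 2 / 2 - l * a := by
    rw [hl]; field_simp; ring
  rw [h7, Real.exp_sub, ← mul_div_assoc, le_div_iff₀ (Real.exp_pos _)]
  linarith

end Concentration

/-! ### Series of geometric type with polynomial weights -/

section GeometricSums

variable {ρ q : ℝ}

/-- Partial sum of the negative binomial series `∑ C(t+k, k) s^t = (1 - s)^{-(k+1)}` at `s = 1 -
1/q`. -/
lemma sum_choose_mul_pow_le (hq : 1 ≤ q) (k T : ℕ) :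
    ∑ t ∈ Finset.range T, ((t + k).choose k : ℝ) * (1 - 1 / q) ^ t ≤ q ^ (k + 1) := by
  have hq0 : 0 < q := by linarith
  have h1 : 0 < 1 / q := by positivity
  have h2 : 1 / q ≤ 1 := (div_le_one hq0).2 hq
  have h := hasSum_choose_mul_geometric_of_norm_lt_one k (r := 1 - 1 / q)
    (by rw [Real.norm_of_nonneg (by linarith)]; linarith)
  have e : 1 / (1 - (1 - 1 / q)) ^ (k + 1) = q ^ (k + 1) := by
    rw [sub_sub_cancel, one_div_pow, one_div_one_div]
  rw [e] at h
  exact sum_le_hasSum _ (fun t _ => mul_nonneg (by positivity) (pow_nonneg (by linarith) _)) h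

lemma sum_range_le_of_succ {f g : ℕ → ℝ} {c : ℝ} (h0 : f 0 ≤ 0)
    (h : ∀ t, f (t + 1) ≤ g t)
    (hc : ∀ T, ∑ t ∈ Finset.range T, g t ≤ c) (T : ℕ) : ∑ t ∈ Finset.range T, f t ≤ c := by
  cases T with
  | zero => simpa using hc 0
  | succ T =>
    rw [Finset.sum_range_succ']
    linarith [hc T, Finset.sum_le_sum fun t (_ : t ∈ Finset.range T) => h t]

lemma sum_pow_mul_pow_le (hq : 1 ≤ q) (hρ : ρ ^ 2 ≤ 1 - 1 / q) (T : ℕ) :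
    ∑ t ∈ Finset.range T, ρ ^ t * ρ ^ t ≤ q := by
  refine (Finset.sum_le_sum fun t _ => ?_).trans ((sum_choose_mul_pow_le hq 0 T).trans_eq (by simp))
  rw [← mul_pow, ← pow_two]
  simpa using pow_le_pow_left₀ (sq_nonneg ρ) hρ t

lemma sum_mul_pow_pred_mul_pow_le (hρ1 : ρ ≤ 1) (hq : 1 ≤ q)
    (hρ : ρ ^ 2 ≤ 1 - 1 / q) (T : ℕ) :
    ∑ t ∈ Finset.range T, (t * ρ ^ (t - 1)) * ρ ^ t ≤ q ^ 2 := by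
  have hs : 0 ≤ 1 - 1 / q := (sq_nonneg ρ).trans hρ
  refine sum_range_le_of_succ (g := fun t => ((t + 1).choose 1 : ℝ) * (1 - 1 / q) ^ t) (by simp)
    (fun t => ?_) (sum_choose_mul_pow_le hq 1) T
  have : ρ ^ t * ρ ^ (t + 1) ≤ (1 - 1 / q) ^ t := by
    calc ρ ^ t * ρ ^ (t + 1) = (ρ ^ 2) ^ t * ρ := by ring
      _ ≤ (ρ ^ 2) ^ t * 1 := by gcongr
      _ ≤ (1 - 1 / q) ^ t := by rw [mul_one]; gcongr
  simp only [Nat.choose_one_right, add_tsub_cancel_right]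
  push_cast
  rw [mul_assoc]
  gcongr

lemma sum_choose_two_mul_pow_mul_pow_le (hρ0 : 0 ≤ ρ) (hρ1 : ρ ≤ 1) (hq : 1 ≤ q)
    (hρ : ρ ^ 2 ≤ 1 - 1 / q) (T : ℕ) :
    ∑ t ∈ Finset.range T, (t.choose 2 * ρ ^ (t - 2)) * ρ ^ t ≤ q ^ 3 := by
  have hs : 0 ≤ 1 - 1 / q := (sq_nonneg ρ).trans hρ
  -- The first two terms vanish, so the index is shifted twice; this also gets rid of the truncated
  -- exponent `t - 2`.
  refine sum_range_le_of_succ (f := fun t => (t.choose 2 * ρ ^ (t - 2)) * ρ ^ t)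
    (g := fun t => ((t + 1).choose 2 * ρ ^ (t + 1 - 2)) * ρ ^ (t + 1)) (by simp)
    (fun t => le_rfl) (fun T => ?_) T
  refine sum_range_le_of_succ (g := fun t => ((t + 2).choose 2 : ℝ) * (1 - 1 / q) ^ t) (by simp)
    (fun t => ?_) (sum_choose_mul_pow_le hq 2) T
  have : ρ ^ t * ρ ^ (t + 2) ≤ (1 - 1 / q) ^ t := by
    calc ρ ^ t * ρ ^ (t + 2) = (ρ ^ 2) ^ t * ρ ^ 2 := by ring
      _ ≤ (ρ ^ 2) ^ t * 1 := by gcongr; exact pow_le_one₀ hρ0 hρ1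
      _ ≤ (1 - 1 / q) ^ t := by rw [mul_one]; gcongr
  simp only [add_assoc, Nat.reduceAdd, add_tsub_cancel_right]
  rw [mul_assoc]
  gcongr

lemma sum_sq_mul_pow_pred_le (hq : 1 ≤ q)
    (hρ : ρ ^ 2 ≤ 1 - 1 / q) (T : ℕ) :
    ∑ t ∈ Finset.range T, (t * ρ ^ (t - 1)) * (t * ρ ^ (t - 1)) ≤ 2 * q ^ 3 := by
  have hs : 0 ≤ 1 - 1 / q := (sq_nonneg ρ).trans hρ
  refine sum_range_le_of_succ (g := fun t => 2 * (((t + 2).choose 2 : ℝ) * (1 - 1 / q) ^ t))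
    (by simp) (fun t => ?_) (fun T => ?_) T
  · have h1 : ρ ^ t * ρ ^ t ≤ (1 - 1 / q) ^ t := by
      rw [← mul_pow, ← pow_two]
      gcongr
    -- That is, `(t + 1)² ≤ (t + 2)(t + 1)`.
    have h2 : ((t + 1 : ℕ) : ℝ) * ((t + 1 : ℕ) : ℝ) ≤ 2 * ((t + 2).choose 2 : ℝ) := by
      rw [Nat.cast_choose_two]
      push_cast
      have : (0 : ℝ) ≤ t := by positivity
      nlinarith
    simp only [add_tsub_cancel_right]
    calc _ = (((t + 1 : ℕ) : ℝ) * ((t + 1 : ℕ) : ℝ)) * (ρ ^ t * ρ ^ t) := by ring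
      _ ≤ 2 * ((t + 2).choose 2 : ℝ) * (1 - 1 / q) ^ t := by
          gcongr
          rw [← mul_pow]
          exact pow_nonneg (mul_self_nonneg ρ) t
      _ = _ := by ring
  · rw [← Finset.mul_sum]
    gcongr
    exact sum_choose_mul_pow_le hq 2 T

end GeometricSums

/-! ### Perturbation of contracting linear systems -/

section AffineFamily

/-- A family of autonomous linear systems with outputs, `x⁺ = (F₀ + dF a) x`,
`u = (W₀ + dW a) x`, whose matrices are affine in a parameter `a`. -/
structure AffineFamily (X Y E : Type*) [AddCommGroup X] [Module ℝ X] [NormedAddCommGroup Y]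
    [InnerProductSpace ℝ Y] [NormedAddCommGroup E] [NormedSpace ℝ E] where
  F₀ : X →ₗ[ℝ] X
  W₀ : X →ₗ[ℝ] Y
  dF : E →ₗ[ℝ] X →ₗ[ℝ] X
  dW : E →ₗ[ℝ] X →ₗ[ℝ] Y

variable {X Y E : Type*} [AddCommGroup X] [Module ℝ X] [NormedAddCommGroup Y]
    [InnerProductSpace ℝ Y] [NormedAddCommGroup E] [NormedSpace ℝ E]

namespace AffineFamily

/-- The trajectory for the parameter `a`. -/
def traj (A : AffineFamily X Y E) (a : E) (x : X) : ℕ → X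
  | 0 => x
  | t + 1 => A.F₀ (A.traj a x t) + A.dF a (A.traj a x t)

/-- The output for the parameter `a`. -/
def out (A : AffineFamily X Y E) (a : E) (x : X) (t : ℕ) : Y :=
  A.W₀ (A.traj a x t) + A.dW a (A.traj a x t)

/-- The derivative at `0` of the trajectory in the direction `Δ`. -/
def dtraj (A : AffineFamily X Y E) (Δ : E) (x : X) : ℕ → X
  | 0 => 0
  | t + 1 => A.F₀ (A.dtraj Δ x t) + A.dF Δ (A.traj 0 x t)

/-- The derivative at `0` of the output in the direction `Δ`. -/
def dout (A : AffineFamily X Y E) (Δ : E) (x : X) (t : ℕ) : Y :=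
  A.W₀ (A.dtraj Δ x t) + A.dW Δ (A.traj 0 x t)

/-- Contraction in the seminorm `p` for `‖a‖ ≤ D`, and bounds for the perturbations. -/
structure Bounds (A : AffineFamily X Y E) (p : Seminorm ℝ X) (ρ h σ D : ℝ) : Prop where
  ρ_nonneg : 0 ≤ ρ
  ρ_le_one : ρ ≤ 1
  h_nonneg : 0 ≤ h
  one_le_σ : 1 ≤ σ
  D_nonneg : 0 ≤ D
  contract : ∀ a x, ‖a‖ ≤ D → p (A.F₀ x + A.dF a x) ≤ ρ * p x
  dF_le : ∀ a x, p (A.dF a x) ≤ h * ‖a‖ * p x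
  W₀_le : ∀ x, ‖A.W₀ x‖ ≤ p x
  dW_le : ∀ a x, ‖A.dW a x‖ ≤ σ * h * ‖a‖ * p x
  dW_le' : ∀ a x, ‖a‖ ≤ D → ‖A.dW a x‖ ≤ σ / 8 * p x

variable {A : AffineFamily X Y E} {p : Seminorm ℝ X} {ρ h σ D q : ℝ}

lemma dtraj_add (A : AffineFamily X Y E) (Δ Δ' : E) (x : X) (t : ℕ) :
    A.dtraj (Δ + Δ') x t = A.dtraj Δ x t + A.dtraj Δ' x t := by
  induction t with
  | zero => simp [dtraj]
  | succ t ih => simp only [dtraj, ih, map_add, LinearMap.add_apply]; abel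

lemma dtraj_smul (A : AffineFamily X Y E) (c : ℝ) (Δ : E) (x : X) (t : ℕ) :
    A.dtraj (c • Δ) x t = c • A.dtraj Δ x t := by
  induction t with
  | zero => simp [dtraj]
  | succ t ih => simp only [dtraj, ih, map_smul, LinearMap.smul_apply, smul_add]

lemma dout_add (A : AffineFamily X Y E) (Δ Δ' : E) (x : X) (t : ℕ) :
    A.dout (Δ + Δ') x t = A.dout Δ x t + A.dout Δ' x t := by
  simp only [dout, dtraj_add, map_add, LinearMap.add_apply]; abel

lemma dout_smul (A : AffineFamily X Y E) (c : ℝ) (Δ : E) (x : X) (t : ℕ) :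
    A.dout (c • Δ) x t = c • A.dout Δ x t := by
  simp only [dout, dtraj_smul, map_smul, LinearMap.smul_apply, smul_add]

lemma traj_add (A : AffineFamily X Y E) (a : E) (x : X) (s t : ℕ) :
    A.traj a x (s + t) = A.traj a (A.traj a x s) t := by
  induction t with
  | zero => simp [traj]
  | succ t ih => rw [← add_assoc, traj, ih, traj]

lemma out_add (A : AffineFamily X Y E) (a : E) (x : X) (s t : ℕ) :
    A.out a x (s + t) = A.out a (A.traj a x s) t := by
  simp only [out, traj_add]

lemma Bounds.traj_le (B : A.Bounds p ρ h σ D) {a : E} (ha : ‖a‖ ≤ D) (x : X) (t : ℕ) :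
    p (A.traj a x t) ≤ ρ ^ t * p x := by
  have := B.ρ_nonneg
  induction t with
  | zero => simp [traj]
  | succ t ih =>
    calc p (A.traj a x (t + 1)) ≤ ρ * p (A.traj a x t) := B.contract a _ ha
      _ ≤ ρ * (ρ ^ t * p x) := by gcongr
      _ = _ := by ring

/-- `t ρ^{t-1}` is the convolution of `ρ^t` with itself delayed by one step: the response of a
`ρ`-contraction to a forcing of size `ρ^t`. The truncated exponent at `t = 0` is harmless because
its coefficient vanishes. -/
lemma mul_pow_pred_step (ρ : ℝ) (t : ℕ) :
    ρ * (t * ρ ^ (t - 1)) + ρ ^ t = ((t + 1 : ℕ) : ℝ) * ρ ^ (t + 1 - 1) := by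
  cases t with
  | zero => simp
  | succ t =>
    simp only [add_tsub_cancel_right]; push_cast; ring

/-- Pascal's rule; this is the response to a forcing of size `t ρ^{t-1}`, as met in second order
remainders. -/
lemma choose_two_pow_step (ρ : ℝ) (t : ℕ) :
    ρ * (t.choose 2 * ρ ^ (t - 2)) + t * ρ ^ (t - 1)
      = ((t + 1).choose 2 : ℝ) * ρ ^ (t + 1 - 2) := by
  match t with
  | 0 => simp
  | 1 => simp
  | t + 2 =>
    rw [Nat.choose_succ_succ' (t + 2) 1]
    simp only [show t + 2 - 2 = t by omega, show t + 2 - 1 = t + 1 by omega,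
      show t + 2 + 1 - 2 = t + 1 by omega, Nat.choose_one_right]
    push_cast
    ring

/-- The difference follows the closed loop of `a`, a `ρ`-contraction, driven by `dF (a - b)` acting
on the decaying trajectory of `b`. -/
lemma Bounds.traj_sub_traj_le (B : A.Bounds p ρ h σ D) {a b : E} (ha : ‖a‖ ≤ D) (hb : ‖b‖ ≤ D)
    (x : X) (t : ℕ) :
    p (A.traj a x t - A.traj b x t) ≤ h * ‖a - b‖ * (t * ρ ^ (t - 1)) * p x := by
  have := B.ρ_nonneg
  have := B.h_nonneg
  induction t with
  | zero => simp [traj]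
  | succ t ih =>
    have e : A.traj a x (t + 1) - A.traj b x (t + 1)
        = (A.F₀ (A.traj a x t - A.traj b x t) + A.dF a (A.traj a x t - A.traj b x t))
          + A.dF (a - b) (A.traj b x t) := by
      simp only [traj, map_sub, LinearMap.sub_apply]; abel
    rw [e]
    calc _ ≤ ρ * p (A.traj a x t - A.traj b x t) + h * ‖a - b‖ * p (A.traj b x t) :=
          (map_add_le_add p _ _).trans (add_le_add (B.contract a _ ha) (B.dF_le _ _))
      _ ≤ ρ * (h * ‖a - b‖ * (t * ρ ^ (t - 1)) * p x) + h * ‖a - b‖ * (ρ ^ t * p x) := by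
          gcongr
          exact B.traj_le hb x t
      _ = h * ‖a - b‖ * (ρ * (t * ρ ^ (t - 1)) + ρ ^ t) * p x := by ring
      _ = _ := by rw [mul_pow_pred_step]

lemma Bounds.dtraj_le (B : A.Bounds p ρ h σ D) (Δ : E) (x : X) (t : ℕ) :
    p (A.dtraj Δ x t) ≤ h * ‖Δ‖ * (t * ρ ^ (t - 1)) * p x := by
  have := B.ρ_nonneg
  have := B.h_nonneg
  have h0 : ∀ y, p (A.F₀ y) ≤ ρ * p y := fun y => by
    simpa using B.contract 0 y (by simpa using B.D_nonneg)
  induction t with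
  | zero => simp [dtraj]
  | succ t ih =>
    calc _ ≤ ρ * p (A.dtraj Δ x t) + h * ‖Δ‖ * p (A.traj 0 x t) :=
          (map_add_le_add p _ _).trans (add_le_add (h0 _) (B.dF_le _ _))
      _ ≤ ρ * (h * ‖Δ‖ * (t * ρ ^ (t - 1)) * p x) + h * ‖Δ‖ * (ρ ^ t * p x) := by
          gcongr
          exact B.traj_le (by simpa using B.D_nonneg) x t
      _ = h * ‖Δ‖ * (ρ * (t * ρ ^ (t - 1)) + ρ ^ t) * p x := by ring
      _ = _ := by rw [mul_pow_pred_step]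

/-- The derivative is taken at `0`, not at `b`. The remainder follows the nominal closed loop with
forcing `dF a (x_a - x_b) + dF (a - b) (x_b - x_0)`, whose two terms produce the factor `‖a‖ + ‖b‖`.
Comparing two perturbed points with one common derivative is what the symmetric difference in the
gradient estimate calls for. -/
lemma Bounds.traj_sub_traj_sub_dtraj_le (B : A.Bounds p ρ h σ D) {a b : E} (ha : ‖a‖ ≤ D)
    (hb : ‖b‖ ≤ D) (x : X) (t : ℕ) :
    p (A.traj a x t - A.traj b x t - A.dtraj (a - b) x t)
      ≤ h ^ 2 * ‖a - b‖ * (‖a‖ + ‖b‖) * (t.choose 2 * ρ ^ (t - 2)) * p x := by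
  have := B.ρ_nonneg
  have := B.h_nonneg
  have h0 : ∀ y, p (A.F₀ y) ≤ ρ * p y := fun y => by
    simpa using B.contract 0 y (by simpa using B.D_nonneg)
  have hb0 := fun t => B.traj_sub_traj_le hb (by simpa using B.D_nonneg : ‖(0 : E)‖ ≤ D) x t
  simp only [sub_zero] at hb0
  induction t with
  | zero => simp [traj, dtraj]
  | succ t ih =>
    have e : A.traj a x (t + 1) - A.traj b x (t + 1) - A.dtraj (a - b) x (t + 1)
        = A.F₀ (A.traj a x t - A.traj b x t - A.dtraj (a - b) x t)
          + (A.dF a (A.traj a x t - A.traj b x t)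
            + A.dF (a - b) (A.traj b x t - A.traj 0 x t)) := by
      simp only [traj, dtraj, map_sub, LinearMap.sub_apply]; abel
    rw [e]
    calc _ ≤ ρ * p (A.traj a x t - A.traj b x t - A.dtraj (a - b) x t)
            + (h * ‖a‖ * p (A.traj a x t - A.traj b x t)
              + h * ‖a - b‖ * p (A.traj b x t - A.traj 0 x t)) :=
          (map_add_le_add p _ _).trans (add_le_add (h0 _)
            ((map_add_le_add p _ _).trans (add_le_add (B.dF_le _ _) (B.dF_le _ _))))
      _ ≤ ρ * (h ^ 2 * ‖a - b‖ * (‖a‖ + ‖b‖) * (t.choose 2 * ρ ^ (t - 2)) * p x)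
            + (h * ‖a‖ * (h * ‖a - b‖ * (t * ρ ^ (t - 1)) * p x)
              + h * ‖a - b‖ * (h * ‖b‖ * (t * ρ ^ (t - 1)) * p x)) := by
          gcongr
          · exact B.traj_sub_traj_le ha hb x t
          · exact hb0 t
      _ = h ^ 2 * ‖a - b‖ * (‖a‖ + ‖b‖)
            * (ρ * (t.choose 2 * ρ ^ (t - 2)) + t * ρ ^ (t - 1)) * p x := by ring
      _ = _ := by rw [choose_two_pow_step]

lemma Bounds.out_le (B : A.Bounds p ρ h σ D) {a : E} (ha : ‖a‖ ≤ D) (x : X) (t : ℕ) :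
    ‖A.out a x t‖ ≤ 9 / 8 * σ * ρ ^ t * p x := by
  have := B.one_le_σ
  calc ‖A.out a x t‖ ≤ p (A.traj a x t) + σ / 8 * p (A.traj a x t) :=
        (norm_add_le _ _).trans (add_le_add (B.W₀_le _) (B.dW_le' _ _ ha))
    _ = (1 + σ / 8) * p (A.traj a x t) := by ring
    _ ≤ (9 / 8 * σ) * (ρ ^ t * p x) := by
        gcongr
        · linarith
        · exact B.traj_le ha x t
    _ = _ := by ring

lemma Bounds.out_sub_out_le (B : A.Bounds p ρ h σ D) {a b : E} (ha : ‖a‖ ≤ D) (hb : ‖b‖ ≤ D)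
    (x : X) (t : ℕ) :
    ‖A.out a x t - A.out b x t‖
      ≤ σ * h * ‖a - b‖ * (9 / 8 * (t * ρ ^ (t - 1)) + ρ ^ t) * p x := by
  have := B.one_le_σ
  have := B.ρ_nonneg
  have := B.h_nonneg
  have e : A.out a x t - A.out b x t = (A.W₀ (A.traj a x t - A.traj b x t)
      + A.dW a (A.traj a x t - A.traj b x t)) + A.dW (a - b) (A.traj b x t) := by
    simp only [out, map_sub, LinearMap.sub_apply]; abel
  rw [e]
  calc _ ≤ (p (A.traj a x t - A.traj b x t) + σ / 8 * p (A.traj a x t - A.traj b x t))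
          + σ * h * ‖a - b‖ * p (A.traj b x t) :=
        (norm_add_le _ _).trans (add_le_add ((norm_add_le _ _).trans
          (add_le_add (B.W₀_le _) (B.dW_le' _ _ ha))) (B.dW_le _ _))
    _ = (1 + σ / 8) * p (A.traj a x t - A.traj b x t)
          + σ * h * ‖a - b‖ * p (A.traj b x t) := by ring
    _ ≤ (9 / 8 * σ) * (h * ‖a - b‖ * (t * ρ ^ (t - 1)) * p x)
          + σ * h * ‖a - b‖ * (ρ ^ t * p x) := by
        gcongr
        · linarith
        · exact B.traj_sub_traj_le ha hb x t
        · exact B.traj_le hb x t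
    _ = _ := by ring

lemma Bounds.dout_le (B : A.Bounds p ρ h σ D) (Δ : E) (x : X) (t : ℕ) :
    ‖A.dout Δ x t‖ ≤ σ * h * ‖Δ‖ * (t * ρ ^ (t - 1) + ρ ^ t) * p x := by
  have := B.one_le_σ
  have := B.ρ_nonneg
  have := B.h_nonneg
  calc _ ≤ 1 * p (A.dtraj Δ x t) + σ * h * ‖Δ‖ * p (A.traj 0 x t) := by
        rw [one_mul]
        exact (norm_add_le _ _).trans (add_le_add (B.W₀_le _) (B.dW_le _ _))
    _ ≤ σ * (h * ‖Δ‖ * (t * ρ ^ (t - 1)) * p x) + σ * h * ‖Δ‖ * (ρ ^ t * p x) := by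
        gcongr
        · exact B.dtraj_le Δ x t
        · exact B.traj_le (by simpa using B.D_nonneg) x t
    _ = _ := by ring

lemma Bounds.out_sub_out_sub_dout_le (B : A.Bounds p ρ h σ D) {a b : E} (ha : ‖a‖ ≤ D)
    (hb : ‖b‖ ≤ D) (x : X) (t : ℕ) :
    ‖A.out a x t - A.out b x t - A.dout (a - b) x t‖
      ≤ σ * h ^ 2 * ‖a - b‖ * (‖a‖ + ‖b‖)
        * (t.choose 2 * ρ ^ (t - 2) + t * ρ ^ (t - 1)) * p x := by
  have := B.one_le_σ
  have := B.ρ_nonneg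
  have := B.h_nonneg
  have hb0 := B.traj_sub_traj_le hb (by simpa using B.D_nonneg : ‖(0 : E)‖ ≤ D) x t
  simp only [sub_zero] at hb0
  have e : A.out a x t - A.out b x t - A.dout (a - b) x t
      = A.W₀ (A.traj a x t - A.traj b x t - A.dtraj (a - b) x t)
        + (A.dW a (A.traj a x t - A.traj b x t)
          + A.dW (a - b) (A.traj b x t - A.traj 0 x t)) := by
    simp only [out, dout, map_sub, LinearMap.sub_apply]; abel
  rw [e]
  calc _ ≤ 1 * p (A.traj a x t - A.traj b x t - A.dtraj (a - b) x t)
          + (σ * h * ‖a‖ * p (A.traj a x t - A.traj b x t)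
            + σ * h * ‖a - b‖ * p (A.traj b x t - A.traj 0 x t)) := by
        rw [one_mul]
        exact (norm_add_le _ _).trans (add_le_add (B.W₀_le _)
          ((norm_add_le _ _).trans (add_le_add (B.dW_le _ _) (B.dW_le _ _))))
    _ ≤ σ * (h ^ 2 * ‖a - b‖ * (‖a‖ + ‖b‖) * (t.choose 2 * ρ ^ (t - 2)) * p x)
          + (σ * h * ‖a‖ * (h * ‖a - b‖ * (t * ρ ^ (t - 1)) * p x)
            + σ * h * ‖a - b‖ * (h * ‖b‖ * (t * ρ ^ (t - 1)) * p x)) := by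
        gcongr
        · exact B.traj_sub_traj_sub_dtraj_le ha hb x t
        · exact B.traj_sub_traj_le ha hb x t
    _ = _ := by ring

lemma Bounds.sum_sq_out_le (B : A.Bounds p ρ h σ D) (hq : 1 ≤ q) (hρ : ρ ^ 2 ≤ 1 - 1 / q)
    {a : E} (ha : ‖a‖ ≤ D) (x : X) (T : ℕ) :
    ∑ t ∈ Finset.range T, ‖A.out a x t‖ ^ 2 ≤ (9 / 8 * σ) ^ 2 * q * p x ^ 2 := by
  have := B.one_le_σ
  have := B.ρ_nonneg
  calc _ ≤ ∑ t ∈ Finset.range T, (9 / 8 * σ) ^ 2 * p x ^ 2 * (ρ ^ t * ρ ^ t) := by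
        refine Finset.sum_le_sum fun t _ => ?_
        refine (pow_le_pow_left₀ (norm_nonneg _) (B.out_le ha x t) 2).trans_eq (by ring)
    _ ≤ (9 / 8 * σ) ^ 2 * p x ^ 2 * q := by
        rw [← Finset.mul_sum]
        gcongr
        exact sum_pow_mul_pow_le hq hρ T
    _ = _ := by ring

/-- Lipschitz bound for the output energies. -/
theorem Bounds.sum_abs_sq_sub_sq_le (B : A.Bounds p ρ h σ D) (hq : 1 ≤ q)
    (hρ : ρ ^ 2 ≤ 1 - 1 / q) {a b : E} (ha : ‖a‖ ≤ D) (hb : ‖b‖ ≤ D) (x : X) (T : ℕ) :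
    ∑ t ∈ Finset.range T, |‖A.out a x t‖ ^ 2 - ‖A.out b x t‖ ^ 2|
      ≤ 9 / 4 * (9 / 8 * q ^ 2 + q) * σ ^ 2 * h * ‖a - b‖ * p x ^ 2 := by
  have := B.one_le_σ
  have := B.ρ_nonneg
  have := B.h_nonneg
  have h0 := sum_pow_mul_pow_le hq hρ T
  have h1 := sum_mul_pow_pred_mul_pow_le B.ρ_le_one hq hρ T
  calc _ ≤ ∑ t ∈ Finset.range T, 9 / 4 * σ ^ 2 * h * ‖a - b‖ * p x ^ 2
            * (9 / 8 * (t * ρ ^ (t - 1) * ρ ^ t) + ρ ^ t * ρ ^ t) := by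
        refine Finset.sum_le_sum fun t _ => ?_
        have e : ‖A.out a x t‖ ^ 2 - ‖A.out b x t‖ ^ 2
            = (‖A.out a x t‖ - ‖A.out b x t‖) * (‖A.out a x t‖ + ‖A.out b x t‖) := by ring
        rw [e, abs_mul, abs_of_nonneg (by positivity : 0 ≤ ‖A.out a x t‖ + ‖A.out b x t‖)]
        calc _ ≤ (σ * h * ‖a - b‖ * (9 / 8 * (t * ρ ^ (t - 1)) + ρ ^ t) * p x)
              * (9 / 8 * σ * ρ ^ t * p x + 9 / 8 * σ * ρ ^ t * p x) := by
              gcongr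
              · exact (abs_norm_sub_norm_le _ _).trans (B.out_sub_out_le ha hb x t)
              · exact B.out_le ha x t
              · exact B.out_le hb x t
          _ = _ := by ring
    _ ≤ 9 / 4 * σ ^ 2 * h * ‖a - b‖ * p x ^ 2 * (9 / 8 * q ^ 2 + q) := by
        rw [← Finset.mul_sum, Finset.sum_add_distrib, ← Finset.mul_sum]
        gcongr
    _ = _ := by ring

/-- Second order bound for the output energies. -/
theorem Bounds.sum_abs_sq_sub_sq_sub_inner_le (B : A.Bounds p ρ h σ D) (hq : 1 ≤ q)
    (hρ : ρ ^ 2 ≤ 1 - 1 / q) {a b : E} (ha : ‖a‖ ≤ D) (hb : ‖b‖ ≤ D) (x : X) (T : ℕ) :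
    ∑ t ∈ Finset.range T,
        |‖A.out a x t‖ ^ 2 - ‖A.out b x t‖ ^ 2 - 2 * inner ℝ (A.out 0 x t) (A.dout (a - b) x t)|
      ≤ (9 / 2 * q ^ 3 + 35 / 8 * q ^ 2 + q) * σ ^ 2 * h ^ 2 * (‖a‖ + ‖b‖) * ‖a - b‖
        * p x ^ 2 := by
  have := B.one_le_σ
  have := B.ρ_nonneg
  have := B.h_nonneg
  have hD0 : ‖(0 : E)‖ ≤ D := by simpa using B.D_nonneg
  have h0 := sum_pow_mul_pow_le hq hρ T
  have h1 := sum_mul_pow_pred_mul_pow_le B.ρ_le_one hq hρ T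
  have h2 := sum_choose_two_mul_pow_mul_pow_le B.ρ_nonneg B.ρ_le_one hq hρ T
  have h3 := sum_sq_mul_pow_pred_le hq hρ T
  calc _ ≤ ∑ t ∈ Finset.range T, σ ^ 2 * h ^ 2 * (‖a‖ + ‖b‖) * ‖a - b‖ * p x ^ 2
            * (9 / 4 * (t.choose 2 * ρ ^ (t - 2) * ρ ^ t) + 35 / 8 * (t * ρ ^ (t - 1) * ρ ^ t)
              + 9 / 8 * (t * ρ ^ (t - 1) * (t * ρ ^ (t - 1))) + ρ ^ t * ρ ^ t) := by
        refine Finset.sum_le_sum fun t _ => ?_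
        set u := A.out a x t with hu
        set v := A.out b x t with hv
        set w := A.out 0 x t with hw
        set d := A.dout (a - b) x t with hd
        -- The first inner product contains the second order remainder, the second a product of two
        -- first order quantities.
        have e : ‖u‖ ^ 2 - ‖v‖ ^ 2 - 2 * inner ℝ w d
            = inner ℝ (u - v - d) (u + v) + inner ℝ d ((u - w) + (v - w)) := by
          simp only [← real_inner_self_eq_norm_sq, inner_add_right,
            inner_sub_left, inner_sub_right, real_inner_comm v u, real_inner_comm w d]
          ring
        have hau := B.out_sub_out_le ha hD0 x t
        have hbv := B.out_sub_out_le hb hD0 x t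
        rw [sub_zero] at hau hbv
        rw [e]
        calc _ ≤ ‖u - v - d‖ * (‖u‖ + ‖v‖) + ‖d‖ * (‖u - w‖ + ‖v - w‖) := by
              refine (abs_add_le _ _).trans (add_le_add ?_ ?_)
              · exact (abs_real_inner_le_norm _ _).trans (by gcongr; exact norm_add_le _ _)
              · exact (abs_real_inner_le_norm _ _).trans (by gcongr; exact norm_add_le _ _)
          _ ≤ (σ * h ^ 2 * ‖a - b‖ * (‖a‖ + ‖b‖)
                * (t.choose 2 * ρ ^ (t - 2) + t * ρ ^ (t - 1)) * p x)
              * (9 / 8 * σ * ρ ^ t * p x + 9 / 8 * σ * ρ ^ t * p x)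
              + (σ * h * ‖a - b‖ * (t * ρ ^ (t - 1) + ρ ^ t) * p x)
                * (σ * h * ‖a‖ * (9 / 8 * (t * ρ ^ (t - 1)) + ρ ^ t) * p x
                  + σ * h * ‖b‖ * (9 / 8 * (t * ρ ^ (t - 1)) + ρ ^ t) * p x) := by
              gcongr
              · exact B.out_sub_out_sub_dout_le ha hb x t
              · exact B.out_le ha x t
              · exact B.out_le hb x t
              · exact B.dout_le _ x t
          _ = _ := by ring
    _ ≤ σ ^ 2 * h ^ 2 * (‖a‖ + ‖b‖) * ‖a - b‖ * p x ^ 2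
          * (9 / 4 * q ^ 3 + 35 / 8 * q ^ 2 + 9 / 8 * (2 * q ^ 3) + q) := by
        rw [← Finset.mul_sum, Finset.sum_add_distrib, Finset.sum_add_distrib,
          Finset.sum_add_distrib, ← Finset.mul_sum, ← Finset.mul_sum, ← Finset.mul_sum]
        gcongr
    _ = _ := by ring

end AffineFamily

end AffineFamily

/-! ### The output energy as a Lyapunov seminorm -/

section EnergySeminorm

variable {X Y E : Type*} [AddCommGroup X] [Module ℝ X] [NormedAddCommGroup Y]
    [InnerProductSpace ℝ Y] [NormedAddCommGroup E] [NormedSpace ℝ E]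

namespace AffineFamily

lemma traj_add_state (A : AffineFamily X Y E) (a : E) (x y : X) (t : ℕ) :
    A.traj a (x + y) t = A.traj a x t + A.traj a y t := by
  induction t with
  | zero => simp [traj]
  | succ t ih => simp only [traj, ih, map_add]; abel

lemma traj_smul_state (A : AffineFamily X Y E) (a : E) (c : ℝ) (x : X) (t : ℕ) :
    A.traj a (c • x) t = c • A.traj a x t := by
  induction t with
  | zero => simp [traj]
  | succ t ih => simp only [traj, ih, map_smul, smul_add]

/-- The output at time `t` as a linear function of the initial state. -/
def outLin (A : AffineFamily X Y E) (a : E) (t : ℕ) : X →ₗ[ℝ] Y where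
  toFun x := A.out a x t
  map_add' x y := by simp only [out, traj_add_state, map_add]; abel
  map_smul' c x := by simp only [out, traj_smul_state, map_smul, smul_add, RingHom.id_apply]

lemma outLin_apply (A : AffineFamily X Y E) (a : E) (t : ℕ) (x : X) :
    A.outLin a t x = A.out a x t := rfl

lemma memℓp_out (A : AffineFamily X Y E) {x : X} (h : Summable fun t => ‖A.out 0 x t‖ ^ 2) :
    Memℓp (fun t => A.out 0 x t) 2 := by
  rw [memℓp_gen_iff (by norm_num)]
  simpa using h

/-- The square root of the output energy at the parameter `0`. -/
noncomputable def energy (A : AffineFamily X Y E)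
    (h : ∀ x, Summable fun t => ‖A.out 0 x t‖ ^ 2) : Seminorm ℝ X :=
  (normSeminorm ℝ (lp (fun _ : ℕ => Y) 2)).comp
    (
    { toFun := fun x => ⟨fun t => A.out 0 x t, A.memℓp_out (h x)⟩
      map_add' := fun x y => by
        ext t
        exact (A.outLin 0 t).map_add x y
      map_smul' := fun c x => by
        ext t
        exact (A.outLin 0 t).map_smul c x } : X →ₗ[ℝ] lp (fun _ : ℕ => Y) 2)

lemma hasSum_energy_sq (A : AffineFamily X Y E)
    (h : ∀ x, Summable fun t => ‖A.out 0 x t‖ ^ 2) (x : X) :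
    HasSum (fun t => ‖A.out 0 x t‖ ^ 2) (A.energy h x ^ 2) := by
  have := lp.hasSum_norm (p := 2) (by norm_num)
    (⟨fun t => A.out 0 x t, A.memℓp_out (h x)⟩ : lp (fun _ : ℕ => Y) 2)
  simp only [ENNReal.toReal_ofNat, Real.rpow_ofNat] at this
  exact this

/-- The Lyapunov identity: one step of the system deletes the first term of the output sequence. -/
lemma energy_step (A : AffineFamily X Y E)
    (h : ∀ x, Summable fun t => ‖A.out 0 x t‖ ^ 2) (x : X) :
    A.energy h (A.F₀ x) ^ 2 + ‖A.W₀ x‖ ^ 2 = A.energy h x ^ 2 := by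
  have h1 := (hasSum_nat_add_iff' 1).2 (A.hasSum_energy_sq h x)
  have e : ∀ t, A.out 0 x (t + 1) = A.out 0 (A.F₀ x) t := fun t => by
    rw [add_comm, out_add]; simp [traj]
  simp only [e] at h1
  have h2 := h1.unique (A.hasSum_energy_sq h (A.F₀ x))
  simp only [Finset.range_one, Finset.sum_singleton, out, traj, map_zero, LinearMap.zero_apply,
    add_zero] at h2
  linarith

end AffineFamily

end EnergySeminorm

/-! ### Quadratic forms and matrix norms -/

section Matrices

lemma exists_norm_sq_eq_of_posSemidef {n : ℕ} {Q : Matrix (Fin n) (Fin n) ℝ} (hQ : Q.PosSemidef) :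
    ∃ B : Matrix (Fin n) (Fin n) ℝ, ∀ x : Fin n → ℝ,
      x ⬝ᵥ (Q *ᵥ x) = ‖WithLp.toLp 2 (B *ᵥ x)‖ ^ 2 := by
  open scoped MatrixOrder in
  obtain ⟨B, rfl⟩ := CStarAlgebra.nonneg_iff_eq_star_mul_self.mp hQ.nonneg
  refine ⟨B, fun x => ?_⟩
  rw [EuclideanSpace.real_norm_sq_eq, ← Matrix.mulVec_mulVec, Matrix.dotProduct_mulVec,
    Matrix.star_eq_conjTranspose, Matrix.conjTranspose_eq_transpose_of_trivial,
    Matrix.vecMul_transpose]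
  simp [dotProduct, pow_two]

lemma dotProduct_self_eq_norm_sq {n : ℕ} (x : Fin n → ℝ) : x ⬝ᵥ x = ‖WithLp.toLp 2 x‖ ^ 2 := by
  rw [EuclideanSpace.real_norm_sq_eq]
  simp [dotProduct, pow_two]

lemma le_dotProduct_mulVec {n : ℕ} {Q : Matrix (Fin n) (Fin n) ℝ} {l : ℝ}
    (hQ : (Q - l • (1 : Matrix (Fin n) (Fin n) ℝ)).PosSemidef) (x : Fin n → ℝ) :
    l * ‖WithLp.toLp 2 x‖ ^ 2 ≤ x ⬝ᵥ (Q *ᵥ x) := by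
  have := (Matrix.posSemidef_iff_dotProduct_mulVec.1 hQ).2 x
  rw [Matrix.sub_mulVec, Matrix.smul_mulVec, Matrix.one_mulVec, dotProduct_sub, dotProduct_smul,
    star_trivial, smul_eq_mul, dotProduct_self_eq_norm_sq] at this
  linarith

lemma dotProduct_mulVec_le {n : ℕ} {Q : Matrix (Fin n) (Fin n) ℝ} {l : ℝ}
    (hQ : (l • (1 : Matrix (Fin n) (Fin n) ℝ) - Q).PosSemidef) (x : Fin n → ℝ) :
    x ⬝ᵥ (Q *ᵥ x) ≤ l * ‖WithLp.toLp 2 x‖ ^ 2 := by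
  have := (Matrix.posSemidef_iff_dotProduct_mulVec.1 hQ).2 x
  rw [Matrix.sub_mulVec, Matrix.smul_mulVec, Matrix.one_mulVec, dotProduct_sub, dotProduct_smul,
    star_trivial, smul_eq_mul, dotProduct_self_eq_norm_sq] at this
  linarith

lemma posSemidef_of_sub {n : ℕ} {Q : Matrix (Fin n) (Fin n) ℝ} {l : ℝ} (hl : 0 ≤ l)
    (hQ : (Q - l • (1 : Matrix (Fin n) (Fin n) ℝ)).PosSemidef) : Q.PosSemidef := by
  have h1 : (l • (1 : Matrix (Fin n) (Fin n) ℝ)).PosSemidef := Matrix.PosSemidef.one.smul hl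
  have := hQ.add h1
  simpa using this

lemma norm_mulVec_le {m n : ℕ} (M : Matrix (Fin m) (Fin n) ℝ) (x : Fin n → ℝ) :
    ‖WithLp.toLp 2 (M *ᵥ x)‖ ≤ ‖M‖ * ‖WithLp.toLp 2 x‖ :=
  Matrix.l2_opNorm_mulVec M (WithLp.toLp 2 x)

/-- Cauchy–Schwarz in each row. It lets perturbations of the gain be measured in the Frobenius norm
throughout. -/
lemma norm_mat_mulVec_le {m p : ℕ} (a : Gain m p) (x : Fin p → ℝ) :
    ‖WithLp.toLp 2 (a.mat *ᵥ x)‖ ≤ ‖a‖ * ‖WithLp.toLp 2 x‖ := by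
  rw [← sq_le_sq₀ (norm_nonneg _) (by positivity), mul_pow]
  simp only [EuclideanSpace.real_norm_sq_eq]
  rw [Fintype.sum_prod_type, Finset.sum_mul]
  refine Finset.sum_le_sum fun i _ => ?_
  exact Finset.sum_mul_sq_le_sq_mul_sq Finset.univ (fun j => a (i, j)) x

lemma mat_add {m p : ℕ} (a b : Gain m p) : (a + b).mat = a.mat + b.mat := by
  ext i j; simp [Gain.mat]

lemma mat_smul {m p : ℕ} (c : ℝ) (a : Gain m p) : (c • a).mat = c • a.mat := by
  ext i j; simp [Gain.mat]

end Matrices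

/-! ### The closed loops as an affine family -/

section System

variable {n m p : ℕ}

/-- The damped closed loops at the gains `K + a` as an affine family, with outputs
`(Q^{1/2} x, R^{1/2} (K + a) C x)`; `Bq` and `Br` are the square roots. -/
noncomputable def Plant.family (S : Plant n m p) (γ : ℝ) (K : Gain m p)
    (Bq : Matrix (Fin n) (Fin n) ℝ) (Br : Matrix (Fin m) (Fin m) ℝ) :
    AffineFamily (EuclideanSpace ℝ (Fin n))
      (WithLp 2 (EuclideanSpace ℝ (Fin n) × EuclideanSpace ℝ (Fin m))) (Gain m p) where
  F₀ := Matrix.toEuclideanLin (√γ • (S.A - S.B * K.mat * S.C))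
  W₀ := (WithLp.linearEquiv 2 ℝ _).symm.toLinearMap ∘ₗ
    (Matrix.toEuclideanLin Bq).prod (Matrix.toEuclideanLin (Br * K.mat * S.C))
  dF := Matrix.toEuclideanLin.toLinearMap ∘ₗ
    { toFun := fun a => -(√γ • (S.B * a.mat * S.C))
      map_add' := fun a b => by
        rw [mat_add, Matrix.mul_add, Matrix.add_mul, smul_add, neg_add]
      map_smul' := fun c a => by
        rw [mat_smul, Matrix.mul_smul, Matrix.smul_mul, smul_comm, RingHom.id_apply, smul_neg] }
  dW :=
    { toFun := fun a => (WithLp.linearEquiv 2 ℝ _).symm.toLinearMap ∘ₗ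
        (LinearMap.prod 0 (Matrix.toEuclideanLin (Br * a.mat * S.C)))
      map_add' := fun a b => by
        ext x : 1
        rw [mat_add, Matrix.mul_add, Matrix.add_mul, map_add]
        simp [← WithLp.toLp_add]
      map_smul' := fun c a => by
        ext x : 1
        rw [mat_smul, Matrix.mul_smul, Matrix.smul_mul, map_smul]
        simp [← WithLp.toLp_smul] }

variable {S : Plant n m p} {γ : ℝ} {K : Gain m p} {Bq : Matrix (Fin n) (Fin n) ℝ}
  {Br : Matrix (Fin m) (Fin m) ℝ}

lemma family_F₀_apply (x : EuclideanSpace ℝ (Fin n)) : (S.family γ K Bq Br).F₀ x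
    = WithLp.toLp 2 ((√γ • (S.A - S.B * K.mat * S.C)) *ᵥ x.ofLp) := rfl

lemma family_dF_apply (a : Gain m p) (x : EuclideanSpace ℝ (Fin n)) :
    (S.family γ K Bq Br).dF a x
      = WithLp.toLp 2 ((-(√γ • (S.B * a.mat * S.C))) *ᵥ x.ofLp) := rfl

lemma family_W₀_apply (x : EuclideanSpace ℝ (Fin n)) : (S.family γ K Bq Br).W₀ x
    = WithLp.toLp 2 (WithLp.toLp 2 (Bq *ᵥ x.ofLp),
        WithLp.toLp 2 ((Br * K.mat * S.C) *ᵥ x.ofLp)) := rfl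

lemma family_dW_apply (a : Gain m p) (x : EuclideanSpace ℝ (Fin n)) :
    (S.family γ K Bq Br).dW a x
      = WithLp.toLp 2 (0, WithLp.toLp 2 ((Br * a.mat * S.C) *ᵥ x.ofLp)) := rfl

lemma traj_family (a : Gain m p) (x : EuclideanSpace ℝ (Fin n)) (t : ℕ) :
    (S.family γ K Bq Br).traj a x t = WithLp.toLp 2 (S.dampedState γ (K + a) x t) := by
  induction t with
  | zero => rfl
  | succ t ih =>
    rw [AffineFamily.traj, ih, Plant.dampedState, mat_add, family_F₀_apply, family_dF_apply,
      ← WithLp.toLp_add, ← Matrix.add_mulVec, ← Matrix.smul_mulVec, Matrix.mul_add,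
      Matrix.add_mul, ← sub_sub, smul_sub √γ _ (S.B * a.mat * S.C), sub_eq_add_neg (√γ • _)]

lemma norm_sq_out_family (hBq : ∀ x, x ⬝ᵥ (S.Q *ᵥ x) = ‖WithLp.toLp 2 (Bq *ᵥ x)‖ ^ 2)
    (hBr : ∀ x, x ⬝ᵥ (S.R *ᵥ x) = ‖WithLp.toLp 2 (Br *ᵥ x)‖ ^ 2)
    (a : Gain m p) (x : EuclideanSpace ℝ (Fin n)) (t : ℕ) :
    ‖(S.family γ K Bq Br).out a x t‖ ^ 2 = S.stage (K + a) (S.dampedState γ (K + a) x t) := by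
  rw [AffineFamily.out, traj_family, family_W₀_apply, family_dW_apply, ← WithLp.toLp_add,
    WithLp.prod_norm_sq_eq_of_L2, Plant.stage, hBq, hBr,
    Plant.input, Matrix.mulVec_neg, WithLp.toLp_neg, norm_neg, mat_add]
  simp only [Prod.mk_add_mk, add_zero, ← WithLp.toLp_add, Matrix.mulVec_mulVec,
    ← Matrix.add_mulVec, ← Matrix.add_mul, ← Matrix.mul_add, Matrix.mul_assoc, WithLp.toLp_fst,
    WithLp.toLp_snd]

end System

/-! ### Infinite-horizon energies and truncation -/

section TotalEnergy

variable {X Y E : Type*} [AddCommGroup X] [Module ℝ X] [NormedAddCommGroup Y]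
    [InnerProductSpace ℝ Y] [NormedAddCommGroup E] [NormedSpace ℝ E]

namespace AffineFamily

variable {A : AffineFamily X Y E} {p : Seminorm ℝ X} {ρ h σ D q : ℝ}

lemma Bounds.summable_sq_out (B : A.Bounds p ρ h σ D) (hq : 1 ≤ q) (hρ : ρ ^ 2 ≤ 1 - 1 / q)
    {a : E} (ha : ‖a‖ ≤ D) (x : X) : Summable fun t => ‖A.out a x t‖ ^ 2 :=
  summable_of_sum_range_le (fun _ => by positivity) (B.sum_sq_out_le hq hρ ha x)

lemma Bounds.summable_inner_out_dout (B : A.Bounds p ρ h σ D) (hq : 1 ≤ q)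
    (hρ : ρ ^ 2 ≤ 1 - 1 / q) (Δ : E) (x : X) :
    Summable fun t => (inner ℝ (A.out 0 x t) (A.dout Δ x t) : ℝ) := by
  have := B.one_le_σ
  have := B.ρ_nonneg
  have := B.h_nonneg
  have hD0 : ‖(0 : E)‖ ≤ D := by simpa using B.D_nonneg
  refine Summable.of_norm (summable_of_sum_range_le (fun _ => norm_nonneg _)
    (c := 9 / 8 * σ ^ 2 * h * ‖Δ‖ * p x ^ 2 * (q ^ 2 + q)) fun T => ?_)
  have h0 := sum_pow_mul_pow_le hq hρ T
  have h1 := sum_mul_pow_pred_mul_pow_le B.ρ_le_one hq hρ T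
  calc _ ≤ ∑ t ∈ Finset.range T, 9 / 8 * σ ^ 2 * h * ‖Δ‖ * p x ^ 2
            * (t * ρ ^ (t - 1) * ρ ^ t + ρ ^ t * ρ ^ t) := by
        refine Finset.sum_le_sum fun t _ => (norm_inner_le_norm _ _).trans ?_
        calc _ ≤ (9 / 8 * σ * ρ ^ t * p x)
              * (σ * h * ‖Δ‖ * (t * ρ ^ (t - 1) + ρ ^ t) * p x) := by
              gcongr
              · exact B.out_le hD0 x t
              · exact B.dout_le Δ x t
          _ = _ := by ring
    _ ≤ _ := by
        rw [← Finset.mul_sum, Finset.sum_add_distrib]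
        gcongr

/-- The derivative at `0` of the total output energy. -/
noncomputable def Bounds.denergy (B : A.Bounds p ρ h σ D) (hq : 1 ≤ q) (hρ : ρ ^ 2 ≤ 1 - 1 / q)
    (x : X) : E →ₗ[ℝ] ℝ where
  toFun Δ := 2 * ∑' t, inner ℝ (A.out 0 x t) (A.dout Δ x t)
  map_add' Δ Δ' := by
    simp only [dout_add, inner_add_right]
    rw [(B.summable_inner_out_dout hq hρ Δ x).tsum_add (B.summable_inner_out_dout hq hρ Δ' x)]
    ring
  map_smul' c Δ := by
    simp only [dout_smul, inner_smul_right, tsum_mul_left, RingHom.id_apply, smul_eq_mul]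
    ring

lemma abs_le_of_tendsto_of_le {u : ℕ → ℝ} {l c : ℝ}
    (h : Filter.Tendsto u Filter.atTop (nhds l)) (hu : ∀ T, |u T| ≤ c) : |l| ≤ c :=
  le_of_tendsto h.abs (Filter.Eventually.of_forall hu)

theorem Bounds.abs_tsum_sub_tsum_le (B : A.Bounds p ρ h σ D) (hq : 1 ≤ q)
    (hρ : ρ ^ 2 ≤ 1 - 1 / q) {a b : E} (ha : ‖a‖ ≤ D) (hb : ‖b‖ ≤ D) (x : X) :
    |∑' t, ‖A.out a x t‖ ^ 2 - ∑' t, ‖A.out b x t‖ ^ 2|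
      ≤ 9 / 4 * (9 / 8 * q ^ 2 + q) * σ ^ 2 * h * ‖a - b‖ * p x ^ 2 := by
  have h1 := ((B.summable_sq_out hq hρ ha x).hasSum.sub
    (B.summable_sq_out hq hρ hb x).hasSum).tendsto_sum_nat
  exact abs_le_of_tendsto_of_le h1 fun T =>
    (Finset.abs_sum_le_sum_abs _ _).trans (B.sum_abs_sq_sub_sq_le hq hρ ha hb x T)

theorem Bounds.abs_tsum_sub_tsum_sub_denergy_le (B : A.Bounds p ρ h σ D) (hq : 1 ≤ q)
    (hρ : ρ ^ 2 ≤ 1 - 1 / q) {a b : E} (ha : ‖a‖ ≤ D) (hb : ‖b‖ ≤ D) (x : X) :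
    |∑' t, ‖A.out a x t‖ ^ 2 - ∑' t, ‖A.out b x t‖ ^ 2 - B.denergy hq hρ x (a - b)|
      ≤ (9 / 2 * q ^ 3 + 35 / 8 * q ^ 2 + q) * σ ^ 2 * h ^ 2 * (‖a‖ + ‖b‖) * ‖a - b‖
        * p x ^ 2 := by
  have h1 := (((B.summable_sq_out hq hρ ha x).hasSum.sub
    (B.summable_sq_out hq hρ hb x).hasSum).sub
    ((B.summable_inner_out_dout hq hρ (a - b) x).hasSum.mul_left 2)).tendsto_sum_nat
  exact abs_le_of_tendsto_of_le h1 fun T =>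
    (Finset.abs_sum_le_sum_abs _ _).trans (B.sum_abs_sq_sub_sq_sub_inner_le hq hρ ha hb x T)

/-- The tail after `τ` is the total energy started at the state `y` reached at time `τ`. By `ha'`
and the Lipschitz bound that energy is at most twice the nominal one, `p y ^ 2`, which has
contracted for `τ` steps. -/
theorem Bounds.tsum_sub_sum_le (B : A.Bounds p ρ h σ D) (hq : 1 ≤ q)
    (hρ : ρ ^ 2 ≤ 1 - 1 / q) (hp : ∀ x, HasSum (fun t => ‖A.out 0 x t‖ ^ 2) (p x ^ 2))
    {a : E} (ha : ‖a‖ ≤ D) (ha' : 9 / 4 * (9 / 8 * q ^ 2 + q) * σ ^ 2 * h * ‖a‖ ≤ 1)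
    (x : X) (τ : ℕ) :
    0 ≤ ∑' t, ‖A.out a x t‖ ^ 2 - ∑ t ∈ Finset.range τ, ‖A.out a x t‖ ^ 2 ∧
    ∑' t, ‖A.out a x t‖ ^ 2 - ∑ t ∈ Finset.range τ, ‖A.out a x t‖ ^ 2
      ≤ 2 * (1 - 1 / q) ^ τ * p x ^ 2 := by
  have hsum := B.summable_sq_out hq hρ ha x
  rw [← hsum.sum_add_tsum_nat_add τ, add_sub_cancel_left]
  refine ⟨tsum_nonneg fun _ => by positivity, ?_⟩
  have e : ∀ t, A.out a x (t + τ) = A.out a (A.traj a x τ) t := fun t => by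
    rw [add_comm, out_add]
  simp only [e]
  set y := A.traj a x τ with hy
  have hD0 : ‖(0 : E)‖ ≤ D := by simpa using B.D_nonneg
  have h1 := (le_abs_self _).trans (B.abs_tsum_sub_tsum_le hq hρ ha hD0 y)
  rw [sub_zero, (hp y).tsum_eq] at h1
  have h2 : p y ^ 2 ≤ (1 - 1 / q) ^ τ * p x ^ 2 := by
    have := B.ρ_nonneg
    calc p y ^ 2 ≤ (ρ ^ τ * p x) ^ 2 := by
          gcongr
          exact B.traj_le ha x τ
      _ = (ρ ^ 2) ^ τ * p x ^ 2 := by ring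
      _ ≤ _ := by gcongr
  nlinarith [sq_nonneg (p y)]

end AffineFamily

end TotalEnergy

/-! ### Second moments under identity covariance -/

section Covariance

variable {n : ℕ} {Y : Type*} [NormedAddCommGroup Y] [InnerProductSpace ℝ Y]

lemma map_eq_sum_single (T : EuclideanSpace ℝ (Fin n) →ₗ[ℝ] Y) (x : EuclideanSpace ℝ (Fin n)) :
    T x = ∑ i, x i • T (EuclideanSpace.single i 1) := by
  conv_lhs => rw [← (EuclideanSpace.basisFun (Fin n) ℝ).sum_repr x]
  simp [map_sum]

lemma norm_sq_map_le (T : EuclideanSpace ℝ (Fin n) →ₗ[ℝ] Y) (x : EuclideanSpace ℝ (Fin n)) :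
    ‖T x‖ ^ 2 ≤ ‖x‖ ^ 2 * ∑ i, ‖T (EuclideanSpace.single i 1)‖ ^ 2 := by
  rw [map_eq_sum_single T x, EuclideanSpace.real_norm_sq_eq]
  calc _ ≤ (∑ i, |x i| * ‖T (EuclideanSpace.single i 1)‖) ^ 2 := by
        gcongr
        refine (norm_sum_le _ _).trans (Finset.sum_le_sum fun i _ => ?_)
        rw [norm_smul, Real.norm_eq_abs]
    _ ≤ (∑ i, |x i| ^ 2) * ∑ i, ‖T (EuclideanSpace.single i 1)‖ ^ 2 :=
        Finset.sum_mul_sq_le_sq_mul_sq _ _ _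
    _ = _ := by simp only [sq_abs]

variable {μ : Measure (EuclideanSpace ℝ (Fin n))} {d : ℝ}

lemma IsInitialLaw.integrable_mul (hμ : IsInitialLaw μ d) (i j : Fin n) :
    Integrable (fun x : EuclideanSpace ℝ (Fin n) => x i * x j) μ := by
  have := hμ.prob
  refine Integrable.of_bound (C := d * d) (by fun_prop) ?_
  filter_upwards [hμ.bounded] with x hx
  rw [norm_mul]
  gcongr
  · exact (norm_nonneg _).trans hx
  · exact (PiLp.norm_apply_le x i).trans hx
  · exact (PiLp.norm_apply_le x j).trans hx

/-- Expanding in coordinates, the covariance keeps only the diagonal terms: the mean of `‖T x‖²` is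
the squared Hilbert–Schmidt norm of `T`. -/
lemma IsInitialLaw.integrable_norm_sq_map (hμ : IsInitialLaw μ d)
    (T : EuclideanSpace ℝ (Fin n) →ₗ[ℝ] Y) : Integrable (fun x => ‖T x‖ ^ 2) μ ∧
      ∫ x, ‖T x‖ ^ 2 ∂μ = ∑ i, ‖T (EuclideanSpace.single i 1)‖ ^ 2 := by
  have e : ∀ x, ‖T x‖ ^ 2 = ∑ i, ∑ j, (x i * x j) *
      inner ℝ (T (EuclideanSpace.single i 1)) (T (EuclideanSpace.single j 1)) := fun x => by
    rw [map_eq_sum_single T x, ← real_inner_self_eq_norm_sq, sum_inner]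
    refine Finset.sum_congr rfl fun i _ => ?_
    rw [inner_sum]
    refine Finset.sum_congr rfl fun j _ => ?_
    rw [inner_smul_left, inner_smul_right, RCLike.conj_to_real, mul_assoc]
  simp only [e]
  have hi : ∀ i j, Integrable (fun x : EuclideanSpace ℝ (Fin n) => (x i * x j) *
      inner ℝ (T (EuclideanSpace.single i 1)) (T (EuclideanSpace.single j 1))) μ :=
    fun i j => (hμ.integrable_mul i j).mul_const _
  refine ⟨integrable_finsetSum _ fun i _ => integrable_finsetSum _ fun j _ => hi i j, ?_⟩
  rw [integral_finsetSum _ fun i _ => integrable_finsetSum _ fun j _ => hi i j]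
  refine Finset.sum_congr rfl fun i _ => ?_
  rw [integral_finsetSum _ fun j _ => hi i j]
  simp only [integral_mul_const, hμ.covariance, Matrix.one_apply, ite_mul, one_mul, zero_mul,
    Finset.sum_ite_eq, Finset.mem_univ, if_true]
  rw [real_inner_self_eq_norm_sq, ← e]

end Covariance

/-! ### The expected cost as a sum over basis states -/

section Cost

variable {n m p : ℕ} {S : Plant n m p} {γ : ℝ} {μ : Measure (EuclideanSpace ℝ (Fin n))} {d : ℝ}

lemma Plant.stage_smul (S : Plant n m p) (K : Gain m p) (c : ℝ) (x : Fin n → ℝ) :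
    S.stage K (c • x) = c ^ 2 * S.stage K x := by
  have : S.input K (c • x) = c • S.input K x := by
    simp [Plant.input, Matrix.mulVec_smul]
  simp only [Plant.stage, this, Matrix.mulVec_smul, dotProduct_smul, smul_dotProduct, smul_eq_mul]
  ring

lemma Plant.dampedState_eq (S : Plant n m p) (γ : ℝ) (K : Gain m p)
    (x : EuclideanSpace ℝ (Fin n)) (t : ℕ) :
    S.dampedState γ K x t = √γ ^ t • S.state K x t := by
  induction t with
  | zero => simp [Plant.dampedState, Plant.state]
  | succ t ih =>
    rw [Plant.dampedState, Plant.state, ih, Matrix.mulVec_smul, smul_smul, ← pow_succ']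
    congr 1
    rw [Plant.input, Matrix.sub_mulVec, Matrix.mulVec_neg, Matrix.mulVec_mulVec,
      Matrix.mulVec_mulVec, Matrix.mul_assoc, sub_eq_add_neg]

lemma Plant.discounted_stage (S : Plant n m p) (hγ : 0 ≤ γ) (K : Gain m p)
    (x : EuclideanSpace ℝ (Fin n)) (t : ℕ) :
    γ ^ t * S.stage K (S.state K x t) = S.stage K (S.dampedState γ K x t) := by
  rw [Plant.dampedState_eq, Plant.stage_smul, ← pow_mul, mul_comm t 2, pow_mul, Real.sq_sqrt hγ]

variable {Y : Type*} [NormedAddCommGroup Y] [InnerProductSpace ℝ Y]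
  {A : AffineFamily (EuclideanSpace ℝ (Fin n)) Y (Gain m p)} {K : Gain m p}

lemma Plant.cost_eq_tsum (hγ : 0 ≤ γ) (hμ : IsInitialLaw μ d) {a : Gain m p}
    (hA : ∀ x t, ‖A.out a x t‖ ^ 2 = S.stage (K + a) (S.dampedState γ (K + a) x t)) :
    S.cost μ γ (K + a)
      = ∑' t, ENNReal.ofReal (∑ i, ‖A.out a (EuclideanSpace.single i 1) t‖ ^ 2) := by
  simp only [Plant.cost, Plant.discounted_stage S hγ, ← hA]
  have h1 := fun t => hμ.integrable_norm_sq_map (A.outLin a t)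
  simp only [AffineFamily.outLin_apply] at h1
  rw [lintegral_tsum fun t => (h1 t).1.aestronglyMeasurable.aemeasurable.ennreal_ofReal]
  refine tsum_congr fun t => ?_
  rw [← (h1 t).2, ofReal_integral_eq_lintegral_ofReal (h1 t).1 (.of_forall fun _ => by positivity)]

lemma Plant.cost_eq_ofReal (hγ : 0 ≤ γ) (hμ : IsInitialLaw μ d) {a : Gain m p}
    (hA : ∀ x t, ‖A.out a x t‖ ^ 2 = S.stage (K + a) (S.dampedState γ (K + a) x t))
    (hs : ∀ x, Summable fun t => ‖A.out a x t‖ ^ 2) :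
    S.cost μ γ (K + a)
      = ENNReal.ofReal (∑ i, ∑' t, ‖A.out a (EuclideanSpace.single i 1) t‖ ^ 2) := by
  rw [Plant.cost_eq_tsum hγ hμ hA, ← ENNReal.ofReal_tsum_of_nonneg
    (fun t => by positivity) (summable_sum fun i _ => hs _), Summable.tsum_finsetSum
    fun i _ => hs _]

lemma Plant.integral_rollout (hμ : IsInitialLaw μ d) {a : Gain m p}
    (hA : ∀ x t, ‖A.out a x t‖ ^ 2 = S.stage (K + a) (S.dampedState γ (K + a) x t)) (τ : ℕ) :
    ∫ x, S.rollout γ τ (K + a) x ∂μ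
      = ∑ i, ∑ t ∈ Finset.range τ, ‖A.out a (EuclideanSpace.single i 1) t‖ ^ 2 := by
  simp only [Plant.rollout, ← hA]
  have h1 := fun t => hμ.integrable_norm_sq_map (A.outLin a t)
  simp only [AffineFamily.outLin_apply] at h1
  rw [integral_finsetSum _ fun t _ => (h1 t).1, Finset.sum_comm]
  exact Finset.sum_congr rfl fun t _ => (h1 t).2

end Cost

/-! ### Uniform contraction on the sublevel set -/

section SublevelBounds

variable {n m p : ℕ} {S : Plant n m p} {γ : ℝ} {μ : Measure (EuclideanSpace ℝ (Fin n))} {d : ℝ}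
  {K : Gain m p} {ℓ₀ ℓ₁ ψ φ ν : ℝ}

/-- A finite mean cost controls the energies of all basis states, and by Cauchy–Schwarz these
control the energy of every initial state. -/
lemma Plant.sum_tsum_out_le {Y : Type*} [NormedAddCommGroup Y] [InnerProductSpace ℝ Y]
    {A : AffineFamily (EuclideanSpace ℝ (Fin n)) Y (Gain m p)}
    (hγ : 0 ≤ γ) (hμ : IsInitialLaw μ d) (hν : 0 ≤ ν)
    (hA : ∀ x t, ‖A.out 0 x t‖ ^ 2 = S.stage (K + 0) (S.dampedState γ (K + 0) x t))
    (hK : K ∈ S.sublevel μ γ ν) :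
    (∀ x, Summable fun t => ‖A.out 0 x t‖ ^ 2) ∧
      ∑ i, ∑' t, ‖A.out 0 (EuclideanSpace.single i 1) t‖ ^ 2 ≤ ν := by
  have h1 : S.cost μ γ (K + 0) ≤ ENNReal.ofReal ν := by rw [add_zero]; exact hK
  have hs : Summable fun t => ∑ i, ‖A.out 0 (EuclideanSpace.single i 1) t‖ ^ 2 := by
    rw [Plant.cost_eq_tsum hγ hμ hA] at h1
    refine summable_of_sum_range_le (c := ν) (fun _ => by positivity) fun T => ?_
    rw [← ENNReal.ofReal_le_ofReal_iff hν, ENNReal.ofReal_sum_of_nonneg fun _ _ => by positivity]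
    exact (ENNReal.sum_le_tsum _).trans h1
  have hs' : ∀ x, Summable fun t => ‖A.out 0 x t‖ ^ 2 := fun x =>
    Summable.of_nonneg_of_le (fun _ => by positivity)
      (fun t => norm_sq_map_le (A.outLin 0 t) x) (hs.mul_left _)
  refine ⟨hs', ?_⟩
  rw [Plant.cost_eq_ofReal hγ hμ hA hs'] at h1
  exact (ENNReal.ofReal_le_ofReal_iff hν).1 h1

lemma kap_sq (hℓ₀ : 0 < ℓ₀) (hν : 0 < ν) : kap ν ℓ₀ ^ 2 = ν / ℓ₀ := by
  rw [kap, Real.sq_sqrt (by positivity)]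

lemma kap_pos (hℓ₀ : 0 < ℓ₀) (hν : 0 < ν) : 0 < kap ν ℓ₀ := Real.sqrt_pos.2 (by positivity)

/-- The closed loops near a gain of the sublevel set contract in the energy seminorm. -/
theorem exists_bounds (hℓ₀ : 0 < ℓ₀) (hℓ : ℓ₀ ≤ ℓ₁) (hψ : 1 ≤ ψ) (hφ : 1 ≤ φ)
    (hS : S.Bounded ℓ₀ ℓ₁ ψ φ) (hμ : IsInitialLaw μ d) (hγ0 : 0 < γ) (hγ1 : γ < 1)
    (hν : 0 < ν) (hn : 0 < n) (hK : K ∈ S.sublevel μ γ ν) :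
    1 ≤ kap ν ℓ₀ ∧
    ∃ (A : AffineFamily (EuclideanSpace ℝ (Fin n))
        (WithLp 2 (EuclideanSpace ℝ (Fin n) × EuclideanSpace ℝ (Fin m))) (Gain m p))
      (e : Seminorm ℝ (EuclideanSpace ℝ (Fin n))) (ρ : ℝ),
      A.Bounds e ρ (kap ν ℓ₀ * ψ * φ) √(ℓ₁ / ℓ₀) (constD ν ℓ₀ ψ φ) ∧
      ρ ^ 2 ≤ 1 - 1 / (3 / 2 * kap ν ℓ₀ ^ 2) ∧
      (∀ x, HasSum (fun t => ‖A.out 0 x t‖ ^ 2) (e x ^ 2)) ∧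
      (∀ x, e x ^ 2 ≤ ν * ‖x‖ ^ 2) ∧
      ∑ i, e (EuclideanSpace.single i 1) ^ 2 ≤ ν ∧
      ∀ a x t, ‖A.out a x t‖ ^ 2 = S.stage (K + a) (S.dampedState γ (K + a) x t) := by
  obtain ⟨Bq, hBq⟩ := exists_norm_sq_eq_of_posSemidef (posSemidef_of_sub hℓ₀.le hS.Q_lower)
  obtain ⟨Br, hBr⟩ := exists_norm_sq_eq_of_posSemidef (posSemidef_of_sub hℓ₀.le hS.R_lower)
  set A := S.family γ K Bq Br with hAdef
  have hA : ∀ a x t, ‖A.out a x t‖ ^ 2 = S.stage (K + a) (S.dampedState γ (K + a) x t) :=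
    norm_sq_out_family hBq hBr
  obtain ⟨hs, hsum⟩ := Plant.sum_tsum_out_le hγ0.le hμ hν.le (hA 0) hK
  set e := A.energy hs with he
  have hes := A.hasSum_energy_sq hs
  have hsum' : ∑ i, e (EuclideanSpace.single i 1) ^ 2 ≤ ν := by
    simpa only [(hes _).tsum_eq] using hsum
  have heν : ∀ x, e x ^ 2 ≤ ν * ‖x‖ ^ 2 := fun x => by
    have hle := fun t => norm_sq_map_le (A.outLin 0 t) x
    have h2 : HasSum (fun t => ‖x‖ ^ 2 * ∑ i, ‖A.outLin 0 t (EuclideanSpace.single i 1)‖ ^ 2)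
        (‖x‖ ^ 2 * ∑ i, e (EuclideanSpace.single i 1) ^ 2) :=
      (hasSum_sum fun i _ => hes (EuclideanSpace.single i 1)).mul_left _
    calc e x ^ 2 ≤ ‖x‖ ^ 2 * ∑ i, e (EuclideanSpace.single i 1) ^ 2 := hasSum_le hle (hes x) h2
      _ ≤ ‖x‖ ^ 2 * ν := by gcongr
      _ = _ := mul_comm _ _
  have hW : ∀ x, ℓ₀ * ‖x‖ ^ 2 ≤ ‖A.W₀ x‖ ^ 2 := fun x => by
    rw [family_W₀_apply, WithLp.prod_norm_sq_eq_of_L2, WithLp.toLp_fst, ← hBq]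
    have := le_dotProduct_mulVec hS.Q_lower x.ofLp
    simp only [WithLp.toLp_ofLp] at this
    nlinarith [sq_nonneg ‖(WithLp.toLp 2 (WithLp.toLp 2 (Bq *ᵥ x.ofLp),
        WithLp.toLp 2 ((Br * K.mat * S.C) *ᵥ x.ofLp))).snd‖]
  have hstep := A.energy_step hs
  have hWe : ∀ x, ‖A.W₀ x‖ ≤ e x := fun x => by
    rw [← sq_le_sq₀ (norm_nonneg _) (apply_nonneg e x)]
    nlinarith [hstep x, sq_nonneg (e (A.F₀ x))]
  set κ := kap ν ℓ₀ with hκ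
  have hκ0 : 0 < κ := kap_pos hℓ₀ hν
  have hκ2 : κ ^ 2 * ℓ₀ = ν := by rw [hκ, kap_sq hℓ₀ hν]; field_simp
  -- On a unit vector, `ℓ₀ ≤ ‖W₀ x‖² ≤ e(x)² ≤ ν`; such a vector exists because `0 < n`.
  have hκ1 : 1 ≤ κ := by
    have h1 := hW (EuclideanSpace.single ⟨0, hn⟩ 1)
    have h2 := heν (EuclideanSpace.single ⟨0, hn⟩ 1)
    have h3 := pow_le_pow_left₀ (norm_nonneg _) (hWe (EuclideanSpace.single ⟨0, hn⟩ 1)) 2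
    simp only [PiLp.norm_single, norm_one, one_pow, mul_one] at h1 h2
    have h4 : 1 * ℓ₀ ≤ κ ^ 2 * ℓ₀ := by linarith
    have h5 := le_of_mul_le_mul_right h4 hℓ₀
    nlinarith
  -- The square root is the contraction factor at `K`; `1/(8κ²)` is `κψφ · D`, the most that a
  -- perturbation of norm `D` can add.
  refine ⟨hκ1, A, e, √(1 - 1 / κ ^ 2) + 1 / (8 * κ ^ 2), ?_, ?_, hes, heν, hsum', hA⟩
  · have hne : ∀ x : EuclideanSpace ℝ (Fin n), √ℓ₀ * ‖x‖ ≤ e x := fun x => by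
      rw [← sq_le_sq₀ (by positivity) (apply_nonneg e x), mul_pow, Real.sq_sqrt hℓ₀.le]
      exact (hW x).trans (pow_le_pow_left₀ (norm_nonneg _) (hWe x) 2)
    have hen : ∀ x : EuclideanSpace ℝ (Fin n), e x ≤ √ν * ‖x‖ := fun x => by
      rw [← sq_le_sq₀ (apply_nonneg e x) (by positivity), mul_pow, Real.sq_sqrt hν.le]
      exact heν x
    have hℓ₁ : 0 < ℓ₁ := hℓ₀.trans_le hℓ
    have hκν : √ν = κ * √ℓ₀ := by
      rw [← hκ2, Real.sqrt_mul (by positivity), Real.sqrt_sq hκ0.le]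
    have hσ1 : 1 ≤ √(ℓ₁ / ℓ₀) := by
      rw [Real.one_le_sqrt, le_div_iff₀ hℓ₀]; linarith
    have hσℓ : √ℓ₁ = √(ℓ₁ / ℓ₀) * √ℓ₀ := by
      rw [← Real.sqrt_mul (by positivity)]; congr 1; field_simp
    have hψ0 : 0 < ψ := by linarith
    have hφ0 : 0 < φ := by linarith
    have hC : ∀ x : EuclideanSpace ℝ (Fin n), ‖WithLp.toLp 2 (S.C *ᵥ x.ofLp)‖ ≤ φ * ‖x‖ :=
      fun x => (norm_mulVec_le S.C x.ofLp).trans (by gcongr; exact hS.C_norm)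
    have hdF : ∀ a x, e (A.dF a x) ≤ κ * ψ * φ * ‖a‖ * e x := fun a x => by
      have h1 : ‖A.dF a x‖ ≤ ψ * (‖a‖ * (φ * ‖x‖)) := by
        rw [family_dF_apply, Matrix.neg_mulVec, Matrix.smul_mulVec, WithLp.toLp_neg, norm_neg,
          WithLp.toLp_smul, norm_smul, Real.norm_of_nonneg (Real.sqrt_nonneg _),
          ← Matrix.mulVec_mulVec, ← Matrix.mulVec_mulVec]
        calc _ ≤ 1 * (ψ * (‖a‖ * (φ * ‖x‖))) := by
              gcongr
              · exact Real.sqrt_le_one.2 hγ1.le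
              · refine (norm_mulVec_le S.B _).trans ?_
                gcongr
                · exact hS.B_norm
                · exact (norm_mat_mulVec_le a _).trans (by gcongr; exact hC x)
          _ = _ := one_mul _
      calc e (A.dF a x) ≤ √ν * (ψ * (‖a‖ * (φ * ‖x‖))) := (hen _).trans (by gcongr)
        _ = κ * ψ * φ * ‖a‖ * (√ℓ₀ * ‖x‖) := by rw [hκν]; ring
        _ ≤ _ := by gcongr; exact hne x
    have hdW : ∀ a x, ‖A.dW a x‖ ≤ √(ℓ₁ / ℓ₀) * φ * ‖a‖ * e x := fun a x => by
      have h1 : ‖A.dW a x‖ ≤ √ℓ₁ * (‖a‖ * (φ * ‖x‖)) := by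
        rw [← sq_le_sq₀ (norm_nonneg _) (by positivity), family_dW_apply,
          WithLp.prod_norm_sq_eq_of_L2, WithLp.toLp_fst, WithLp.toLp_snd,
          ← Matrix.mulVec_mulVec, ← Matrix.mulVec_mulVec, ← hBr, norm_zero, mul_pow,
          Real.sq_sqrt hℓ₁.le, zero_pow two_ne_zero, zero_add]
        refine (dotProduct_mulVec_le hS.R_upper _).trans ?_
        gcongr
        exact (norm_mat_mulVec_le a _).trans (by gcongr; exact hC x)
      calc ‖A.dW a x‖ ≤ √ℓ₁ * (‖a‖ * (φ * ‖x‖)) := h1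
        _ = √(ℓ₁ / ℓ₀) * φ * ‖a‖ * (√ℓ₀ * ‖x‖) := by rw [hσℓ]; ring
        _ ≤ _ := by gcongr; exact hne x
    have hu1 : 1 / κ ^ 2 ≤ 1 := by
      rw [div_le_one (by positivity)]; nlinarith
    have hF₀ : ∀ x, e (A.F₀ x) ≤ √(1 - 1 / κ ^ 2) * e x := fun x => by
      rw [← sq_le_sq₀ (apply_nonneg e _) (mul_nonneg (Real.sqrt_nonneg _) (apply_nonneg e x)),
        mul_pow, Real.sq_sqrt (by linarith)]
      have h1 : 1 / κ ^ 2 * e x ^ 2 ≤ ℓ₀ * ‖x‖ ^ 2 := by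
        calc 1 / κ ^ 2 * e x ^ 2 ≤ 1 / κ ^ 2 * (ν * ‖x‖ ^ 2) := by gcongr; exact heν x
          _ = _ := by rw [← hκ2]; field_simp
      have := hstep x
      have := hW x
      linarith
    have hr0 : √(1 - 1 / κ ^ 2) ≤ 1 - 1 / κ ^ 2 / 2 := by
      rw [Real.sqrt_le_left (by linarith)]
      nlinarith [sq_nonneg (1 / κ ^ 2)]
    have hu8 : 1 / (8 * κ ^ 2) = 1 / κ ^ 2 / 8 := by field_simp
    have hu0 : 0 < 1 / κ ^ 2 := by positivity
    have hD : κ * ψ * φ * constD ν ℓ₀ ψ φ = 1 / (8 * κ ^ 2) := by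
      rw [constD, ← hκ]; field_simp
    have hD0 : 0 ≤ constD ν ℓ₀ ψ φ := by rw [constD, ← hκ]; positivity
    exact
      { ρ_nonneg := by positivity
        ρ_le_one := by rw [hu8]; linarith
        h_nonneg := by positivity
        one_le_σ := hσ1
        D_nonneg := hD0
        contract := fun a x ha => by
          calc e (A.F₀ x + A.dF a x) ≤ √(1 - 1 / κ ^ 2) * e x + κ * ψ * φ * ‖a‖ * e x :=
                (map_add_le_add e _ _).trans (add_le_add (hF₀ x) (hdF a x))
            _ ≤ √(1 - 1 / κ ^ 2) * e x + κ * ψ * φ * constD ν ℓ₀ ψ φ * e x := by gcongr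
            _ = _ := by rw [hD]; ring
        dF_le := hdF
        W₀_le := hWe
        dW_le := fun a x => by
          refine (hdW a x).trans ?_
          have : 1 * φ ≤ κ * ψ * φ := by
            gcongr
            nlinarith
          rw [one_mul] at this
          gcongr
        dW_le' := fun a x ha => by
          have h1 : φ * ‖a‖ ≤ 1 / 8 := by
            calc φ * ‖a‖ ≤ φ * constD ν ℓ₀ ψ φ := by gcongr
              _ = 1 / (8 * (κ ^ 3 * ψ)) := by rw [constD, ← hκ]; field_simp
              _ ≤ 1 / 8 := by
                gcongr
                have h3 : 1 ≤ κ ^ 3 := one_le_pow₀ hκ1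
                nlinarith
          calc ‖A.dW a x‖ ≤ √(ℓ₁ / ℓ₀) * (φ * ‖a‖) * e x := (hdW a x).trans_eq (by ring)
            _ ≤ √(ℓ₁ / ℓ₀) * (1 / 8) * e x := by gcongr
            _ = _ := by ring }
  · have hu1 : 1 / κ ^ 2 ≤ 1 := by
      rw [div_le_one (by positivity)]; nlinarith
    have hu0 : 0 < 1 / κ ^ 2 := by positivity
    have h1 : √(1 - 1 / κ ^ 2) ^ 2 = 1 - 1 / κ ^ 2 := Real.sq_sqrt (by linarith)
    have h2 : √(1 - 1 / κ ^ 2) ≤ 1 := Real.sqrt_le_one.2 (by linarith)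
    have e1 : 1 / (8 * κ ^ 2) = 1 / κ ^ 2 / 8 := by field_simp
    have e2 : 1 / (3 / 2 * κ ^ 2) = 2 / 3 * (1 / κ ^ 2) := by field_simp
    rw [e1, e2]
    -- With `u = 1/κ² ≤ 1`, `ρ² ≤ 1 - u + u/4 + u²/64 ≤ 1 - 2u/3`.
    nlinarith

end SublevelBounds

/-! ### Regularity constants of the cost -/

section Regularity

variable {n m p : ℕ} {S : Plant n m p} {γ : ℝ} {μ : Measure (EuclideanSpace ℝ (Fin n))} {d : ℝ}
  {K : Gain m p} {ℓ₀ ℓ₁ ψ φ ν : ℝ}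

/-- The Lipschitz constant of the cost obtained from the energy estimates. -/
noncomputable def lipConst (ν ℓ₀ ℓ₁ ψ φ : ℝ) : ℝ := 10 * kap ν ℓ₀ ^ 7 * ℓ₁ * ψ * φ

/-- The second order constant of the cost obtained from the energy estimates. -/
noncomputable def quadConst (ν ℓ₀ ℓ₁ ψ φ : ℝ) : ℝ :=
  27 * kap ν ℓ₀ ^ 10 * ℓ₁ * ψ ^ 2 * φ ^ 2

lemma energy_lip_le {κ : ℝ} (hℓ₀ : 0 < ℓ₀) (hℓ : ℓ₀ ≤ ℓ₁) (hψ : 1 ≤ ψ) (hφ : 1 ≤ φ)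
    (hκ1 : 1 ≤ κ) (hκ2 : κ ^ 2 * ℓ₀ = ν) :
    9 / 4 * (9 / 8 * (3 / 2 * κ ^ 2) ^ 2 + 3 / 2 * κ ^ 2) * √(ℓ₁ / ℓ₀) ^ 2 * (κ * ψ * φ) * ν
      ≤ 10 * κ ^ 7 * ℓ₁ * ψ * φ := by
  have hℓ₁ : 0 < ℓ₁ := hℓ₀.trans_le hℓ
  rw [Real.sq_sqrt (by positivity), ← hκ2]
  have h1 : κ ^ 2 ≤ κ ^ 4 := pow_le_pow_right₀ hκ1 (by norm_num)
  have h2 : 9 / 4 * (9 / 8 * (3 / 2 * κ ^ 2) ^ 2 + 3 / 2 * κ ^ 2) ≤ 10 * κ ^ 4 := by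
    have h0 : 0 ≤ κ ^ 4 := by positivity
    calc _ = 9 / 4 * (81 / 32 * κ ^ 4 + 3 / 2 * κ ^ 2) := by ring
      _ ≤ _ := by linarith
  calc _ = (9 / 4 * (9 / 8 * (3 / 2 * κ ^ 2) ^ 2 + 3 / 2 * κ ^ 2)) * (κ ^ 3 * ℓ₁ * ψ * φ) := by
        field_simp
    _ ≤ 10 * κ ^ 4 * (κ ^ 3 * ℓ₁ * ψ * φ) := by gcongr
    _ = _ := by ring

lemma energy_quad_le {κ : ℝ} (hℓ₀ : 0 < ℓ₀) (hℓ : ℓ₀ ≤ ℓ₁) (hψ : 1 ≤ ψ) (hφ : 1 ≤ φ)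
    (hκ1 : 1 ≤ κ) (hκ2 : κ ^ 2 * ℓ₀ = ν) :
    (9 / 2 * (3 / 2 * κ ^ 2) ^ 3 + 35 / 8 * (3 / 2 * κ ^ 2) ^ 2 + 3 / 2 * κ ^ 2)
      * √(ℓ₁ / ℓ₀) ^ 2 * (κ * ψ * φ) ^ 2 * ν ≤ 27 * κ ^ 10 * ℓ₁ * ψ ^ 2 * φ ^ 2 := by
  have hℓ₁ : 0 < ℓ₁ := hℓ₀.trans_le hℓ
  rw [Real.sq_sqrt (by positivity), ← hκ2]
  have h1 : κ ^ 2 ≤ κ ^ 6 := pow_le_pow_right₀ hκ1 (by norm_num)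
  have h1' : κ ^ 4 ≤ κ ^ 6 := pow_le_pow_right₀ hκ1 (by norm_num)
  have h2 : 9 / 2 * (3 / 2 * κ ^ 2) ^ 3 + 35 / 8 * (3 / 2 * κ ^ 2) ^ 2 + 3 / 2 * κ ^ 2
      ≤ 27 * κ ^ 6 := by
    have h0 : 0 ≤ κ ^ 6 := by positivity
    calc _ = 243 / 16 * κ ^ 6 + 315 / 32 * κ ^ 4 + 3 / 2 * κ ^ 2 := by ring
      _ ≤ _ := by linarith
  calc _ = (9 / 2 * (3 / 2 * κ ^ 2) ^ 3 + 35 / 8 * (3 / 2 * κ ^ 2) ^ 2 + 3 / 2 * κ ^ 2)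
          * (κ ^ 4 * ℓ₁ * ψ ^ 2 * φ ^ 2) := by field_simp
    _ ≤ 27 * κ ^ 6 * (κ ^ 4 * ℓ₁ * ψ ^ 2 * φ ^ 2) := by gcongr
    _ = _ := by ring

/-- The cost estimates come from the energy estimates summed over the basis states, whose squared
seminorms add up to at most `ν`. For a single rollout `e(x)² ≤ ν ‖x‖²` is used instead. The vector
`g` is the Riesz representative of the summed energy derivatives. -/
theorem exists_regularity (hℓ₀ : 0 < ℓ₀) (hℓ : ℓ₀ ≤ ℓ₁) (hψ : 1 ≤ ψ) (hφ : 1 ≤ φ)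
    (hS : S.Bounded ℓ₀ ℓ₁ ψ φ) (hμ : IsInitialLaw μ d) (hγ0 : 0 < γ) (hγ1 : γ < 1)
    (hν : 0 < ν) (hn : 0 < n) (hK : K ∈ S.sublevel μ γ ν) :
    ∃ g : Gain m p,
      (∀ a, ‖a‖ ≤ constD ν ℓ₀ ψ φ → S.cost μ γ (K + a) ≠ ⊤) ∧
      (∀ a, ‖a‖ ≤ constD ν ℓ₀ ψ φ →
        |S.costReal μ γ (K + a) - S.costReal μ γ K| ≤ lipConst ν ℓ₀ ℓ₁ ψ φ * ‖a‖) ∧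
      (∀ a b, ‖a‖ ≤ constD ν ℓ₀ ψ φ → ‖b‖ ≤ constD ν ℓ₀ ψ φ →
        |S.costReal μ γ (K + a) - S.costReal μ γ (K + b) - inner ℝ g (a - b)|
          ≤ quadConst ν ℓ₀ ℓ₁ ψ φ * (‖a‖ + ‖b‖) * ‖a - b‖) ∧
      (∀ a x τ, ‖a‖ ≤ constD ν ℓ₀ ψ φ →
        |S.rollout γ τ (K + a) x - S.rollout γ τ K x|
          ≤ lipConst ν ℓ₀ ℓ₁ ψ φ * ‖a‖ * ‖x‖ ^ 2) ∧
      (∀ a τ, ‖a‖ ≤ constD ν ℓ₀ ψ φ → ‖a‖ ≤ ν / constG ν ℓ₀ ℓ₁ ψ φ →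
        0 ≤ S.costReal μ γ (K + a) - ∫ x, S.rollout γ τ (K + a) x ∂μ ∧
        S.costReal μ γ (K + a) - ∫ x, S.rollout γ τ (K + a) x ∂μ
          ≤ 2 * ν * Real.exp (-(ℓ₀ / (2 * ν) * τ))) := by
  obtain ⟨hκ1, A, e, ρ, B, hρ, hes, heν, hsum, hA⟩ :=
    exists_bounds hℓ₀ hℓ hψ hφ hS hμ hγ0 hγ1 hν hn hK
  set κ := kap ν ℓ₀ with hκ
  have hκ2 : κ ^ 2 * ℓ₀ = ν := by rw [hκ, kap_sq hℓ₀ hν]; field_simp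
  have hℓ₁ : 0 < ℓ₁ := hℓ₀.trans_le hℓ
  have hψ0 : 0 < ψ := by linarith
  have hφ0 : 0 < φ := by linarith
  have hq : 1 ≤ 3 / 2 * κ ^ 2 := by nlinarith
  have hJ : ∀ a, ‖a‖ ≤ constD ν ℓ₀ ψ φ → S.cost μ γ (K + a)
      = ENNReal.ofReal (∑ i, ∑' t, ‖A.out a (EuclideanSpace.single i 1) t‖ ^ 2) := fun a ha =>
    Plant.cost_eq_ofReal hγ0.le hμ (hA a) (B.summable_sq_out hq hρ ha)
  have hJr : ∀ a, ‖a‖ ≤ constD ν ℓ₀ ψ φ → S.costReal μ γ (K + a)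
      = ∑ i, ∑' t, ‖A.out a (EuclideanSpace.single i 1) t‖ ^ 2 := fun a ha => by
    rw [Plant.costReal, hJ a ha, ENNReal.toReal_ofReal]
    exact Finset.sum_nonneg fun i _ => tsum_nonneg fun t => by positivity
  have hD0 : ‖(0 : Gain m p)‖ ≤ constD ν ℓ₀ ψ φ := by simpa using B.D_nonneg
  have hJ0 := hJr 0 hD0
  rw [add_zero] at hJ0
  have hlip := energy_lip_le (ν := ν) hℓ₀ hℓ hψ hφ hκ1 hκ2
  have hquad := energy_quad_le (ν := ν) hℓ₀ hℓ hψ hφ hκ1 hκ2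
  have hsum0 : 0 ≤ ∑ i, e (EuclideanSpace.single i 1) ^ 2 := by positivity
  set c₁ := 9 / 4 * (9 / 8 * (3 / 2 * κ ^ 2) ^ 2 + 3 / 2 * κ ^ 2) * √(ℓ₁ / ℓ₀) ^ 2
    * (κ * ψ * φ) with hc₁
  set c₂ := (9 / 2 * (3 / 2 * κ ^ 2) ^ 3 + 35 / 8 * (3 / 2 * κ ^ 2) ^ 2 + 3 / 2 * κ ^ 2)
      * √(ℓ₁ / ℓ₀) ^ 2 * (κ * ψ * φ) ^ 2 with hc₂
  have hc₁0 : 0 ≤ c₁ := by positivity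
  have hc₂0 : 0 ≤ c₂ := by positivity
  set l : Gain m p →ₗ[ℝ] ℝ := ∑ i, B.denergy hq hρ (EuclideanSpace.single i 1) with hl
  refine ⟨(InnerProductSpace.toDual ℝ _).symm (LinearMap.toContinuousLinearMap l),
    fun a ha => ?_, fun a ha => ?_, fun a b ha hb => ?_, fun a x τ ha => ?_,
    fun a τ ha ha' => ?_⟩
  · rw [hJ a ha]; exact ENNReal.ofReal_ne_top
  · rw [hJr a ha, hJ0, ← Finset.sum_sub_distrib]
    calc _ ≤ ∑ i, c₁ * ‖a - 0‖ * e (EuclideanSpace.single i 1) ^ 2 :=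
          (Finset.abs_sum_le_sum_abs _ _).trans
            (Finset.sum_le_sum fun i _ => B.abs_tsum_sub_tsum_le hq hρ ha hD0 _)
      _ = c₁ * ‖a‖ * ∑ i, e (EuclideanSpace.single i 1) ^ 2 := by
          rw [sub_zero, Finset.mul_sum]
      _ ≤ c₁ * ‖a‖ * ν := by gcongr
      _ = c₁ * ν * ‖a‖ := by ring
      _ ≤ _ := by rw [lipConst, ← hκ]; gcongr
  · rw [hJr a ha, hJr b hb, InnerProductSpace.toDual_symm_apply,
      LinearMap.coe_toContinuousLinearMap', hl, LinearMap.sum_apply, ← Finset.sum_sub_distrib,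
      ← Finset.sum_sub_distrib]
    calc _ ≤ ∑ i, c₂ * (‖a‖ + ‖b‖) * ‖a - b‖ * e (EuclideanSpace.single i 1) ^ 2 :=
          (Finset.abs_sum_le_sum_abs _ _).trans
            (Finset.sum_le_sum fun i _ => B.abs_tsum_sub_tsum_sub_denergy_le hq hρ ha hb _)
      _ = c₂ * (‖a‖ + ‖b‖) * ‖a - b‖ * ∑ i, e (EuclideanSpace.single i 1) ^ 2 := by
          rw [Finset.mul_sum]
      _ ≤ c₂ * (‖a‖ + ‖b‖) * ‖a - b‖ * ν := by gcongr
      _ = c₂ * ν * (‖a‖ + ‖b‖) * ‖a - b‖ := by ring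
      _ ≤ _ := by rw [quadConst, ← hκ]; gcongr
  · have h0 := hA 0
    rw [add_zero] at h0
    simp only [Plant.rollout, ← hA, ← h0]
    rw [← Finset.sum_sub_distrib]
    calc _ ≤ c₁ * ‖a - 0‖ * e x ^ 2 :=
          (Finset.abs_sum_le_sum_abs _ _).trans (B.sum_abs_sq_sub_sq_le hq hρ ha hD0 x τ)
      _ ≤ c₁ * ‖a‖ * (ν * ‖x‖ ^ 2) := by rw [sub_zero]; gcongr; exact heν x
      _ = c₁ * ν * ‖a‖ * ‖x‖ ^ 2 := by ring
      _ ≤ _ := by rw [lipConst, ← hκ]; gcongr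
  -- The bound `ν / G` on `‖a‖` serves here, to keep the perturbed energy below twice the nominal
  -- one.
  · have hsmall : c₁ * ‖a‖ ≤ 1 := by
      have hG : c₁ * ν ≤ constG ν ℓ₀ ℓ₁ ψ φ := by
        refine hlip.trans ?_
        rw [constG, ← hκ]
        have : κ ^ 7 ≤ κ ^ 9 := pow_le_pow_right₀ hκ1 (by norm_num)
        gcongr
        norm_num
      have hG0 : 0 < constG ν ℓ₀ ℓ₁ ψ φ := by rw [constG, ← hκ]; positivity
      calc c₁ * ‖a‖ ≤ c₁ * (ν / constG ν ℓ₀ ℓ₁ ψ φ) := by gcongr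
        _ = c₁ * ν / constG ν ℓ₀ ℓ₁ ψ φ := by ring
        _ ≤ 1 := div_le_one_of_le₀ hG hG0.le
    have htail := fun x => B.tsum_sub_sum_le hq hρ hes ha hsmall x τ
    rw [hJr a ha, Plant.integral_rollout hμ (hA a), ← Finset.sum_sub_distrib]
    refine ⟨Finset.sum_nonneg fun i _ => (htail _).1, ?_⟩
    have hexp : (1 - 1 / (3 / 2 * κ ^ 2)) ^ τ ≤ Real.exp (-(ℓ₀ / (2 * ν) * τ)) := by
      have h1 : 0 ≤ 1 - 1 / (3 / 2 * κ ^ 2) := (sq_nonneg ρ).trans hρ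
      have h2 : ℓ₀ / (2 * ν) ≤ 1 / (3 / 2 * κ ^ 2) := by
        rw [← hκ2]
        have : ℓ₀ / (2 * (κ ^ 2 * ℓ₀)) = 1 / (2 * κ ^ 2) := by field_simp
        rw [this]
        gcongr
        norm_num
      calc _ ≤ Real.exp (-(1 / (3 / 2 * κ ^ 2))) ^ τ := by
            gcongr
            linarith [Real.add_one_le_exp (-(1 / (3 / 2 * κ ^ 2)))]
        _ = Real.exp (-(1 / (3 / 2 * κ ^ 2) * τ)) := by
            rw [← Real.exp_nat_mul]; congr 1; ring
        _ ≤ _ := by gcongr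
    calc _ ≤ ∑ i, 2 * (1 - 1 / (3 / 2 * κ ^ 2)) ^ τ * e (EuclideanSpace.single i 1) ^ 2 :=
          Finset.sum_le_sum fun i _ => (htail _).2
      _ ≤ 2 * Real.exp (-(ℓ₀ / (2 * ν) * τ)) * ν := by
          rw [← Finset.mul_sum]
          gcongr
      _ = _ := by ring

end Regularity

/-! ### Moments of a uniformly random direction -/

section Direction

variable {ι : Type*} [Fintype ι]

/-- The direction `x / ‖x‖` of a vector. -/
noncomputable def direction (x : EuclideanSpace ℝ ι) : EuclideanSpace ℝ ι := ‖x‖⁻¹ • x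

lemma measurable_direction : Measurable (direction : EuclideanSpace ℝ ι → _) := by
  unfold direction
  fun_prop

lemma norm_direction_le (x : EuclideanSpace ℝ ι) : ‖direction x‖ ≤ 1 := by
  rw [direction, norm_smul, norm_inv, norm_norm]
  exact inv_mul_le_one

lemma direction_map (R : EuclideanSpace ℝ ι ≃ₗᵢ[ℝ] EuclideanSpace ℝ ι) (x : EuclideanSpace ℝ ι) :
    direction (R x) = R (direction x) := by
  rw [direction, direction, R.norm_map, map_smul]

lemma integral_comp_direction_map (R : EuclideanSpace ℝ ι ≃ₗᵢ[ℝ] EuclideanSpace ℝ ι)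
    (f : EuclideanSpace ℝ ι → ℝ) :
    ∫ x, f (R (direction x)) ∂(stdGaussian (EuclideanSpace ℝ ι))
      = ∫ x, f (direction x) ∂(stdGaussian (EuclideanSpace ℝ ι)) := by
  have h : MeasurePreserving R.toHomeomorph.toMeasurableEquiv
      (stdGaussian (EuclideanSpace ℝ ι)) (stdGaussian (EuclideanSpace ℝ ι)) :=
    ⟨R.toHomeomorph.toMeasurableEquiv.measurable, stdGaussian_map R⟩
  simp only [← direction_map]
  exact h.integral_comp' (fun x => f (direction x))

lemma ae_norm_direction [Nonempty ι] :
    ∀ᵐ x ∂(stdGaussian (EuclideanSpace ℝ ι)), ‖direction x‖ = 1 := by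
  have h : ∀ᵐ x ∂(stdGaussian (EuclideanSpace ℝ ι)), x ≠ 0 := by
    rw [← map_pi_eq_stdGaussian, ae_map_iff (p := fun x => x ≠ 0) (by fun_prop)
      (measurableSet_singleton (0 : EuclideanSpace ℝ ι)).compl]
    obtain ⟨i⟩ := ‹Nonempty ι›
    have := nullSingletonClass_gaussianReal (μ := 0) (v := 1) one_ne_zero
    have h1 : ∀ᵐ y ∂(gaussianReal 0 1), y ≠ 0 := by simp [ae_iff]
    have h2 := (measurePreserving_eval (fun _ : ι => gaussianReal 0 1) i).quasiMeasurePreserving.ae h1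
    filter_upwards [h2] with x hx h0
    exact hx (by simpa using congrArg (fun y : EuclideanSpace ℝ ι => y i) h0)
  filter_upwards [h] with x hx
  rw [direction, norm_smul, norm_inv, norm_norm, inv_mul_cancel₀ (norm_ne_zero_iff.2 hx)]

lemma abs_inner_direction_le (x v : EuclideanSpace ℝ ι) : |inner ℝ (direction x) v| ≤ ‖v‖ :=
  (abs_real_inner_le_norm _ _).trans
    (mul_le_of_le_one_left (norm_nonneg _) (norm_direction_le x))

lemma measurable_inner_direction (v : EuclideanSpace ℝ ι) :
    Measurable fun x => (inner ℝ (direction x) v : ℝ) :=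
  (measurable_direction (ι := ι)).inner measurable_const

lemma integrable_mul_inner_direction {F : EuclideanSpace ℝ ι → ℝ} (hF : Measurable F) {M : ℝ}
    (hM : ∀ u, ‖u‖ ≤ 1 → |F u| ≤ M) (v : EuclideanSpace ℝ ι) :
    Integrable (fun x => F (direction x) * inner ℝ (direction x) v)
      (stdGaussian (EuclideanSpace ℝ ι)) := by
  refine Integrable.of_bound (C := M * ‖v‖) ((hF.comp measurable_direction).mul
    (measurable_inner_direction v)).aestronglyMeasurable (.of_forall fun x => ?_)
  rw [norm_mul]
  have := (abs_nonneg _).trans (hM _ (norm_direction_le x))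
  gcongr
  · exact hM _ (norm_direction_le x)
  · exact abs_inner_direction_le x v

lemma integrable_inner_direction_mul (v w : EuclideanSpace ℝ ι) :
    Integrable (fun x => (inner ℝ (direction x) w : ℝ) * inner ℝ (direction x) v)
      (stdGaussian (EuclideanSpace ℝ ι)) :=
  integrable_mul_inner_direction (F := fun u => inner ℝ u w) (by fun_prop) (M := ‖w‖)
    (fun u hu => (abs_real_inner_le_norm _ _).trans
      (mul_le_of_le_one_left (norm_nonneg _) hu)) v

lemma integral_inner_direction_sq [Nonempty ι] (v : EuclideanSpace ℝ ι) :
    ∫ x, (inner ℝ (direction x) v : ℝ) * inner ℝ (direction x) v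
      ∂(stdGaussian (EuclideanSpace ℝ ι)) = ‖v‖ ^ 2 / Fintype.card ι := by
  classical
  have key : ∀ w : EuclideanSpace ℝ ι, ‖v‖ = ‖w‖ →
      ∫ x, (inner ℝ (direction x) v : ℝ) * inner ℝ (direction x) v
        ∂(stdGaussian (EuclideanSpace ℝ ι))
      = ∫ x, (inner ℝ (direction x) w : ℝ) * inner ℝ (direction x) w
        ∂(stdGaussian (EuclideanSpace ℝ ι)) := fun w hw => by
    -- This reflection exchanges `v` and `w`, so the second moment depends on `‖v‖` only; over an
    -- orthonormal basis the moments add up to `1`.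
    set R := (ℝ ∙ (v - w))ᗮ.reflection with hR
    rw [← integral_comp_direction_map R (fun u => inner ℝ u w * inner ℝ u w),
      ← Submodule.reflection_sub hw]
    simp only [← hR, R.inner_map_map]
  have h1 : ∀ i, ∫ x, (inner ℝ (direction x) v : ℝ) * inner ℝ (direction x) v
        ∂(stdGaussian (EuclideanSpace ℝ ι))
      = ‖v‖ ^ 2 * ∫ x, (inner ℝ (direction x) (EuclideanSpace.basisFun ι ℝ i) : ℝ)
        * inner ℝ (direction x) (EuclideanSpace.basisFun ι ℝ i)
        ∂(stdGaussian (EuclideanSpace ℝ ι)) := fun i => by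
    rw [key (‖v‖ • EuclideanSpace.basisFun ι ℝ i) (by simp [norm_smul]), ← integral_const_mul]
    refine integral_congr_ae (.of_forall fun x => ?_)
    simp only [inner_smul_right]
    ring
  have h2 : ∑ i, ∫ x, (inner ℝ (direction x) (EuclideanSpace.basisFun ι ℝ i) : ℝ)
        * inner ℝ (direction x) (EuclideanSpace.basisFun ι ℝ i)
        ∂(stdGaussian (EuclideanSpace ℝ ι)) = 1 := by
    rw [← integral_finsetSum _ fun i _ => integrable_inner_direction_mul _ _]
    rw [integral_congr_ae (g := fun _ => (1 : ℝ)) ?_]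
    · simp
    · filter_upwards [ae_norm_direction] with x hx
      have := (EuclideanSpace.basisFun ι ℝ).sum_sq_norm_inner_left (direction x)
      rw [hx, one_pow] at this
      rw [← this]
      refine Finset.sum_congr rfl fun i _ => ?_
      rw [Real.norm_eq_abs, sq_abs, pow_two]
  have h3 := Finset.sum_congr rfl fun i (_ : i ∈ (Finset.univ : Finset ι)) => h1 i
  rw [← Finset.mul_sum, h2, Finset.sum_const, Finset.card_univ, nsmul_eq_mul, mul_one] at h3
  rw [eq_div_iff (by positivity), mul_comm]
  exact h3

lemma integral_inner_direction_mul [Nonempty ι] (g v : EuclideanSpace ℝ ι) :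
    ∫ x, (inner ℝ (direction x) g : ℝ) * inner ℝ (direction x) v
      ∂(stdGaussian (EuclideanSpace ℝ ι)) = inner ℝ g v / Fintype.card ι := by
  have e : ∀ x : EuclideanSpace ℝ ι, (inner ℝ (direction x) g : ℝ) * inner ℝ (direction x) v
      = (1 / 4) * (inner ℝ (direction x) (g + v) * inner ℝ (direction x) (g + v)
        - inner ℝ (direction x) (g - v) * inner ℝ (direction x) (g - v)) := fun x => by
    simp only [inner_add_right, inner_sub_right]; ring
  simp only [e]
  rw [integral_const_mul, integral_sub (integrable_inner_direction_mul _ _)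
    (integrable_inner_direction_mul _ _), integral_inner_direction_sq, integral_inner_direction_sq,
    norm_add_sq_real, norm_sub_sq_real]
  ring

/-- A function that is `C`-Lipschitz on the unit sphere has a first moment of norm at most
`C / dim`. -/
lemma abs_integral_mul_inner_direction_le [Nonempty ι] {F : EuclideanSpace ℝ ι → ℝ}
    (hF : Measurable F) {M C : ℝ} (hM : ∀ u, ‖u‖ ≤ 1 → |F u| ≤ M)
    (hC : ∀ u w, ‖u‖ ≤ 1 → ‖w‖ ≤ 1 → |F u - F w| ≤ C * ‖u - w‖)
    (v : EuclideanSpace ℝ ι) :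
    |∫ x, F (direction x) * inner ℝ (direction x) v ∂(stdGaussian (EuclideanSpace ℝ ι))|
      ≤ C * ‖v‖ / Fintype.card ι := by
  rcases eq_or_ne v 0 with rfl | hv
  · simp
  have hv0 : 0 < ‖v‖ := norm_pos_iff.2 hv
  -- The reflection flips the sign of `⟪u, v⟫`, so `F` may be replaced by half of `F u - F (R u)`.
  -- As `u - R u` has length `2 |⟪u, v⟫| / ‖v‖`, the Lipschitz bound supplies a second factor `⟪u,
  -- v⟫`, whose square averages to `‖v‖² / dim`.
  set R := (ℝ ∙ v)ᗮ.reflection with hR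
  have hRv : R v = -v := Submodule.reflection_orthogonalComplement_singleton_eq_neg v
  have hRu : ∀ u, u - R u = (2 * (inner ℝ u v / ‖v‖ ^ 2)) • v := fun u => by
    rw [hR, Submodule.reflection_orthogonal_apply, Submodule.reflection_singleton_apply,
      real_inner_comm, ← Nat.cast_smul_eq_nsmul ℝ, smul_smul]
    simp
  set I := ∫ x, F (direction x) * inner ℝ (direction x) v ∂(stdGaussian (EuclideanSpace ℝ ι))
    with hI
  have h1 : ∫ x, F (R (direction x)) * inner ℝ (direction x) v
      ∂(stdGaussian (EuclideanSpace ℝ ι)) = -I := by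
    rw [hI, ← integral_comp_direction_map R (fun u => F u * inner ℝ u v), ← integral_neg]
    refine integral_congr_ae (.of_forall fun x => ?_)
    have : inner ℝ (R (direction x)) v = -(inner ℝ (direction x) v : ℝ) := by
      rw [← R.inner_map_map (direction x) v, hRv, inner_neg_right, neg_neg]
    simp only [this]
    ring
  have h2 : 2 * I = ∫ x, (F (direction x) - F (R (direction x))) * inner ℝ (direction x) v
      ∂(stdGaussian (EuclideanSpace ℝ ι)) := by
    simp only [sub_mul]
    rw [integral_sub (integrable_mul_inner_direction hF hM v), h1]
    · ring
    · exact integrable_mul_inner_direction (F := fun u => F (R u))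
        (hF.comp R.continuous.measurable) (fun u hu => hM _ (by rwa [R.norm_map])) v
  have h3 : |2 * I| ≤ ∫ x, (2 * C / ‖v‖) * (inner ℝ (direction x) v * inner ℝ (direction x) v)
      ∂(stdGaussian (EuclideanSpace ℝ ι)) := by
    rw [h2]
    refine abs_integral_le_integral_abs.trans (integral_mono_of_nonneg
      (.of_forall fun _ => abs_nonneg _) ((integrable_inner_direction_mul v v).const_mul _)
      (.of_forall fun x => ?_))
    simp only
    rw [abs_mul]
    have h4 := hC (direction x) (R (direction x)) (norm_direction_le x)
      (by rw [R.norm_map]; exact norm_direction_le x)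
    rw [hRu, norm_smul, Real.norm_eq_abs, abs_mul, abs_div, abs_two,
      abs_of_pos (by positivity : 0 < ‖v‖ ^ 2)] at h4
    calc _ ≤ C * (2 * (|inner ℝ (direction x) v| / ‖v‖ ^ 2) * ‖v‖)
          * |inner ℝ (direction x) v| := by gcongr
      _ = 2 * C / ‖v‖ * (|inner ℝ (direction x) v| * |inner ℝ (direction x) v|) := by
          field_simp
      _ = _ := by rw [abs_mul_abs_self]
  rw [integral_const_mul, integral_inner_direction_sq, abs_mul, abs_two] at h3
  have h5 : 2 * C / ‖v‖ * (‖v‖ ^ 2 / Fintype.card ι) = 2 * (C * ‖v‖ / Fintype.card ι) := by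
    field_simp
  linarith

end Direction

/-! ### Continuity of rollouts and measurability of the cost -/

section Measurability

variable {n m p : ℕ} (S : Plant n m p) (γ : ℝ)

lemma continuous_mat : Continuous (Gain.mat : Gain m p → Matrix (Fin m) (Fin p) ℝ) :=
  continuous_matrix fun i j => by unfold Gain.mat; simp only [Matrix.of_apply]; fun_prop

lemma Plant.continuous_dampedState (t : ℕ) :
    Continuous fun q : Gain m p × EuclideanSpace ℝ (Fin n) => S.dampedState γ q.1 q.2 t := by
  induction t with
  | zero => simp only [Plant.dampedState]; fun_prop
  | succ t ih =>
    simp only [Plant.dampedState]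
    have h : Continuous fun q : Gain m p × EuclideanSpace ℝ (Fin n) =>
        (S.A - S.B * q.1.mat * S.C) *ᵥ S.dampedState γ q.1 q.2 t :=
      Continuous.matrix_mulVec (continuous_const.sub ((continuous_const.matrix_mul
        (continuous_mat.comp continuous_fst)).matrix_mul continuous_const)) ih
    exact h.const_smul √γ

lemma Plant.continuous_stage :
    Continuous fun q : Gain m p × (Fin n → ℝ) => S.stage q.1 q.2 := by
  have h : Continuous fun q : Gain m p × (Fin n → ℝ) => S.input q.1 q.2 :=
    ((continuous_mat.comp continuous_fst).matrix_mulVec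
      (continuous_const.matrix_mulVec continuous_snd)).neg
  exact (continuous_snd.dotProduct (continuous_const.matrix_mulVec continuous_snd)).add
    (h.dotProduct (continuous_const.matrix_mulVec h))

lemma Plant.continuous_rollout (τ : ℕ) :
    Continuous fun q : Gain m p × EuclideanSpace ℝ (Fin n) => S.rollout γ τ q.1 q.2 :=
  continuous_finsetSum _ fun t _ =>
    S.continuous_stage.comp (continuous_fst.prodMk (S.continuous_dampedState γ t))

variable {S γ} {μ : Measure (EuclideanSpace ℝ (Fin n))} {d : ℝ}

lemma Plant.measurable_cost [SFinite μ] (hγ : 0 ≤ γ) : Measurable (S.cost μ γ) := by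
  have h : Measurable fun q : Gain m p × EuclideanSpace ℝ (Fin n) =>
      ∑' t : ℕ, ENNReal.ofReal (γ ^ t * S.stage q.1 (S.state q.1 q.2 t)) := by
    simp only [S.discounted_stage hγ]
    exact Measurable.tsum fun t => (S.continuous_stage.comp
      (continuous_fst.prodMk (S.continuous_dampedState γ t))).measurable.ennreal_ofReal
  exact h.lintegral_prod_right'

lemma Plant.measurable_costReal [SFinite μ] (hγ : 0 ≤ γ) : Measurable (S.costReal μ γ) :=
  (Plant.measurable_cost hγ).ennreal_toReal

lemma Plant.measurable_integral_rollout [SFinite μ] (τ : ℕ) :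
    Measurable fun K : Gain m p => ∫ x, S.rollout γ τ K x ∂μ :=
  ((S.continuous_rollout γ τ).measurable.stronglyMeasurable.integral_prod_right
    (f := fun K x => S.rollout γ τ K x)).measurable

lemma Plant.integrable_rollout (hμ : IsInitialLaw μ d) (τ : ℕ) (K : Gain m p) :
    Integrable (fun x => S.rollout γ τ K x) μ := by
  have := hμ.prob
  have hc : Continuous fun x => S.rollout γ τ K x :=
    (S.continuous_rollout γ τ).comp (continuous_const.prodMk continuous_id)
  obtain ⟨M, hM⟩ := (isCompact_closedBall (0 : EuclideanSpace ℝ (Fin n)) d).exists_bound_of_continuousOn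
    hc.continuousOn
  refine Integrable.of_bound (C := M) hc.aestronglyMeasurable ?_
  filter_upwards [hμ.bounded] with x hx
  exact hM x (by simpa using hx)

end Measurability

/-! ### Bias of the two-point gradient estimate -/

section Bias

variable {n m p : ℕ} {S : Plant n m p} {γ : ℝ} {μ : Measure (EuclideanSpace ℝ (Fin n))} {d : ℝ}

/-- Local regularity of the cost and of its rollouts of length `τ` at a gain `K`. -/
structure Plant.RegularAt (S : Plant n m p) (μ : Measure (EuclideanSpace ℝ (Fin n))) (γ : ℝ)
    (τ : ℕ) (K g : Gain m p) (D c₁ c₂ r T : ℝ) : Prop where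
  cost_ne_top : ∀ a, ‖a‖ ≤ D → S.cost μ γ (K + a) ≠ ⊤
  lip : ∀ a, ‖a‖ ≤ D → |S.costReal μ γ (K + a) - S.costReal μ γ K| ≤ c₁ * ‖a‖
  quad : ∀ a b, ‖a‖ ≤ D → ‖b‖ ≤ D →
    |S.costReal μ γ (K + a) - S.costReal μ γ (K + b) - inner ℝ g (a - b)|
      ≤ c₂ * (‖a‖ + ‖b‖) * ‖a - b‖
  rollout_lip : ∀ a x, ‖a‖ ≤ D →
    |S.rollout γ τ (K + a) x - S.rollout γ τ K x| ≤ c₁ * ‖a‖ * ‖x‖ ^ 2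
  tail_nonneg : ∀ a, ‖a‖ ≤ r → 0 ≤ S.costReal μ γ (K + a) - ∫ x, S.rollout γ τ (K + a) x ∂μ
  tail_le : ∀ a, ‖a‖ ≤ r → S.costReal μ γ (K + a) - ∫ x, S.rollout γ τ (K + a) x ∂μ ≤ T

/-- The contribution of one sample to the gradient estimate. -/
noncomputable def Plant.sampleEst (S : Plant n m p) (γ : ℝ) (τ : ℕ) (r : ℝ) (K : Gain m p)
    (z : Gain m p × EuclideanSpace ℝ (Fin n)) : Gain m p :=
  ((m : ℝ) * p / (2 * r)) • (S.rollout γ τ (K + r • direction z.1) z.2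
      - S.rollout γ τ (K - r • direction z.1) z.2) • direction z.1

lemma Plant.gradEst_eq (S : Plant n m p) (γ : ℝ) (τ : ℕ) (r : ℝ) {N : ℕ}
    (z : Fin N → Gain m p × EuclideanSpace ℝ (Fin n)) (K : Gain m p) :
    S.gradEst γ τ r z K = (N : ℝ)⁻¹ • ∑ i, S.sampleEst γ τ r K (z i) := by
  simp only [Plant.gradEst, Plant.sampleEst, direction]
  rw [← Finset.smul_sum, smul_smul]
  congr 1
  rw [← div_div, div_eq_mul_inv, mul_comm]

lemma Plant.measurable_sampleEst (τ : ℕ) (r : ℝ) :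
    Measurable fun q : Gain m p × (Gain m p × EuclideanSpace ℝ (Fin n)) =>
      S.sampleEst γ τ r q.1 q.2 := by
  have hd : Measurable fun q : Gain m p × (Gain m p × EuclideanSpace ℝ (Fin n)) =>
      direction q.2.1 := measurable_direction.comp (measurable_fst.comp measurable_snd)
  have h := (S.continuous_rollout γ τ).measurable
  have hx : Measurable fun q : Gain m p × (Gain m p × EuclideanSpace ℝ (Fin n)) => q.2.2 :=
    measurable_snd.comp measurable_snd
  have ha : Measurable fun q : Gain m p × (Gain m p × EuclideanSpace ℝ (Fin n)) =>
      q.1 + r • direction q.2.1 := measurable_fst.add (hd.const_smul r)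
  have hs : Measurable fun q : Gain m p × (Gain m p × EuclideanSpace ℝ (Fin n)) =>
      q.1 - r • direction q.2.1 := measurable_fst.sub (hd.const_smul r)
  have h1 := ((h.comp (ha.prodMk hx)).sub (h.comp (hs.prodMk hx))).smul hd
  exact h1.const_smul ((m : ℝ) * p / (2 * r))

lemma norm_smul_direction_le {r : ℝ} (hr : 0 ≤ r) (x : Gain m p) : ‖r • direction x‖ ≤ r := by
  rw [norm_smul, Real.norm_of_nonneg hr]
  exact mul_le_of_le_one_right hr (norm_direction_le x)

variable {τ : ℕ} {K g : Gain m p} {D c₁ c₂ r T : ℝ}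

/-- Both rollouts lie within `c₁ r ‖x₀‖²` of the rollout at `K`, so the factor `1/r` cancels and a
small radius does not inflate the samples. -/
lemma Plant.RegularAt.norm_sampleEst_le (H : S.RegularAt μ γ τ K g D c₁ c₂ r T) (hr : 0 < r)
    (hrD : r ≤ D) (hc₁ : 0 ≤ c₁) (z : Gain m p × EuclideanSpace ℝ (Fin n)) :
    ‖S.sampleEst γ τ r K z‖ ≤ m * p * c₁ * ‖z.2‖ ^ 2 := by
  set a := r • direction z.1 with ha
  have har : ‖a‖ ≤ r := norm_smul_direction_le hr.le _
  have h1 := H.rollout_lip a z.2 (har.trans hrD)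
  have h2 := H.rollout_lip (-a) z.2 (by rw [norm_neg]; exact har.trans hrD)
  rw [norm_neg, ← sub_eq_add_neg] at h2
  have h3 : |S.rollout γ τ (K + a) z.2 - S.rollout γ τ (K - a) z.2| ≤ 2 * (c₁ * r * ‖z.2‖ ^ 2) := by
    have h4 : c₁ * ‖a‖ * ‖z.2‖ ^ 2 ≤ c₁ * r * ‖z.2‖ ^ 2 := by gcongr
    rw [abs_le] at h1 h2 ⊢
    constructor <;> linarith [h1.1, h1.2, h2.1, h2.2]
  rw [Plant.sampleEst, norm_smul, norm_smul, Real.norm_of_nonneg (by positivity), Real.norm_eq_abs]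
  calc _ ≤ (m : ℝ) * p / (2 * r) * (2 * (c₁ * r * ‖z.2‖ ^ 2) * 1) := by
        gcongr
        exact norm_direction_le _
    _ = _ := by field_simp

lemma IsInitialLaw.ae_prod_norm_le (hμ : IsInitialLaw μ d) :
    ∀ᵐ z ∂((stdGaussian (Gain m p)).prod μ), ‖z.2‖ ≤ d := by
  have := hμ.prob
  exact Measure.quasiMeasurePreserving_snd.ae hμ.bounded

lemma Plant.RegularAt.ae_norm_sampleEst_le (H : S.RegularAt μ γ τ K g D c₁ c₂ r T) (hr : 0 < r)
    (hrD : r ≤ D) (hc₁ : 0 ≤ c₁) (hμ : IsInitialLaw μ d) :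
    ∀ᵐ z ∂((stdGaussian (Gain m p)).prod μ), ‖S.sampleEst γ τ r K z‖ ≤ m * p * c₁ * d ^ 2 := by
  filter_upwards [hμ.ae_prod_norm_le] with z hz
  refine (H.norm_sampleEst_le hr hrD hc₁ z).trans ?_
  gcongr

lemma Plant.measurable_sampleEst_right (τ : ℕ) (r : ℝ) (K : Gain m p) :
    Measurable fun z => S.sampleEst γ τ r K z := by
  have h : Measurable (Function.uncurry (S.sampleEst γ τ r)) := Plant.measurable_sampleEst τ r
  exact h.of_uncurry_left

lemma Plant.RegularAt.integrable_sampleEst (H : S.RegularAt μ γ τ K g D c₁ c₂ r T) (hr : 0 < r)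
    (hrD : r ≤ D) (hc₁ : 0 ≤ c₁) (hμ : IsInitialLaw μ d) :
    Integrable (S.sampleEst γ τ r K) ((stdGaussian (Gain m p)).prod μ) := by
  have := hμ.prob
  exact Integrable.of_bound (Plant.measurable_sampleEst_right τ r K).aestronglyMeasurable _
    (H.ae_norm_sampleEst_le hr hrD hc₁ hμ)

lemma norm_le_of_forall_inner_le {E : Type*} [NormedAddCommGroup E] [InnerProductSpace ℝ E]
    {w : E} {c : ℝ} (hc : 0 ≤ c) (h : ∀ v, inner ℝ w v ≤ c * ‖v‖) : ‖w‖ ≤ c := by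
  have h1 := h w
  rw [real_inner_self_eq_norm_sq] at h1
  by_contra! h2
  nlinarith [norm_nonneg w]

/-- The bias of the two-point estimate: a smoothing error and a truncation error. -/
theorem Plant.RegularAt.norm_integral_sampleEst_sub_le
    (H : S.RegularAt μ γ τ K g D c₁ c₂ r T) (hr : 0 < r) (hrD : r ≤ D) (hc₁ : 0 ≤ c₁)
    (hc₂ : 0 ≤ c₂) (hT : 0 ≤ T) (hμ : IsInitialLaw μ d) (hγ : 0 ≤ γ) (hm : 0 < m) (hp : 0 < p) :
    ‖∫ z, S.sampleEst γ τ r K z ∂((stdGaussian (Gain m p)).prod μ) - g‖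
      ≤ 2 * c₂ * r + m * p / (2 * r) * T := by
  have := hμ.prob
  have : NeZero m := ⟨hm.ne'⟩
  have : NeZero p := ⟨hp.ne'⟩
  have hint := H.integrable_sampleEst hr hrD hc₁ hμ
  have hm0 : (0 : ℝ) < m := by exact_mod_cast hm
  have hp0 : (0 : ℝ) < p := by exact_mod_cast hp
  have hcard : ((Fintype.card (Fin m × Fin p) : ℕ) : ℝ) = m * p := by simp
  refine norm_le_of_forall_inner_le (by positivity) fun v => ?_
  set J := S.costReal μ γ with hJ
  have hJm : Measurable J := Plant.measurable_costReal hγ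
  set Jt : Gain m p → ℝ := fun K => ∫ x, S.rollout γ τ K x ∂μ with hJt
  have hJtm : Measurable Jt := Plant.measurable_integral_rollout τ
  have hneg : ∀ a : Gain m p, K - a = K + -a := fun a => sub_eq_add_neg _ _
  have hur : ∀ u : Gain m p, ‖u‖ ≤ 1 → ‖r • u‖ ≤ r := fun u hu => by
    rw [norm_smul, Real.norm_of_nonneg hr.le]
    exact mul_le_of_le_one_right hr.le hu
  have hur' : ∀ u : Gain m p, ‖u‖ ≤ 1 → ‖-(r • u)‖ ≤ r := fun u hu => by
    rw [norm_neg]; exact hur u hu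
  -- The symmetric difference minus its linear part. The two-point second order bound makes it `4 c₂
  -- r²`-Lipschitz, not merely small, which is what the moment lemma needs to gain `1/(mp)`.
  set F : Gain m p → ℝ := fun u => J (K + r • u) - J (K - r • u) - 2 * r * inner ℝ u g with hF
  have hFm : Measurable F := by
    refine ((hJm.comp (by fun_prop)).sub (hJm.comp (by fun_prop))).sub ?_
    fun_prop
  have hFC : ∀ u w, ‖u‖ ≤ 1 → ‖w‖ ≤ 1 → |F u - F w| ≤ (4 * c₂ * r ^ 2) * ‖u - w‖ := by
    intro u w hu hw
    have hq : ∀ a b : Gain m p, ‖a‖ ≤ r → ‖b‖ ≤ r →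
        |J (K + a) - J (K + b) - inner ℝ g (a - b)| ≤ c₂ * (r + r) * ‖a - b‖ := fun a b ha hb =>
      (H.quad a b (ha.trans hrD) (hb.trans hrD)).trans (by gcongr)
    have h1 := hq _ _ (hur u hu) (hur w hw)
    have h2 := hq _ _ (hur' u hu) (hur' w hw)
    have e1 : ‖r • u - r • w‖ = r * ‖u - w‖ := by
      rw [← smul_sub, norm_smul, Real.norm_of_nonneg hr.le]
    have e2 : ‖-(r • u) - -(r • w)‖ = r * ‖u - w‖ := by
      rw [← e1, ← norm_neg]; congr 1; abel
    rw [e1] at h1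
    rw [e2] at h2
    have e3 : F u - F w = (J (K + r • u) - J (K + r • w) - inner ℝ g (r • u - r • w))
        - (J (K + -(r • u)) - J (K + -(r • w)) - inner ℝ g (-(r • u) - -(r • w))) := by
      simp only [hF, hneg, inner_sub_right, inner_neg_right, inner_smul_right,
        real_inner_comm g]
      ring
    rw [e3]
    refine (abs_sub _ _).trans ((add_le_add h1 h2).trans_eq (by ring))
  have hFM : ∀ u, ‖u‖ ≤ 1 → |F u| ≤ 4 * c₂ * r ^ 2 := fun u hu => by
    have h0 : F 0 = 0 := by simp [hF]
    have := hFC u 0 hu (by simp)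
    rw [h0, sub_zero, sub_zero] at this
    exact this.trans (mul_le_of_le_one_right (by positivity) hu)
  have hF1 := abs_integral_mul_inner_direction_le hFm hFM hFC v
  set H2 : Gain m p → ℝ := fun u => (J (K + r • u) - Jt (K + r • u))
    - (J (K - r • u) - Jt (K - r • u)) with hH2
  have hH2m : Measurable H2 := by
    refine ((hJm.comp ?_).sub (hJtm.comp ?_)).sub ((hJm.comp ?_).sub (hJtm.comp ?_)) <;> fun_prop
  -- Both truncation errors lie in `[0, T]`, so their difference costs `T` rather than `2 T`.
  have hH2M : ∀ u, ‖u‖ ≤ 1 → |H2 u| ≤ T := fun u hu => by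
    have h1 := H.tail_nonneg _ (hur u hu)
    have h2 := H.tail_nonneg _ (hur' u hu)
    have h3 := H.tail_le _ (hur u hu)
    have h4 := H.tail_le _ (hur' u hu)
    rw [← hneg] at h2 h4
    rw [abs_le]
    constructor <;> simp only [hH2, hJ, hJt] <;> linarith
  have hH2I : |∫ x, H2 (direction x) * inner ℝ (direction x) v ∂(stdGaussian (Gain m p))|
      ≤ T * ‖v‖ := by
    have := norm_integral_le_of_norm_le_const (μ := stdGaussian (Gain m p)) (C := T * ‖v‖)
      (f := fun x => H2 (direction x) * inner ℝ (direction x) v) (.of_forall fun x => by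
        rw [norm_mul]
        gcongr
        · exact hH2M _ (norm_direction_le x)
        · exact abs_inner_direction_le x v)
    simpa using this
  have hmain : inner ℝ (∫ z, S.sampleEst γ τ r K z ∂((stdGaussian (Gain m p)).prod μ)) v
      = m * p / (2 * r) * ∫ x, (Jt (K + r • direction x) - Jt (K - r • direction x))
          * inner ℝ (direction x) v ∂(stdGaussian (Gain m p)) := by
    rw [real_inner_comm, ← integral_inner hint, integral_prod _ (hint.const_inner v),
      ← integral_const_mul]
    refine integral_congr_ae (.of_forall fun x => ?_)
    simp only [Plant.sampleEst, inner_smul_right]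
    rw [integral_const_mul, integral_mul_const,
      integral_sub (Plant.integrable_rollout hμ τ _) (Plant.integrable_rollout hμ τ _),
      real_inner_comm]
  have hsplit : ∫ x, (Jt (K + r • direction x) - Jt (K - r • direction x))
          * inner ℝ (direction x) v ∂(stdGaussian (Gain m p))
      = ∫ x, F (direction x) * inner ℝ (direction x) v ∂(stdGaussian (Gain m p))
        + 2 * r * (inner ℝ g v / (m * p))
        - ∫ x, H2 (direction x) * inner ℝ (direction x) v ∂(stdGaussian (Gain m p)) := by
    have hg2 := (integrable_inner_direction_mul v g).const_mul (2 * r)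
    have hadd : Integrable (fun x => F (direction x) * inner ℝ (direction x) v
        + 2 * r * ((inner ℝ (direction x) g : ℝ) * inner ℝ (direction x) v))
        (stdGaussian (Gain m p)) := (integrable_mul_inner_direction hFm hFM v).add hg2
    rw [← hcard, ← integral_inner_direction_mul, ← integral_const_mul,
      ← integral_add (integrable_mul_inner_direction hFm hFM v) hg2,
      ← integral_sub hadd (integrable_mul_inner_direction hH2m hH2M v)]
    refine integral_congr_ae (.of_forall fun x => ?_)
    simp only [hF, hH2]
    ring
  rw [inner_sub_left, hmain, hsplit]
  rw [hcard] at hF1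
  have h1 := (abs_le.1 hF1).2
  have h2 := (abs_le.1 hH2I).1
  set I1 := ∫ x, F (direction x) * inner ℝ (direction x) v ∂(stdGaussian (Gain m p))
  set I2 := ∫ x, H2 (direction x) * inner ℝ (direction x) v ∂(stdGaussian (Gain m p))
  calc _ = m * p / (2 * r) * (I1 - I2) := by field_simp; ring
    _ ≤ m * p / (2 * r) * (4 * c₂ * r ^ 2 * ‖v‖ / (m * p) + T * ‖v‖) := by
        gcongr
        linarith
    _ = _ := by field_simp; ring

end Bias

/-! ### Gradient and deviation bound at a fixed gain -/

section FixedGain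

variable {n m p : ℕ} {S : Plant n m p} {γ : ℝ} {μ : Measure (EuclideanSpace ℝ (Fin n))} {d : ℝ}
  {τ : ℕ} {K g : Gain m p} {D c₁ c₂ r T : ℝ}

lemma Plant.RegularAt.hasGradientAt (H : S.RegularAt μ γ τ K g D c₁ c₂ r T) (hD : 0 < D) :
    HasGradientAt (S.costReal μ γ) g K := by
  rw [hasGradientAt_iff_isLittleO_nhds_zero]
  have hO : (fun h => S.costReal μ γ (K + h) - S.costReal μ γ K - inner ℝ g h)
      =O[nhds 0] fun h => ‖h‖ ^ 2 := by
    refine Asymptotics.IsBigO.of_bound c₂ ?_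
    filter_upwards [Metric.closedBall_mem_nhds (0 : Gain m p) hD] with h hh
    rw [mem_closedBall_zero_iff] at hh
    have := H.quad h 0 hh (by simpa using hD.le)
    simp only [norm_zero, add_zero, sub_zero] at this
    rw [Real.norm_eq_abs, norm_pow, norm_norm]
    exact this.trans_eq (by ring)
  exact hO.trans_isLittleO (by simpa using Asymptotics.isLittleO_norm_pow_id one_lt_two)

lemma Plant.RegularAt.norm_gradient_le (H : S.RegularAt μ γ τ K g D c₁ c₂ r T) (hD : 0 < D)
    (hc₁ : 0 ≤ c₁) : ‖g‖ ≤ c₁ := by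
  have h := (H.hasGradientAt hD).hasFDerivAt.le_of_lip' hc₁ (by
    filter_upwards [Metric.closedBall_mem_nhds K hD] with x hx
    rw [mem_closedBall_iff_norm] at hx
    have := H.lip (x - K) hx
    rwa [add_sub_cancel] at this)
  simpa using h

/-- Deviation of the gradient estimate from the gradient at a fixed gain. -/
theorem Plant.RegularAt.measureReal_gradEst_le
    (H : S.RegularAt μ γ τ K g D c₁ c₂ r T) (hr : 0 < r) (hrD : r ≤ D) (hc₁ : 0 < c₁)
    (hc₂ : 0 ≤ c₂) (hT : 0 ≤ T) (hμ : IsInitialLaw μ d) (hd : 0 < d) (hγ : 0 ≤ γ)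
    (hm : 0 < m) (hp : 0 < p) {N : ℕ} (hN : 0 < N) {t : ℝ} (ht : 0 ≤ t) :
    (Measure.pi fun _ : Fin N => (stdGaussian (Gain m p)).prod μ).real
        {z | 2 * c₂ * r + m * p / (2 * r) * T + t ≤ ‖S.gradEst γ τ r z K - g‖}
      ≤ 2 * Real.exp (-(N * t ^ 2 / (2 * (2 * (m * p * c₁ * d ^ 2)) ^ 2))) := by
  have := hμ.prob
  have hm0 : (0 : ℝ) < m := by exact_mod_cast hm
  have hp0 : (0 : ℝ) < p := by exact_mod_cast hp
  have hN0 : (0 : ℝ) < N := by exact_mod_cast hN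
  set ρ := (stdGaussian (Gain m p)).prod μ with hρ
  set e := ∫ z, S.sampleEst γ τ r K z ∂ρ with he
  have hbias := H.norm_integral_sampleEst_sub_le hr hrD hc₁.le hc₂ hT hμ hγ hm hp
  have hint := H.integrable_sampleEst hr hrD hc₁.le hμ
  have hbd := H.ae_norm_sampleEst_le hr hrD hc₁.le hμ
  have hebd : ‖e‖ ≤ m * p * c₁ * d ^ 2 := by
    simpa using norm_integral_le_of_norm_le_const hbd
  set Y : Gain m p × EuclideanSpace ℝ (Fin n) → Gain m p := fun z => S.sampleEst γ τ r K z - e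
    with hY
  have hYm : Measurable Y := (Plant.measurable_sampleEst_right τ r K).sub_const e
  have hY0 : ∫ z, Y z ∂ρ = 0 := by
    simp only [hY]
    rw [integral_sub hint (integrable_const _)]
    simp [he]
    exact sub_self _
  have hYb : ∀ᵐ z ∂ρ, ‖Y z‖ ≤ 2 * (m * p * c₁ * d ^ 2) := by
    filter_upwards [hbd] with z hz
    exact (norm_sub_le _ _).trans (by linarith)
  have hpres := fun i : Fin N => measurePreserving_eval (fun _ : Fin N => ρ) i
  -- Centering at the mean `e` doubles the almost sure bound of a sample; the bias `e - g` is added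
  -- by the triangle inequality.
  have hpin := measureReal_norm_sum_ge_le (P := Measure.pi fun _ : Fin N => ρ)
    (X := fun i z => Y (z i)) (b := 2 * (m * p * c₁ * d ^ 2)) (a := N * t)
    (iIndepFun_pi (X := fun _ => Y) fun _ => hYm.aemeasurable)
    (fun i => hYm.comp (measurable_pi_apply i)) (by positivity)
    (fun i => (hpres i).quasiMeasurePreserving.ae hYb)
    (fun i => by
      have h1 := integral_map (μ := Measure.pi fun _ : Fin N => ρ) (hpres i).measurable.aemeasurable
        (f := Y) hYm.aestronglyMeasurable
      rw [(hpres i).map_eq, hY0] at h1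
      exact h1.symm) (by positivity) (by simpa using hN)
  refine (measureReal_mono fun z hz => ?_).trans (hpin.trans_eq ?_)
  · simp only [Set.mem_ofPred_eq] at hz ⊢
    have e1 : ∑ i, Y (z i) = (N : ℝ) • (S.gradEst γ τ r z K - e) := by
      rw [Plant.gradEst_eq, smul_sub, smul_smul, mul_inv_cancel₀ hN0.ne', one_smul]
      simp only [hY]
      rw [Finset.sum_sub_distrib, Finset.sum_const, Finset.card_univ, Fintype.card_fin,
        Nat.cast_smul_eq_nsmul]
    rw [e1, norm_smul, Real.norm_of_nonneg hN0.le]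
    gcongr
    have h2 : ‖S.gradEst γ τ r z K - g‖ ≤ ‖S.gradEst γ τ r z K - e‖ + ‖e - g‖ := by
      rw [← sub_add_sub_cancel _ e g]; exact norm_add_le _ _
    linarith
  · rw [Fintype.card_fin]
    congr 3
    field_simp

end FixedGain

/-! ### Accuracy of the estimate with the prescribed parameters -/

section Sublevel

variable {n m p : ℕ} {S : Plant n m p} {γ : ℝ} {μ : Measure (EuclideanSpace ℝ (Fin n))} {d : ℝ}
  {K : Gain m p} {ℓ₀ ℓ₁ ψ φ ν : ℝ}

lemma IsInitialLaw.one_le_sq (hμ : IsInitialLaw μ d) (hn : 0 < n) : 1 ≤ d ^ 2 := by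
  have := hμ.prob
  have h := hμ.covariance ⟨0, hn⟩ ⟨0, hn⟩
  rw [Matrix.one_apply_eq] at h
  rw [← h]
  have h1 : ∫ x : EuclideanSpace ℝ (Fin n), x ⟨0, hn⟩ * x ⟨0, hn⟩ ∂μ ≤ ∫ _, d ^ 2 ∂μ := by
    refine integral_mono_of_nonneg (.of_forall fun x => mul_self_nonneg _) (integrable_const _) ?_
    filter_upwards [hμ.bounded] with x hx
    have h2 := (PiLp.norm_apply_le x ⟨0, hn⟩).trans hx
    rw [Real.norm_eq_abs] at h2
    have hd0 : 0 ≤ d := (abs_nonneg _).trans h2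
    rw [← abs_mul_abs_self, pow_two]
    gcongr
  simpa using h1

lemma constD_pos (hℓ₀ : 0 < ℓ₀) (hν : 0 < ν) (hψ : 1 ≤ ψ) (hφ : 1 ≤ φ) :
    0 < constD ν ℓ₀ ψ φ := by
  have := kap_pos hℓ₀ hν
  rw [constD]
  positivity

theorem regularAt_gradient (hℓ₀ : 0 < ℓ₀) (hℓ : ℓ₀ ≤ ℓ₁) (hψ : 1 ≤ ψ) (hφ : 1 ≤ φ)
    (hS : S.Bounded ℓ₀ ℓ₁ ψ φ) (hμ : IsInitialLaw μ d) (hγ0 : 0 < γ) (hγ1 : γ < 1)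
    (hν : 0 < ν) (hn : 0 < n) (hK : K ∈ S.sublevel μ γ ν) (τ : ℕ) {r : ℝ}
    (hrD : r ≤ constD ν ℓ₀ ψ φ) (hrG : r ≤ ν / constG ν ℓ₀ ℓ₁ ψ φ) :
    S.RegularAt μ γ τ K (gradient (S.costReal μ γ) K) (constD ν ℓ₀ ψ φ) (lipConst ν ℓ₀ ℓ₁ ψ φ)
      (quadConst ν ℓ₀ ℓ₁ ψ φ) r (2 * ν * Real.exp (-(ℓ₀ / (2 * ν) * τ))) := by
  obtain ⟨g, h1, h2, h3, h4, h5⟩ := exists_regularity hℓ₀ hℓ hψ hφ hS hμ hγ0 hγ1 hν hn hK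
  have H : S.RegularAt μ γ τ K g (constD ν ℓ₀ ψ φ) (lipConst ν ℓ₀ ℓ₁ ψ φ)
      (quadConst ν ℓ₀ ℓ₁ ψ φ) r (2 * ν * Real.exp (-(ℓ₀ / (2 * ν) * τ))) :=
    ⟨h1, h2, h3, fun a x => h4 a x τ, fun a ha => (h5 a τ (ha.trans hrD) (ha.trans hrG)).1,
      fun a ha => (h5 a τ (ha.trans hrD) (ha.trans hrG)).2⟩
  rwa [(H.hasGradientAt (constD_pos hℓ₀ hν hψ hφ)).gradient]

lemma one_le_kap (hℓ₀ : 0 < ℓ₀) (hℓ : ℓ₀ ≤ ℓ₁) (hψ : 1 ≤ ψ) (hφ : 1 ≤ φ)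
    (hS : S.Bounded ℓ₀ ℓ₁ ψ φ) (hμ : IsInitialLaw μ d) (hγ0 : 0 < γ) (hγ1 : γ < 1)
    (hν : 0 < ν) (hn : 0 < n) (hK : K ∈ S.sublevel μ γ ν) : 1 ≤ kap ν ℓ₀ :=
  (exists_bounds hℓ₀ hℓ hψ hφ hS hμ hγ0 hγ1 hν hn hK).1

lemma quadConst_le (hℓ₀ : 0 < ℓ₀) (hℓ : ℓ₀ ≤ ℓ₁) (hν : 0 < ν) (hψ : 1 ≤ ψ) (hφ : 1 ≤ φ)
    (hm : 0 < m) (hp : 0 < p) :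
    104 / 27 * quadConst ν ℓ₀ ℓ₁ ψ φ ≤ constL m p ν ℓ₀ ℓ₁ ψ φ := by
  have := kap_pos hℓ₀ hν
  have hℓ₁ : 0 < ℓ₁ := hℓ₀.trans_le hℓ
  have h1 : 1 ≤ √((min m p : ℕ) : ℝ) := by
    rw [Real.one_le_sqrt]
    exact_mod_cast (by omega : 1 ≤ min m p)
  rw [quadConst, constL]
  calc _ = 104 * kap ν ℓ₀ ^ 10 * ℓ₁ * ψ ^ 2 * φ ^ 2 * 1 := by ring
    _ ≤ _ := by gcongr

/-- At a gain of the sublevel set the gradient estimate is `ε/3`-accurate with probability at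
least `1 - δ₀`. -/
theorem measureReal_gradEst_error_le (hℓ₀ : 0 < ℓ₀) (hℓ : ℓ₀ ≤ ℓ₁) (hψ : 1 ≤ ψ) (hφ : 1 ≤ φ)
    (hS : S.Bounded ℓ₀ ℓ₁ ψ φ) (hd : 0 < d) (hμ : IsInitialLaw μ d) (hγ0 : 0 < γ) (hγ1 : γ < 1)
    (hν : 0 < ν) (hn : 0 < n) (hm : 0 < m) (hp : 0 < p) (hK : K ∈ S.sublevel μ γ ν)
    {ε δ₀ r : ℝ} (hε : 0 < ε) (hδ₀ : 0 < δ₀) (hδ₁ : δ₀ < 1) {τ N : ℕ} (hr : 0 < r)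
    (hτ : 2 * ν / ℓ₀ * Real.log (36 * d ^ 2 * ν ^ 2 * m * p / (r * ε * ℓ₀)) ≤ τ)
    (hrD : r ≤ constD ν ℓ₀ ψ φ)
    (hrG : r ≤ ν / constG ν ℓ₀ ℓ₁ ψ φ)
    (hrL : r ≤ ε / (9 * constL m p ν ℓ₀ ℓ₁ ψ φ))
    (hN : 81 * (m * p * constG ν ℓ₀ ℓ₁ ψ φ) ^ 2 * (d ^ 2 + 1) ^ 2 / ε ^ 2
      * Real.log (15 / δ₀) ≤ N) :
    (Measure.pi fun _ : Fin N => (stdGaussian (Gain m p)).prod μ).real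
        {z | ε / 3 < ‖S.gradEst γ τ r z K - gradient (S.costReal μ γ) K‖} ≤ δ₀ := by
  have := hμ.prob
  have hκ1 := one_le_kap hℓ₀ hℓ hψ hφ hS hμ hγ0 hγ1 hν hn hK
  have H := regularAt_gradient hℓ₀ hℓ hψ hφ hS hμ hγ0 hγ1 hν hn hK τ hrD hrG
  have hd1 := hμ.one_le_sq hn
  have hℓ₁ : 0 < ℓ₁ := hℓ₀.trans_le hℓ
  have hm0 : (0 : ℝ) < m := by exact_mod_cast hm
  have hp0 : (0 : ℝ) < p := by exact_mod_cast hp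
  have hψ0 : 0 < ψ := by linarith
  have hφ0 : 0 < φ := by linarith
  have hquad := quadConst_le hℓ₀ hℓ hν hψ hφ hm hp
  have hκ0 : 0 < kap ν ℓ₀ := by linarith
  have hνℓ : ℓ₀ ≤ ν := by
    have h1 := kap_sq hℓ₀ hν
    have h2 : 1 ≤ kap ν ℓ₀ ^ 2 := one_le_pow₀ hκ1
    rw [h1, le_div_iff₀ hℓ₀] at h2
    linarith
  set c₁ := lipConst ν ℓ₀ ℓ₁ ψ φ with hc₁
  set c₂ := quadConst ν ℓ₀ ℓ₁ ψ φ with hc₂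
  have hc₁0 : 0 < c₁ := by rw [hc₁, lipConst]; positivity
  have hc₂0 : 0 < c₂ := by rw [hc₂, quadConst]; positivity
  set G := constG ν ℓ₀ ℓ₁ ψ φ with hG
  have hG0 : 0 < G := by rw [hG, constG]; positivity
  have hc₁G : 16 * c₁ ≤ 10 * G := by
    rw [hc₁, hG, lipConst, constG]
    have : kap ν ℓ₀ ^ 7 ≤ kap ν ℓ₀ ^ 9 := pow_le_pow_right₀ hκ1 (by norm_num)
    calc _ = 160 * kap ν ℓ₀ ^ 7 * ℓ₁ * ψ * φ := by ring
      _ ≤ 160 * kap ν ℓ₀ ^ 9 * ℓ₁ * ψ * φ := by gcongr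
      _ = _ := by ring
  have hlog : 0 < Real.log (15 / δ₀) := by
    refine Real.log_pos ?_
    rw [lt_div_iff₀ hδ₀]; linarith
  have hN0 : 0 < N := by
    have : (0 : ℝ) < N := lt_of_lt_of_le (by positivity) hN
    exact_mod_cast this
  set T := 2 * ν * Real.exp (-(ℓ₀ / (2 * ν) * τ)) with hT
  have hT0 : 0 ≤ T := by positivity
  -- Error budget: smoothing `54ε/936`, truncation `ε/36` and deviation `2ε/9` add up to less than
  -- `ε/3`. The first comes from `c₂ ≤ 27 L / 104` and `r ≤ ε / (9 L)`.
  have hsmooth : 2 * c₂ * r ≤ ε * (54 / 936) := by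
    have h1 : 0 < constL m p ν ℓ₀ ℓ₁ ψ φ := lt_of_lt_of_le (by positivity) hquad
    rw [le_div_iff₀ (by positivity)] at hrL
    have h2 : r * (9 * (104 / 27 * c₂)) ≤ ε := le_trans (by gcongr) hrL
    linarith
  have htrunc : m * p / (2 * r) * T ≤ ε / 36 := by
    set arg := 36 * d ^ 2 * ν ^ 2 * m * p / (r * ε * ℓ₀) with harg
    have harg0 : 0 < arg := by positivity
    have h1 : Real.log arg ≤ ℓ₀ / (2 * ν) * τ := by
      calc Real.log arg = ℓ₀ / (2 * ν) * (2 * ν / ℓ₀ * Real.log arg) := by field_simp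
        _ ≤ _ := by gcongr
    have h2 : Real.exp (-(ℓ₀ / (2 * ν) * τ)) ≤ arg⁻¹ := by
      rw [← Real.exp_log harg0, ← Real.exp_neg]
      gcongr
    calc m * p / (2 * r) * T ≤ m * p / (2 * r) * (2 * ν * arg⁻¹) := by rw [hT]; gcongr
      _ = ε / 36 * (ℓ₀ / (d ^ 2 * ν)) := by rw [harg]; field_simp
      -- Here `ℓ₀ ≤ ν` and `1 ≤ d ^ 2` enter, the latter because a coordinate has variance one.
      _ ≤ ε / 36 * 1 := by
          gcongr
          rw [div_le_one (by positivity)]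
          nlinarith
      _ = _ := mul_one _
  have hdev := H.measureReal_gradEst_le hr hrD hc₁0 hc₂0.le hT0 hμ hd hγ0.le hm hp hN0
    (t := 2 * ε / 9) (by positivity)
  refine (measureReal_mono fun z hz => ?_).trans (hdev.trans ?_)
  · simp only [Set.mem_ofPred_eq] at hz ⊢
    linarith
  · have h1 : Real.log (15 / δ₀) ≤ N * (2 * ε / 9) ^ 2 / (2 * (2 * (m * p * c₁ * d ^ 2)) ^ 2) := by
      rw [le_div_iff₀ (by positivity)]
      rw [div_mul_eq_mul_div, div_le_iff₀ (by positivity)] at hN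
      have h2 : 2 * (m * p * c₁ * d ^ 2) ≤ 5 / 4 * (m * p * G * (d ^ 2 + 1)) := by
        calc _ = m * p * (2 * c₁) * d ^ 2 := by ring
          _ ≤ m * p * (5 / 4 * G) * (d ^ 2 + 1) := by
              have h3 : 2 * c₁ ≤ 5 / 4 * G := by linarith
              have h4 : d ^ 2 ≤ d ^ 2 + 1 := by linarith
              exact mul_le_mul (mul_le_mul_of_nonneg_left h3 (by positivity)) h4
                (by positivity) (by positivity)
          _ = _ := by ring
      have h3 : (2 * (m * p * c₁ * d ^ 2)) ^ 2 ≤ (5 / 4 * (m * p * G * (d ^ 2 + 1))) ^ 2 := by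
        gcongr
      calc Real.log (15 / δ₀) * (2 * (2 * (m * p * c₁ * d ^ 2)) ^ 2)
          ≤ Real.log (15 / δ₀) * (2 * (5 / 4 * (m * p * G * (d ^ 2 + 1))) ^ 2) := by gcongr
        _ = 25 / 8 / 81 * (81 * (m * p * G) ^ 2 * (d ^ 2 + 1) ^ 2 * Real.log (15 / δ₀)) := by ring
        _ ≤ 4 / 81 * (81 * (m * p * G) ^ 2 * (d ^ 2 + 1) ^ 2 * Real.log (15 / δ₀)) := by
            gcongr
            norm_num
        _ ≤ 4 / 81 * (N * ε ^ 2) := by gcongr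
        _ = _ := by ring
    calc _ ≤ 2 * Real.exp (-Real.log (15 / δ₀)) := by gcongr
      _ = 2 / 15 * δ₀ := by
          rw [Real.exp_neg, Real.exp_log (by positivity)]; field_simp
      _ ≤ δ₀ := by linarith

end Sublevel

/-! ### Events about independent batches -/

section Fresh

variable {Ω α β : Type*} [MeasurableSpace Ω] [MeasurableSpace α] [MeasurableSpace β]

/-- An event about an independent pair whose slices are all unlikely is unlikely. -/
lemma measureReal_mem_le_of_indepFun {P : Measure Ω} [IsProbabilityMeasure P]
    {X : Ω → α} {Y : Ω → β} (hX : AEMeasurable X P) (hY : AEMeasurable Y P) (h : IndepFun X Y P)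
    {s : Set (α × β)} (hs : MeasurableSet s) {c : ℝ} (hc : 0 ≤ c)
    (hslice : ∀ x, (P.map Y).real (Prod.mk x ⁻¹' s) ≤ c) :
    P.real {ω | (X ω, Y ω) ∈ s} ≤ c := by
  have := Measure.isProbabilityMeasure_map hX
  have := Measure.isProbabilityMeasure_map hY
  have h1 : P {ω | (X ω, Y ω) ∈ s} = ((P.map X).prod (P.map Y)) s := by
    rw [← (indepFun_iff_map_prod_eq_prod_map_map hX hY).1 h,
      Measure.map_apply_of_aemeasurable (hX.prodMk hY) hs]
    rfl
  refine ENNReal.toReal_le_of_le_ofReal hc ?_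
  rw [h1, Measure.prod_apply hs]
  calc _ ≤ ∫⁻ _, ENNReal.ofReal c ∂(P.map X) := by
        refine lintegral_mono fun x => ?_
        rw [← ofReal_measureReal]
        exact ENNReal.ofReal_le_ofReal (hslice x)
    _ = ENNReal.ofReal c := by simp

/-- In an independent array, the rows before row `j` are independent of row `j`. -/
lemma iIndepFun.indepFun_rows {P : Measure Ω} [IsProbabilityMeasure P] {N : ℕ}
    {Z : ℕ → Fin N → Ω → α} (hZ : ∀ j i, AEMeasurable (Z j i) P)
    (h : iIndepFun (fun q : ℕ × Fin N => Z q.1 q.2) P) (j : ℕ) :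
    IndepFun (fun ω (q : Finset.range j ×ˢ (Finset.univ : Finset (Fin N))) => Z q.1.1 q.1.2 ω)
      (fun ω i => Z j i ω) P := by
  have h1 := h.indepFun_finset₀ (Finset.range j ×ˢ Finset.univ) ({j} ×ˢ Finset.univ)
    (by
      rw [Finset.disjoint_left]
      rintro ⟨k, i⟩ hk hk'
      simp only [Finset.mem_product, Finset.mem_range, Finset.mem_singleton] at hk hk'
      omega)
    (fun q => hZ q.1 q.2)
  refine h1.comp (φ := id) (ψ := fun (y : ({j} ×ˢ Finset.univ : Finset (ℕ × Fin N)) → α)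
    (i : Fin N) => y ⟨(j, i), by simp⟩) measurable_id ?_
  exact measurable_pi_lambda _ fun i => measurable_pi_apply _

end Fresh

/-! ### Transfer of the accuracy bound to the random iterates -/

section Iterates

variable {n m p : ℕ} {S : Plant n m p} {γ : ℝ} {μ : Measure (EuclideanSpace ℝ (Fin n))} {d : ℝ}

lemma Plant.measurable_gradEst (τ : ℕ) (r : ℝ) {N : ℕ} :
    Measurable fun q : (Fin N → Gain m p × EuclideanSpace ℝ (Fin n)) × Gain m p =>
      S.gradEst γ τ r q.1 q.2 := by
  simp only [Plant.gradEst_eq]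
  have h : ∀ i : Fin N, Measurable fun q :
      (Fin N → Gain m p × EuclideanSpace ℝ (Fin n)) × Gain m p =>
        S.sampleEst γ τ r q.2 (q.1 i) := by
    intro i
    have h1 : Measurable fun q : (Fin N → Gain m p × EuclideanSpace ℝ (Fin n)) × Gain m p =>
      (q.2, q.1 i) := by fun_prop
    have h2 := (Plant.measurable_sampleEst (S := S) (γ := γ) τ r).comp h1
    exact h2
  have h3 := Finset.measurable_fun_sum Finset.univ fun i _ => h i
  exact h3.const_smul (N : ℝ)⁻¹

lemma Plant.measurable_iterate (τ : ℕ) (r η : ℝ) {N : ℕ} (K₀ : Gain m p) (j : ℕ) :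
    Measurable fun z : ℕ → Fin N → Gain m p × EuclideanSpace ℝ (Fin n) =>
      S.iterate γ τ r η z K₀ j := by
  induction j with
  | zero => exact measurable_const
  | succ j ih =>
    exact ih.sub (((Plant.measurable_gradEst (S := S) (γ := γ) τ r).comp
      ((measurable_pi_apply j).prodMk ih)).const_smul η)

lemma Plant.iterate_congr {τ : ℕ} {r η : ℝ} {N : ℕ} {K₀ : Gain m p} {j : ℕ}
    {z z' : ℕ → Fin N → Gain m p × EuclideanSpace ℝ (Fin n)} (h : ∀ k < j, z k = z' k) :
    S.iterate γ τ r η z K₀ j = S.iterate γ τ r η z' K₀ j := by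
  induction j with
  | zero => rfl
  | succ j ih =>
    simp only [Plant.iterate]
    rw [ih fun k hk => h k (by omega), h j (by omega)]

lemma Plant.measurableSet_sublevel [SFinite μ] (hγ : 0 ≤ γ) (ν : ℝ) :
    MeasurableSet (S.sublevel μ γ ν) :=
  measurableSet_le (Plant.measurable_cost hγ) measurable_const

lemma measurable_gradient {E : Type*} [NormedAddCommGroup E] [InnerProductSpace ℝ E]
    [CompleteSpace E] [MeasurableSpace E] [BorelSpace E] (f : E → ℝ) :
    Measurable (gradient f) := by
  have := (InnerProductSpace.toDual ℝ E).symm.continuous.measurable.comp (measurable_fderiv ℝ f)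
  exact this

/-- The `j`-th iterate is independent of the `j`-th batch. -/
lemma Plant.aemeasurable_iterate_and_indepFun {τ : ℕ} {r η : ℝ} {N : ℕ} (K₀ : Gain m p)
    {Ω : Type*} [MeasurableSpace Ω] {P : Measure Ω} [IsProbabilityMeasure P]
    {Z : ℕ → Fin N → Ω → Gain m p × EuclideanSpace ℝ (Fin n)}
    (hZm : ∀ j i, AEMeasurable (Z j i) P)
    (hZind : iIndepFun (fun q : ℕ × Fin N => Z q.1 q.2) P) (j : ℕ) :
    AEMeasurable (fun ω => S.iterate γ τ r η (fun k i => Z k i ω) K₀ j) P ∧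
      IndepFun (fun ω => S.iterate γ τ r η (fun k i => Z k i ω) K₀ j) (fun ω i => Z j i ω) P := by
  classical
  -- Extending the first `j` batches by zeros does not change the `j`-th iterate and exhibits it as
  -- a measurable function of those batches alone.
  let pad : ((Finset.range j ×ˢ (Finset.univ : Finset (Fin N)) : Finset (ℕ × Fin N)) →
      Gain m p × EuclideanSpace ℝ (Fin n)) → ℕ → Fin N → Gain m p × EuclideanSpace ℝ (Fin n) :=
    fun x k i => if h : k < j then x ⟨(k, i), by simpa using h⟩ else 0
  have hpad : Measurable pad := by
    refine measurable_pi_lambda _ fun k => measurable_pi_lambda _ fun i => ?_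
    by_cases h : k < j
    · simp only [pad, h, dif_pos]; exact measurable_pi_apply _
    · simp only [pad, h, dif_neg, not_false_eq_true]; exact measurable_const
  have hF := (Plant.measurable_iterate (S := S) (γ := γ) τ r η K₀ j).comp hpad
  have hit : (fun ω => S.iterate γ τ r η (fun k i => Z k i ω) K₀ j)
      = fun ω => S.iterate γ τ r η (pad fun q => Z q.1.1 q.1.2 ω) K₀ j := by
    funext ω
    refine Plant.iterate_congr fun k hk => ?_
    funext i
    simp only [pad, hk, dif_pos]
  rw [hit]
  have hpast : AEMeasurable (fun ω (q : (Finset.range j ×ˢ (Finset.univ : Finset (Fin N)) :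
      Finset (ℕ × Fin N))) => Z q.1.1 q.1.2 ω) P := aemeasurable_pi_lambda _ fun q => hZm _ _
  exact ⟨hF.comp_aemeasurable hpast, (iIndepFun.indepFun_rows hZm hZind j).comp hF measurable_id⟩

/-- If at every gain of the sublevel set a fresh batch yields an estimate of error above `a` with
probability at most `c`, then so it does at the `j`-th iterate. -/
lemma measureReal_iterate_error_le [IsProbabilityMeasure μ] (hγ : 0 ≤ γ) {ν a c : ℝ} (hc : 0 ≤ c)
    (τ : ℕ) (r η : ℝ) {N : ℕ} (K₀ : Gain m p)
    (hfix : ∀ K ∈ S.sublevel μ γ ν,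
      (Measure.pi fun _ : Fin N => (stdGaussian (Gain m p)).prod μ).real
        {z | a < ‖S.gradEst γ τ r z K - gradient (S.costReal μ γ) K‖} ≤ c)
    {Ω : Type*} [MeasurableSpace Ω] {P : Measure Ω} [IsProbabilityMeasure P]
    {Z : ℕ → Fin N → Ω → Gain m p × EuclideanSpace ℝ (Fin n)}
    (hZlaw : ∀ j i, HasLaw (Z j i) ((stdGaussian (Gain m p)).prod μ) P)
    (hZind : iIndepFun (fun q : ℕ × Fin N => Z q.1 q.2) P) (j : ℕ) :
    P.real {ω | S.iterate γ τ r η (fun k i => Z k i ω) K₀ j ∈ S.sublevel μ γ ν ∧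
      a < ‖S.gradEst γ τ r (fun i => Z j i ω) (S.iterate γ τ r η (fun k i => Z k i ω) K₀ j)
        - gradient (S.costReal μ γ) (S.iterate γ τ r η (fun k i => Z k i ω) K₀ j)‖} ≤ c := by
  have hZm : ∀ j i, AEMeasurable (Z j i) P := fun j i => (hZlaw j i).aemeasurable
  have hlaw : P.map (fun ω i => Z j i ω)
      = Measure.pi fun _ : Fin N => (stdGaussian (Gain m p)).prod μ := by
    have h1 : iIndepFun (fun i => Z j i) P :=
      hZind.precomp (g := fun i : Fin N => (j, i)) fun _ _ h => (Prod.mk.inj h).2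
    rw [h1.map_fun_eq_pi_map (hZm j)]
    congr 1 with i
    rw [(hZlaw j i).map_eq]
  have hs : MeasurableSet {q : Gain m p × (Fin N → Gain m p × EuclideanSpace ℝ (Fin n)) |
      q.1 ∈ S.sublevel μ γ ν ∧
        a < ‖S.gradEst γ τ r q.2 q.1 - gradient (S.costReal μ γ) q.1‖} := by
    have hfst : Measurable fun q : Gain m p × (Fin N → Gain m p × EuclideanSpace ℝ (Fin n)) =>
      q.1 := measurable_fst
    have h1 : Measurable fun q : Gain m p × (Fin N → Gain m p × EuclideanSpace ℝ (Fin n)) =>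
        S.gradEst γ τ r q.2 q.1 := by
      have h := (Plant.measurable_gradEst (S := S) (γ := γ) τ r (N := N)).comp
        (measurable_swap (α := Gain m p))
      exact h
    have h2 : Measurable fun q : Gain m p × (Fin N → Gain m p × EuclideanSpace ℝ (Fin n)) =>
        gradient (S.costReal μ γ) q.1 := by
      have h := (measurable_gradient (S.costReal μ γ)).comp hfst
      exact h
    exact (hfst (Plant.measurableSet_sublevel hγ ν)).inter
      (measurableSet_lt measurable_const (h1.sub h2).norm)
  obtain ⟨hXm, hind⟩ := Plant.aemeasurable_iterate_and_indepFun (S := S) (γ := γ) (τ := τ) (r := r)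
    (η := η) K₀ hZm hZind j
  refine measureReal_mem_le_of_indepFun hXm (aemeasurable_pi_lambda _ fun i => hZm _ _) hind hs hc
    fun K => ?_
  rw [hlaw]
  -- Membership in the sublevel set is part of the event, so slices at other gains are empty and
  -- need no estimate.
  by_cases hK : K ∈ S.sublevel μ γ ν
  · exact (measureReal_mono fun z hz => hz.2).trans (hfix K hK)
  · refine le_of_eq_of_le (congrArg _ ?_) (measureReal_empty.trans_le hc)
    exact Set.eq_empty_of_forall_notMem fun z hz => hK hz.1

end Iterates

/-! ### Descent along accurate estimates -/

section Descent

variable {n m p : ℕ} {S : Plant n m p} {γ : ℝ} {μ : Measure (EuclideanSpace ℝ (Fin n))} {d : ℝ}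
  {K : Gain m p} {ℓ₀ ℓ₁ ψ φ ν : ℝ}

lemma constL_pos (hℓ₀ : 0 < ℓ₀) (hℓ : ℓ₀ ≤ ℓ₁) (hν : 0 < ν) (hψ : 1 ≤ ψ) (hφ : 1 ≤ φ)
    (hm : 0 < m) (hp : 0 < p) : 0 < constL m p ν ℓ₀ ℓ₁ ψ φ := by
  have := kap_pos hℓ₀ hν
  have hℓ₁ : 0 < ℓ₁ := hℓ₀.trans_le hℓ
  have h1 : (0 : ℝ) < (min m p : ℕ) := by exact_mod_cast (by omega : 0 < min m p)
  rw [constL]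
  positivity

/-- One step along an `ε/3`-accurate gradient estimate that is not small lowers the cost. -/
lemma cost_step_le (hℓ₀ : 0 < ℓ₀) (hℓ : ℓ₀ ≤ ℓ₁) (hψ : 1 ≤ ψ) (hφ : 1 ≤ φ)
    (hS : S.Bounded ℓ₀ ℓ₁ ψ φ) (hμ : IsInitialLaw μ d) (hγ0 : 0 < γ) (hγ1 : γ < 1)
    (hν : 0 < ν) (hn : 0 < n) (hm : 0 < m) (hp : 0 < p) (hK : K ∈ S.sublevel μ γ ν)
    {ε η r : ℝ} (hε : 0 < ε) (hη : 0 < η)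
    (hrD : r ≤ constD ν ℓ₀ ψ φ) (hrG : r ≤ ν / constG ν ℓ₀ ℓ₁ ψ φ)
    (hηD : η ≤ constD ν ℓ₀ ψ φ / (constG0 m p ν ℓ₀ ℓ₁ ψ φ + ε))
    (hηL : η ≤ 1 / (2 * constL m p ν ℓ₀ ℓ₁ ψ φ)) {v : Gain m p}
    (hv : 2 * ε / 3 < ‖v‖) (hacc : ‖v - gradient (S.costReal μ γ) K‖ ≤ ε / 3) :
    S.cost μ γ (K - η • v) ≤ S.cost μ γ K ∧
      S.costReal μ γ (K - η • v) ≤ S.costReal μ γ K - η * ε ^ 2 / 9 := by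
  have hκ1 := one_le_kap hℓ₀ hℓ hψ hφ hS hμ hγ0 hγ1 hν hn hK
  have hκ0 : 0 < kap ν ℓ₀ := by linarith
  have hℓ₁ : 0 < ℓ₁ := hℓ₀.trans_le hℓ
  have hψ0 : 0 < ψ := by linarith
  have hφ0 : 0 < φ := by linarith
  have H := regularAt_gradient hℓ₀ hℓ hψ hφ hS hμ hγ0 hγ1 hν hn hK 0 hrD hrG
  have hquad := quadConst_le hℓ₀ hℓ hν hψ hφ hm hp
  have hL := constL_pos hℓ₀ hℓ hν hψ hφ hm hp
  have hD := constD_pos hℓ₀ hν hψ hφ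
  have hlip : lipConst ν ℓ₀ ℓ₁ ψ φ ≤ 80 * constD ν ℓ₀ ψ φ * (quadConst ν ℓ₀ ℓ₁ ψ φ / 27) := by
    rw [lipConst, quadConst, constD]
    have : 80 * (1 / (8 * kap ν ℓ₀ ^ 3 * ψ * φ)) * (27 * kap ν ℓ₀ ^ 10 * ℓ₁ * ψ ^ 2 * φ ^ 2 / 27)
        = 10 * kap ν ℓ₀ ^ 7 * ℓ₁ * ψ * φ := by field_simp; norm_num
    rw [this]
  have hc₁ : 0 ≤ lipConst ν ℓ₀ ℓ₁ ψ φ := by rw [lipConst]; positivity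
  have hc₂ : 0 ≤ quadConst ν ℓ₀ ℓ₁ ψ φ := by rw [quadConst]; positivity
  have hG0 : 0 ≤ constG0 m p ν ℓ₀ ℓ₁ ψ φ := by rw [constG0]; positivity
  have hg := H.norm_gradient_le hD hc₁
  set g := gradient (S.costReal μ γ) K
  set L := constL m p ν ℓ₀ ℓ₁ ψ φ
  set D := constD ν ℓ₀ ψ φ
  set c₂ := quadConst ν ℓ₀ ℓ₁ ψ φ
  have hηL' : η * L ≤ 1 / 2 := by
    rw [le_div_iff₀ (by positivity)] at hηL; linarith
  have hηε : η * ε ≤ D := by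
    rw [le_div_iff₀ (by positivity)] at hηD
    nlinarith
  have hηg : η * ‖g‖ ≤ 2 / 3 * D := by
    have h1 : ‖g‖ ≤ 80 / 104 * D * L := by
      refine (hg.trans hlip).trans ?_
      have : D * (104 / 27 * c₂) ≤ D * L := by gcongr
      linarith
    calc η * ‖g‖ ≤ η * (80 / 104 * D * L) := by gcongr
      _ = 80 / 104 * D * (η * L) := by ring
      _ ≤ 80 / 104 * D * (1 / 2) := by gcongr
      _ ≤ _ := by linarith
  -- The step stays in the ball where the regularity bounds hold: `η ‖g‖` uses at most `2D/3` and
  -- the estimation error at most `D/3`.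
  have hstep : ‖-(η • v)‖ ≤ D := by
    rw [norm_neg, norm_smul, Real.norm_of_nonneg hη.le]
    have h1 : ‖v‖ ≤ ‖g‖ + ε / 3 := by
      have := norm_add_le g (v - g)
      rw [add_sub_cancel] at this
      linarith
    have h2 : η * ‖v‖ ≤ η * (‖g‖ + ε / 3) := by gcongr
    linarith
  have hdec : S.costReal μ γ (K - η • v) ≤ S.costReal μ γ K - η * ε ^ 2 / 9 := by
    have h1 := (abs_le.1 (H.quad (-(η • v)) 0 hstep (by simpa using hD.le))).2
    simp only [norm_zero, add_zero, sub_zero, norm_neg, norm_smul, Real.norm_of_nonneg hη.le,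
      inner_neg_right, inner_smul_right, ← sub_eq_add_neg] at h1
    -- The error `ε/3` is less than `‖v‖/2`, since `‖v‖` exceeds `2ε/3`.
    have h2 : ‖v‖ ^ 2 / 2 ≤ inner ℝ g v := by
      have h3 : inner ℝ (v - g) v ≤ ε / 3 * ‖v‖ :=
        (real_inner_le_norm _ _).trans (by gcongr)
      rw [inner_sub_left, real_inner_self_eq_norm_sq] at h3
      nlinarith
    have h4 : η * (‖v‖ ^ 2 / 2) ≤ η * inner ℝ g v := by gcongr
    have h5 : c₂ * (η * ‖v‖) * (η * ‖v‖) ≤ η * ‖v‖ ^ 2 / 4 := by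
      have : η * c₂ ≤ 1 / 4 := by nlinarith
      calc _ = η * c₂ * (η * ‖v‖ ^ 2) := by ring
        _ ≤ 1 / 4 * (η * ‖v‖ ^ 2) := by gcongr
        _ = _ := by ring
    have h6 : η * (2 * ε / 3) ^ 2 ≤ η * ‖v‖ ^ 2 := by gcongr
    -- First order gain `η ‖v‖²/2` minus second order loss `η ‖v‖²/4` leaves `η ‖v‖²/4 ≥ η ε²/9`.
    linarith
  refine ⟨?_, hdec⟩
  have h1 : S.cost μ γ (K - η • v) ≠ ⊤ := by
    rw [sub_eq_add_neg]; exact H.cost_ne_top _ hstep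
  have h2 : S.cost μ γ K ≠ ⊤ := ne_top_of_le_ne_top ENNReal.ofReal_ne_top hK
  rw [← ENNReal.toReal_le_toReal h1 h2]
  exact hdec.trans (sub_le_self _ (by positivity))

/-- If the gradient estimates are `ε/3`-accurate along the run, the method stops in time. -/
lemma exists_stopsAt (hℓ₀ : 0 < ℓ₀) (hℓ : ℓ₀ ≤ ℓ₁) (hψ : 1 ≤ ψ) (hφ : 1 ≤ φ)
    (hS : S.Bounded ℓ₀ ℓ₁ ψ φ) (hμ : IsInitialLaw μ d) (hγ0 : 0 < γ) (hγ1 : γ < 1)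
    (hν : 0 < ν) (hn : 0 < n) (hm : 0 < m) (hp : 0 < p) {K₀ : Gain m p}
    (hK₀ : K₀ ∈ S.sublevel μ γ ν) {ε η r : ℝ} (hε : 0 < ε) (hη : 0 < η)
    (hrD : r ≤ constD ν ℓ₀ ψ φ) (hrG : r ≤ ν / constG ν ℓ₀ ℓ₁ ψ φ)
    (hηD : η ≤ constD ν ℓ₀ ψ φ / (constG0 m p ν ℓ₀ ℓ₁ ψ φ + ε))
    (hηL : η ≤ 1 / (2 * constL m p ν ℓ₀ ℓ₁ ψ φ)) {M : ℝ}
    (hM : 9 * S.costReal μ γ K₀ / (η * ε ^ 2) ≤ M) {τ N : ℕ}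
    {z : ℕ → Fin N → Gain m p × EuclideanSpace ℝ (Fin n)}
    (hz : ∀ j : ℕ, (j : ℝ) ≤ M → S.iterate γ τ r η z K₀ j ∈ S.sublevel μ γ ν →
      ‖S.gradEst γ τ r (z j) (S.iterate γ τ r η z K₀ j)
        - gradient (S.costReal μ γ) (S.iterate γ τ r η z K₀ j)‖ ≤ ε / 3) :
    ∃ j : ℕ, (j : ℝ) ≤ M ∧ S.StopsAt γ τ r η ε z K₀ j ∧
      (∀ i < j, S.cost μ γ (S.iterate γ τ r η z K₀ (i + 1))
        ≤ S.cost μ γ (S.iterate γ τ r η z K₀ i)) ∧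
      DifferentiableAt ℝ (S.costReal μ γ) (S.iterate γ τ r η z K₀ j) ∧
      ‖gradient (S.costReal μ γ) (S.iterate γ τ r η z K₀ j)‖ ≤ ε := by
  classical
  set k := S.iterate γ τ r η z K₀ with hk
  have hstep : ∀ i : ℕ, (i : ℝ) ≤ M → k i ∈ S.sublevel μ γ ν →
      2 * ε / 3 < ‖S.gradEst γ τ r (z i) (k i)‖ →
      S.cost μ γ (k (i + 1)) ≤ S.cost μ γ (k i) ∧
        S.costReal μ γ (k (i + 1)) ≤ S.costReal μ γ (k i) - η * ε ^ 2 / 9 :=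
    fun i hi hmem hbig => cost_step_le hℓ₀ hℓ hψ hφ hS hμ hγ0 hγ1 hν hn hm hp hmem hε hη hrD hrG
      hηD hηL hbig (hz i hi hmem)
  have hM0 : 0 ≤ M := le_trans (div_nonneg (mul_nonneg (by norm_num) ENNReal.toReal_nonneg)
    (by positivity)) hM
  -- The range reaches `M + 1` because the contradiction below evaluates the cost at `⌊M⌋₊ + 1`,
  -- strictly beyond `M`, where it would be negative.
  have hrun : ∀ j : ℕ, (j : ℝ) ≤ M + 1 → (∀ i < j, 2 * ε / 3 < ‖S.gradEst γ τ r (z i) (k i)‖) →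
      k j ∈ S.sublevel μ γ ν ∧ S.costReal μ γ (k j) ≤ S.costReal μ γ K₀ - j * (η * ε ^ 2 / 9) := by
    intro j
    induction j with
    | zero => intro _ _; exact ⟨hK₀, by simp [hk, Plant.iterate]⟩
    | succ j ih =>
      intro hj hbig
      push_cast at hj
      obtain ⟨h1, h2⟩ := ih (by linarith) fun i hi => hbig i (by omega)
      obtain ⟨h3, h4⟩ := hstep j (by linarith) h1 (hbig j (by omega))
      refine ⟨h3.trans h1, h4.trans ?_⟩
      push_cast
      linarith
  have hex : ∃ j : ℕ, ‖S.gradEst γ τ r (z j) (k j)‖ ≤ 2 * ε / 3 ∧ (j : ℝ) ≤ M := by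
    by_contra! hcon
    have hbig : ∀ i < ⌊M⌋₊ + 1, 2 * ε / 3 < ‖S.gradEst γ τ r (z i) (k i)‖ := by
      intro i hi
      by_contra! hle
      have h1 := hcon i hle
      have h2 : (i : ℝ) ≤ ⌊M⌋₊ := by exact_mod_cast (by omega : i ≤ ⌊M⌋₊)
      linarith [Nat.floor_le hM0]
    have h1 := (hrun (⌊M⌋₊ + 1) (by push_cast; linarith [Nat.floor_le hM0]) hbig).2
    have h2 : 0 ≤ S.costReal μ γ (k (⌊M⌋₊ + 1)) := ENNReal.toReal_nonneg
    have h3 := Nat.lt_floor_add_one M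
    rw [div_le_iff₀ (by positivity)] at hM
    have h4 : M * (η * ε ^ 2) < (⌊M⌋₊ + 1) * (η * ε ^ 2) := by gcongr
    push_cast at h1
    linarith
  obtain ⟨h1, h2⟩ := Nat.find_spec hex
  set j := Nat.find hex
  have hle : ∀ i < j, (i : ℝ) ≤ M := fun i hi => le_trans (by exact_mod_cast hi.le) h2
  have hbig : ∀ i < j, 2 * ε / 3 < ‖S.gradEst γ τ r (z i) (k i)‖ := by
    intro i hi
    by_contra! hcon
    exact Nat.find_min hex hi ⟨hcon, hle i hi⟩
  have hmem : ∀ i ≤ j, k i ∈ S.sublevel μ γ ν := fun i hi =>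
    (hrun i (by have : (i : ℝ) ≤ j := by exact_mod_cast hi
                linarith) fun i' hi' => hbig i' (by omega)).1
  refine ⟨j, h2, ⟨h1, hbig⟩, fun i hi => (hstep i (hle i hi) (hmem i hi.le) (hbig i hi)).1, ?_, ?_⟩
  · exact ((regularAt_gradient hℓ₀ hℓ hψ hφ hS hμ hγ0 hγ1 hν hn (hmem j le_rfl) 0 hrD
      hrG).hasGradientAt (constD_pos hℓ₀ hν hψ hφ)).differentiableAt
  · have h3 := hz j h2 (hmem j le_rfl)
    have h4 := norm_sub_norm_le (gradient (S.costReal μ γ) (k j)) (S.gradEst γ τ r (z j) (k j))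
    rw [norm_sub_rev] at h4
    linarith

end Descent

/-! ### The degenerate case of an empty state -/

section NoState

variable {m p : ℕ} (S : Plant 0 m p) (γ : ℝ)

lemma Plant.stage_of_isEmpty (K : Gain m p) (x : Fin 0 → ℝ) : S.stage K x = 0 := by
  have h1 : S.C *ᵥ x = 0 := by
    rw [Subsingleton.elim x 0, Matrix.mulVec_zero]
  simp [Plant.stage, Plant.input, h1]

lemma Plant.cost_of_isEmpty (μ : Measure (EuclideanSpace ℝ (Fin 0))) (K : Gain m p) :
    S.cost μ γ K = 0 := by
  simp [Plant.cost, Plant.stage_of_isEmpty]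

lemma Plant.gradEst_of_isEmpty (τ : ℕ) (r : ℝ) {N : ℕ}
    (z : Fin N → Gain m p × EuclideanSpace ℝ (Fin 0)) (K : Gain m p) :
    S.gradEst γ τ r z K = 0 := by
  simp [Plant.gradEst, Plant.rollout, Plant.stage_of_isEmpty]

end NoState

end SOF

theorem theorem1 {n m p : ℕ} (S : SOF.Plant n m p)
    (ℓ₀ ℓ₁ ψ φ : ℝ) (hℓ₀ : 0 < ℓ₀) (hℓ : ℓ₀ ≤ ℓ₁) (hψ : 1 ≤ ψ) (hφ : 1 ≤ φ)
    (hS : S.Bounded ℓ₀ ℓ₁ ψ φ)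
    (μ : Measure (EuclideanSpace ℝ (Fin n))) (d : ℝ) (hd : 0 < d) (hμ : SOF.IsInitialLaw μ d)
    (γ : ℝ) (hγ0 : 0 < γ) (hγ1 : γ < 1)
    (ν : ℝ) (K₀ : SOF.Gain m p) (hK₀ : K₀ ∈ S.sublevel μ γ ν)
    (ε : ℝ) (hε : 0 < ε) (δ₀ : ℝ) (hδ₀ : 0 < δ₀)
    (τ N : ℕ) (r η : ℝ) (hr : 0 < r) (hη : 0 < η)
    (hτ : 2 * ν / ℓ₀ * Real.log (36 * d ^ 2 * ν ^ 2 * m * p / (r * ε * ℓ₀)) ≤ τ)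
    (hrD : r ≤ SOF.constD ν ℓ₀ ψ φ)
    (hrG : r ≤ ν / SOF.constG ν ℓ₀ ℓ₁ ψ φ)
    (hrL : r ≤ ε / (9 * SOF.constL m p ν ℓ₀ ℓ₁ ψ φ))
    (hN : 81 * (m * p * SOF.constG ν ℓ₀ ℓ₁ ψ φ) ^ 2 * (d ^ 2 + 1) ^ 2 / ε ^ 2
      * Real.log (15 / δ₀) ≤ N)
    (hηD : η ≤ SOF.constD ν ℓ₀ ψ φ / (SOF.constG0 m p ν ℓ₀ ℓ₁ ψ φ + ε))
    (hηL : η ≤ 1 / (2 * SOF.constL m p ν ℓ₀ ℓ₁ ψ φ))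
    (M : ℝ) (hM : 9 * S.costReal μ γ K₀ / (η * ε ^ 2) ≤ M)
    {Ω : Type*} [MeasurableSpace Ω] (P : Measure Ω) [IsProbabilityMeasure P]
    (Z : ℕ → Fin N → Ω → SOF.Gain m p × EuclideanSpace ℝ (Fin n))
    (hZlaw : ∀ j i, HasLaw (Z j i) ((stdGaussian (SOF.Gain m p)).prod μ) P)
    (hZind : iIndepFun (fun q : ℕ × Fin N => Z q.1 q.2) P) :
    ∃ E : Set Ω, MeasurableSet E ∧ 1 - (M + 1) * δ₀ ≤ P.real E ∧
      ∀ ω ∈ E, ∃ j : ℕ, (j : ℝ) ≤ M ∧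
        S.StopsAt γ τ r η ε (fun k i => Z k i ω) K₀ j ∧
        (∀ i < j, S.cost μ γ (S.iterate γ τ r η (fun k i => Z k i ω) K₀ (i + 1))
          ≤ S.cost μ γ (S.iterate γ τ r η (fun k i => Z k i ω) K₀ i)) ∧
        DifferentiableAt ℝ (S.costReal μ γ) (S.iterate γ τ r η (fun k i => Z k i ω) K₀ j) ∧
        ‖gradient (S.costReal μ γ) (S.iterate γ τ r η (fun k i => Z k i ω) K₀ j)‖ ≤ ε := by
  have hM0 : 0 ≤ M := le_trans (div_nonneg (mul_nonneg (by norm_num) ENNReal.toReal_nonneg)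
    (by positivity)) hM
  have := hμ.prob
  rcases Nat.eq_zero_or_pos n with rfl | hn
  · refine ⟨Set.univ, MeasurableSet.univ, ?_, fun ω _ => ⟨0, by simpa using hM0, ⟨?_, ?_⟩, ?_, ?_⟩⟩
    · rw [probReal_univ]
      have : 0 ≤ (M + 1) * δ₀ := by positivity
      linarith
    · rw [SOF.Plant.gradEst_of_isEmpty, norm_zero]
      positivity
    · exact fun i hi => absurd hi (Nat.not_lt_zero i)
    · exact fun i hi => absurd hi (Nat.not_lt_zero i)
    · have hconst : S.costReal μ γ = fun _ => 0 := by
        funext K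
        simp [SOF.Plant.costReal, SOF.Plant.cost_of_isEmpty]
      rw [hconst]
      exact ⟨differentiableAt_const _, by simpa [gradient_fun_const] using hε.le⟩
  -- For `ν ≤ 0` the conventions for square roots and division give `κ = 0` and `D = 0`,
  -- contradicting `0 < r ≤ D`. Likewise `min m p = 0` below gives `L = 0`, so that the bound on `r`
  -- in terms of `L` becomes `r ≤ 0`.
  have hν : 0 < ν := by
    by_contra! h
    have h1 : SOF.kap ν ℓ₀ = 0 := Real.sqrt_eq_zero_of_nonpos (div_nonpos_of_nonpos_of_nonneg h hℓ₀.le)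
    rw [SOF.constD, h1] at hrD
    norm_num at hrD
    linarith
  have hmp : 0 < min m p := by
    by_contra! h
    rw [SOF.constL, Nat.le_zero.1 h] at hrL
    norm_num at hrL
    linarith
  have hm : 0 < m := by omega
  have hp : 0 < p := by omega
  -- For `1 ≤ δ₀` the claimed probability is not positive, and the empty event suffices.
  rcases le_or_gt 1 δ₀ with hδ₁ | hδ₁
  · refine ⟨∅, MeasurableSet.empty, ?_, fun ω hω => hω.elim⟩
    rw [measureReal_empty]
    nlinarith
  set bad : ℕ → Set Ω := fun j =>
    {ω | S.iterate γ τ r η (fun k i => Z k i ω) K₀ j ∈ S.sublevel μ γ ν ∧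
      ε / 3 < ‖S.gradEst γ τ r (fun i => Z j i ω) (S.iterate γ τ r η (fun k i => Z k i ω) K₀ j)
        - gradient (S.costReal μ γ) (S.iterate γ τ r η (fun k i => Z k i ω) K₀ j)‖} with hbad
  have hbad_le : ∀ j, P.real (bad j) ≤ δ₀ := fun j =>
    SOF.measureReal_iterate_error_le hγ0.le hδ₀.le τ r η K₀
      (fun K hK => SOF.measureReal_gradEst_error_le hℓ₀ hℓ hψ hφ hS hd hμ hγ0 hγ1 hν hn hm hp hK hε
        hδ₀ hδ₁ hr hτ hrD hrG hrL hN) hZlaw hZind j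
  -- The samples are only almost everywhere measurable, so the bad event is replaced by a measurable
  -- hull of the same measure.
  set U : Set Ω := toMeasurable P (⋃ j ∈ Finset.range (⌊M⌋₊ + 1), bad j) with hU
  have hU_le : P.real U ≤ (M + 1) * δ₀ := by
    rw [hU, measureReal_def, measure_toMeasurable, ← measureReal_def]
    calc _ ≤ ∑ j ∈ Finset.range (⌊M⌋₊ + 1), P.real (bad j) := measureReal_biUnion_finset_le _ _
      _ ≤ ∑ j ∈ Finset.range (⌊M⌋₊ + 1), δ₀ := Finset.sum_le_sum fun j _ => hbad_le j
      _ = (⌊M⌋₊ + 1) * δ₀ := by simp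
      _ ≤ (M + 1) * δ₀ := by gcongr; exact Nat.floor_le hM0
  refine ⟨Uᶜ, (measurableSet_toMeasurable _ _).compl, ?_, fun ω hω => ?_⟩
  · rw [probReal_compl_eq_one_sub (measurableSet_toMeasurable _ _)]
    linarith
  · refine SOF.exists_stopsAt hℓ₀ hℓ hψ hφ hS hμ hγ0 hγ1 hν hn hm hp hK₀ hε hη hrD hrG hηD hηL hM
      fun j hj hmem => ?_
    by_contra! hcon
    refine hω (subset_toMeasurable _ _ (Set.mem_biUnion (x := j) ?_ ⟨hmem, hcon⟩))
    exact Finset.mem_coe.2 (Finset.mem_range.2 (Nat.lt_succ_of_le (Nat.le_floor hj)))
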